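/- **Setting.** Let $\bar M$ be a smooth compact (Hausdorff) $3$-manifold with boundary $\partial M$ and interior $M$, with an orientation of each tangent space (used only to define the cross product $\times_g$; e.g. $\bar M$ oriented). Fix a smooth defining function $\rho:\bar M\to[0,\infty)$, i.e. $\rho^{-1}(0)=\partial M$ and $d\rho\ne0$ along $\partial M$, and a smooth Riemannian metric $\bar h$ on $\bar M$ with $|d\rho|_{\bar h}=1$ along $\partial M$, with Levi-Civita connection $\bar\nabla$; put $h=\rho^{-2}\bar h$ on $M$. For a tensor of covariant rank $p$ and contravariant rank $q$ put $r=p-q$. *Function spaces.* $C^{k,\alpha}_\delta(M)=\rho^\delta C^{k,\alpha}(M)$ are the weighted Hölder spaces of tensor fields on $M$ with respect to $h$: $u\in C^{k,\alpha}_\delta(M)$ iff in every smooth chart of $\bar M$ and for every compact subset $S$ of its domain, the components $u_I$ are $C^k$ on $M$ and there is a constant $C$ with $\rho^{r-\delta+j}|D^ju_I|\le C$ on $S\cap M$ for $0\le j\le k$, and $\rho(x)^{r-\delta+k+\alpha}|D^ku_I(x)-D^ku_I(y)|\le C|x-y|^\alpha$ for $x,y\in S\cap M$ with $|x-y|\le\min(\rho(x),\rho(y))$.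 For a covariant tensor field $u$ of rank $r$, $u\in\mathscr C^{k,\alpha;m}(M)$ means $\bar\nabla^l u\in C^{k-l,\alpha}_{r+l}(M)$ for $0\le l\le m$. *Data.* Let $k\ge2$ be an integer and $\alpha\in(0,1)$. Let $g$ be a Riemannian metric on $M$, $K$ a symmetric covariant $2$-tensor field on $M$, $E,B,J$ vector fields on $M$ and $\xi\geq 0$ a function on $M$; put $\bar g=\rho^2g$, $\Sigma=K+g$, $\bar\Sigma=\rho\Sigma$, $\tau=\operatorname{tr}_gK$. Suppose that 1. $\bar g\in\mathscr C^{k,\alpha;2}(M)$, the continuous extension of $\bar g$ to $\bar M$ is nondegenerate, and $|d\rho|_{\bar g}=1$ along $\partial M$; 2. $\Sigma$ is traceless with respect to $g$ and $\bar\Sigma\in\mathscr C^{k-1,\alpha;1}(M)$; 3. $E,B\in C^{k-2,\alpha}_1(M)$ and $J,\xi\in C^{k-2,\alpha}_2(M)$; 4. the constraint equations hold on $M$: $$R[g]-|K|_g^2+\tau^2=|E|_g^2+|B|_g^2+2\xi,\qquad \operatorname{div}_gK-d\tau=(E\times_gB+J)^\flat,\qquad \operatorname{div}_gE=\operatorname{div}_gB=0,$$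 the last two equations in the sense of distributions. *The tensor $\mathcal H$.* With $\mathcal D_{\bar g}X=\frac12\mathcal L_X\bar g-\frac13(\operatorname{div}_{\bar g}X)\bar g$ and $A_{\bar g}(\rho)=\frac12|d\rho|_{\bar g}\operatorname{div}_{\bar g}\big(|d\rho|_{\bar g}\operatorname{grad}_{\bar g}\rho\big)$ let $$\mathcal H_{\bar g}(\rho)=|d\rho|_{\bar g}^6\,\mathcal D_{\bar g}\big(|d\rho|_{\bar g}^{-2}\operatorname{grad}_{\bar g}\rho\big)+A_{\bar g}(\rho)\Big(d\rho\otimes d\rho-\tfrac13|d\rho|_{\bar g}^2\,\bar g\Big)$$ (extended by $0$ to the critical points of $\rho$). It is the conformally covariant traceless Hessian of $\rho$. **Statement.** The following are equivalent: 1. (shear-free condition) $\displaystyle\bar\Sigma\big|_{\partial M}=\Big[\operatorname{Hess}_{\bar g}\rho-\tfrac13(\Delta_{\bar g}\rho)\,\bar g\Big]_{\partial M}$; 2. $\bar\Sigma\big|_{\partial M}=\mathcal H_{\bar g}(\rho)\big|_{\partial M}$; 3. $\bar\Sigma-\mathcal H_{\bar g}(\rho)\in C^{k-1,\alpha}_3(M)$.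 In 1 and 2 the equality means that both tensor fields extend continuously from $M$ to $\partial M$ and that the extensions agree there. (Here $\mathcal H_{\bar g}(\rho)=\mathcal H_{\rho^2g}(\rho)$.) -/

import Mathlib

open Set Filter Topology MeasureTheory Bundle Manifold
open scoped Manifold ContDiff

noncomputable section

namespace Hyperboloidal

/-- The coordinate space of charts of a 3-manifold with boundary. -/
abbrev E3 : Type := EuclideanSpace ℝ (Fin 3)

/-- The model with corners of 3-manifolds with boundary: the half space `0 ≤ x 0`. -/
abbrev I3 : ModelWithCorners ℝ E3 (EuclideanHalfSpace 3) := 𝓡∂ 3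

section Charts

variable (M : Type*) [TopologicalSpace M] [ChartedSpace (EuclideanHalfSpace 3) M]

/-- Charts of `M`, as partial homeomorphisms to the half space. -/
abbrev Chart := OpenPartialHomeomorph M (EuclideanHalfSpace 3)

/-- The smooth charts of `M`: all charts of the maximal smooth atlas. -/
abbrev smoothCharts : Set (Chart M) := IsManifold.maximalAtlas I3 ∞ M

/-- Component functions, one for each chart, point of coordinate space and index in `ι`. For a
covariant `n`-tensor `ι = (Fin n → Fin 3)`, for a vector field `ι = Fin 3`. Only the values on the
chart domains (see `dom`) of smooth charts matter. -/
abbrev Comps (ι : Type) := Chart M → E3 → ι → ℝ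

/-- Components of a covariant `n`-tensor. -/
abbrev CovComps (n : ℕ) := Comps M (Fin n → Fin 3)

/-- A (not necessarily continuous) covariant 2-tensor field. -/
abbrev Cov2 := ∀ p : M, TangentSpace I3 p →L[ℝ] TangentSpace I3 p →L[ℝ] ℝ

/-- A (not necessarily continuous) vector field. -/
abbrev VecField := ∀ p : M, TangentSpace I3 p

variable {M}

/-- The set in coordinate space which corresponds to the part of the chart in the manifold
interior. It is an open subset of `E3`. -/
def dom (φ : Chart M) : Set E3 :=
  (φ.extend I3).target ∩ (φ.extend I3).symm ⁻¹' I3.interior M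

/-- The coordinate vector `∂ᵢ` of the chart `φ` at the point with coordinates `x`. -/
def coordVec (φ : Chart M) (x : E3) (i : Fin 3) : TangentSpace I3 ((φ.extend I3).symm x) :=
  mfderivWithin 𝓘(ℝ, E3) I3 (φ.extend I3).symm (range I3) x
    (EuclideanSpace.single i (1 : ℝ) : E3)

/-- Components of a function. -/
def scalarComps (f : M → ℝ) : CovComps M 0 := fun φ x _ => f ((φ.extend I3).symm x)

/-- Components `Xⁱ` of a vector field. -/
def vecComps (X : VecField M) : Comps M (Fin 3) := fun φ x i =>
  (show E3 from mfderiv I3 𝓘(ℝ, E3) (φ.extend I3) ((φ.extend I3).symm x)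
    (X ((φ.extend I3).symm x))) i

/-- Components `u_{ij}` of a covariant 2-tensor field. -/
def cov2Comps (u : Cov2 M) : CovComps M 2 := fun φ x J =>
  u ((φ.extend I3).symm x) (coordVec φ x (J 0)) (coordVec φ x (J 1))

end Charts

section LocalFormulas

/-- The partial derivative `∂ᵢ f` at an interior point of coordinate space. -/
def pd (i : Fin 3) (f : E3 → ℝ) (x : E3) : ℝ :=
  fderiv ℝ f x (EuclideanSpace.single i (1 : ℝ))

variable (G : E3 → Matrix (Fin 3) (Fin 3) ℝ)

/-- Christoffel symbols `Γ^l_{ij}` of the metric with matrix `G`. -/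
def christoffel (l i j : Fin 3) (x : E3) : ℝ :=
  (1 / 2) * ∑ m, (G x)⁻¹ l m *
    (pd i (fun y => G y m j) x + pd j (fun y => G y m i) x - pd m (fun y => G y i j) x)

/-- Ricci curvature
`R_{ij} = ∂_l Γ^l_{ij} - ∂_j Γ^l_{il} + Γ^l_{lm} Γ^m_{ij} - Γ^l_{jm} Γ^m_{il}`. -/
def ricci (i j : Fin 3) (x : E3) : ℝ :=
  ∑ l, (pd l (christoffel G l i j) x - pd j (christoffel G l i l) x
    + ∑ m, (christoffel G l l m x * christoffel G m i j x
      - christoffel G l j m x * christoffel G m i l x))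

/-- Scalar curvature. -/
def scalarCurv (x : E3) : ℝ := ∑ i, ∑ j, (G x)⁻¹ i j * ricci G i j x

/-- The trace `G^{ij} T_{ij}`. -/
def trG (T : Matrix (Fin 3) (Fin 3) ℝ) (x : E3) : ℝ := ∑ i, ∑ j, (G x)⁻¹ i j * T i j

/-- `|T|²` for a covariant 2-tensor `T`. -/
def normSqCov2 (T : Matrix (Fin 3) (Fin 3) ℝ) (x : E3) : ℝ :=
  ∑ i, ∑ j, ∑ k, ∑ l, (G x)⁻¹ i k * (G x)⁻¹ j l * T i j * T k l

/-- `|X|²` for a vector `X`. -/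
def normSqVec (X : Fin 3 → ℝ) (x : E3) : ℝ := ∑ i, ∑ j, G x i j * X i * X j

/-- The gradient `(grad f)^i = G^{ij} ∂_j f`. -/
def gradient (f : E3 → ℝ) (i : Fin 3) (x : E3) : ℝ := ∑ j, (G x)⁻¹ i j * pd j f x

/-- `|df|` with respect to `G`. -/
def normD (f : E3 → ℝ) (x : E3) : ℝ :=
  Real.sqrt (∑ i, ∑ j, (G x)⁻¹ i j * pd i f x * pd j f x)

/-- The Hessian `∂_i ∂_j f - Γ^l_{ij} ∂_l f`. -/
def hessian (f : E3 → ℝ) (i j : Fin 3) (x : E3) : ℝ :=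
  pd i (pd j f) x - ∑ l, christoffel G l i j x * pd l f x

/-- The Laplacian, the trace of the Hessian. -/
def laplacian (f : E3 → ℝ) (x : E3) : ℝ :=
  trG G (Matrix.of fun i j => hessian G f i j x) x

/-- The divergence `∂_i X^i + Γ^i_{il} X^l` of a differentiable vector field. -/
def divVec (X : Fin 3 → E3 → ℝ) (x : E3) : ℝ :=
  ∑ i, (pd i (X i) x + ∑ l, christoffel G i i l x * X l x)

/-- The divergence `(Div T)_j = G^{ik} ∇_i T_{kj}` of a differentiable covariant 2-tensor field. -/
def divCov2 (T : E3 → Matrix (Fin 3) (Fin 3) ℝ) (j : Fin 3) (x : E3) : ℝ :=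
  ∑ i, ∑ k, (G x)⁻¹ i k * (pd i (fun y => T y k j) x
    - ∑ l, (christoffel G l i k x * T x l j + christoffel G l i j x * T x k l))

/-- The Lie derivative `(L_X G)_{ij} = X^l ∂_l G_{ij} + G_{lj} ∂_i X^l + G_{il} ∂_j X^l`. -/
def lieMetric (X : Fin 3 → E3 → ℝ) (i j : Fin 3) (x : E3) : ℝ :=
  ∑ l, (X l x * pd l (fun y => G y i j) x + G x l j * pd i (X l) x + G x i l * pd j (X l) x)

/-- The conformal Killing (Ahlfors) operator `½ L_X G - ⅓ (Div X) G`. -/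
def ahlfors (X : Fin 3 → E3 → ℝ) (i j : Fin 3) (x : E3) : ℝ :=
  (1 / 2) * lieMetric G X i j x - (1 / 3) * divVec G X x * G x i j

/-- The traceless Hessian `Hess f - ⅓ (Δ f) G`. -/
def tracelessHess (f : E3 → ℝ) (i j : Fin 3) (x : E3) : ℝ :=
  hessian G f i j x - (1 / 3) * laplacian G f x * G x i j

/-- `A_G(f) = ½ |df| Div (|df| grad f)`. -/
def calA (f : E3 → ℝ) (x : E3) : ℝ :=
  (1 / 2) * normD G f x * divVec G (fun i y => normD G f y * gradient G f i y) x

/-- The conformally covariant traceless Hessian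
`|df|⁶ D(|df|⁻² grad f) + A_G(f) (df ⊗ df - ⅓ |df|² G)`. At critical points of `f` both terms are
zero, which is also the value of the expanded expression, a polynomial in `G`, its inverse and the
derivatives of `G` and `f`. -/
def calH (f : E3 → ℝ) (i j : Fin 3) (x : E3) : ℝ :=
  normD G f x ^ 6 * ahlfors G (fun l y => (normD G f y ^ 2)⁻¹ * gradient G f l y) i j x
    + calA G f x * (pd i f x * pd j f x - (1 / 3) * normD G f x ^ 2 * G x i j)

end LocalFormulas

section Fields

variable {M : Type*} [TopologicalSpace M] [ChartedSpace (EuclideanHalfSpace 3) M]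

/-- The matrix of a covariant 2-tensor in a chart. -/
def mat (u : CovComps M 2) (φ : Chart M) (x : E3) : Matrix (Fin 3) (Fin 3) ℝ :=
  Matrix.of fun i j => u φ x ![i, j]

/-- A function in a chart. -/
def inChart (f : M → ℝ) (φ : Chart M) (x : E3) : ℝ := f ((φ.extend I3).symm x)

/-- The covariant derivative, with respect to the metric `h`, of a covariant `n`-tensor; the first
index of the result is the index of differentiation. -/
def covDeriv (h : CovComps M 2) {n : ℕ} (u : CovComps M n) : CovComps M (n + 1) := fun φ x J =>
  pd (J 0) (fun y => u φ y (Fin.tail J)) x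
    - ∑ s : Fin n, ∑ l : Fin 3,
        christoffel (mat h φ) l (J 0) (Fin.tail J s) x *
          u φ x (Function.update (Fin.tail J) s l)

/-- The iterated covariant derivative. -/
def iterCovDeriv (h : CovComps M 2) {n : ℕ} (u : CovComps M n) : (l : ℕ) → CovComps M (n + l)
  | 0 => u
  | l + 1 => covDeriv h (iterCovDeriv h u l)

/-- The weighted Hölder space `C^{k,α}_δ(M) = ρ^δ C^{k,α}(M)` of the asymptotically hyperbolic
metric `ρ⁻² h̄`, for tensors of weight `r` (covariant minus contravariant rank): in every smooth
chart, and locally uniformly up to the boundary, the components satisfy the scale invariant bounds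
that express uniform boundedness in `C^{k,α}` of `ρ^(-δ) u` on the balls of radius comparable
to `ρ` (these are balls of radius comparable to one for `ρ⁻² h̄`), rescaled to size one. -/
def MemHolder (ρ : M → ℝ) (k : ℕ) (α δ : ℝ) (r : ℤ) {ι : Type} (u : Comps M ι) : Prop :=
  ∀ φ ∈ smoothCharts M, ∀ J : ι,
    ContDiffOn ℝ k (fun x => u φ x J) (dom φ) ∧
    ∀ S : Set M, IsCompact S → S ⊆ φ.source → ∃ C : ℝ,
      (∀ x ∈ φ.extend I3 '' (S ∩ I3.interior M), ∀ j ≤ k,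
        inChart ρ φ x ^ ((r : ℝ) - δ + j) * ‖iteratedFDeriv ℝ j (fun y => u φ y J) x‖ ≤ C) ∧
      (∀ x ∈ φ.extend I3 '' (S ∩ I3.interior M), ∀ y ∈ φ.extend I3 '' (S ∩ I3.interior M),
        ‖x - y‖ ≤ min (inChart ρ φ x) (inChart ρ φ y) →
        inChart ρ φ x ^ ((r : ℝ) - δ + k + α) *
          ‖iteratedFDeriv ℝ k (fun z => u φ z J) x - iteratedFDeriv ℝ k (fun z => u φ z J) y‖
            ≤ C * ‖x - y‖ ^ α)

/-- The space `𝒞^{k,α;m}(M)` of covariant `n`-tensors `u` with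
`∇̄^l u ∈ C^{k-l,α}_{n+l}(M)` for `0 ≤ l ≤ m`. -/
def MemScriptC (ρ : M → ℝ) (h : CovComps M 2) (k : ℕ) (α : ℝ) (m : ℕ) {n : ℕ}
    (u : CovComps M n) : Prop :=
  ∀ l ≤ m, MemHolder ρ (k - l) α ((n + l : ℕ) : ℝ) ((n + l : ℕ) : ℤ) (iterCovDeriv h u l)

/-- The continuous extension to the boundary point `p` of the 2-tensor `u` has the value `t`. -/
def HasBoundaryValue (u : CovComps M 2) (p : M)
    (t : TangentSpace I3 p →L[ℝ] TangentSpace I3 p →L[ℝ] ℝ) : Prop :=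
  ∀ φ ∈ smoothCharts M, p ∈ φ.source → ∀ J : Fin 2 → Fin 3,
    Tendsto (fun x => u φ x J) (𝓝[dom φ] (φ.extend I3 p))
      (𝓝 (t (mfderivWithin 𝓘(ℝ, E3) I3 (φ.extend I3).symm (range I3) (φ.extend I3 p)
              (EuclideanSpace.single (J 0) (1 : ℝ) : E3))
            (mfderivWithin 𝓘(ℝ, E3) I3 (φ.extend I3).symm (range I3) (φ.extend I3 p)
              (EuclideanSpace.single (J 1) (1 : ℝ) : E3))))

/-- `u` and `v` extend continuously to the boundary of `M` and have the same values there. -/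
def EqOnBoundary (u v : CovComps M 2) : Prop :=
  ∀ p ∈ I3.boundary M, ∃ t : TangentSpace I3 p →L[ℝ] TangentSpace I3 p →L[ℝ] ℝ,
    HasBoundaryValue u p t ∧ HasBoundaryValue v p t

/-- `|η| = 1` with respect to the scalar product `b`, where `|η|² = η(v)` for the vector `v`
dual to `η`. -/
def IsUnitCovector {p : M} (b : TangentSpace I3 p →L[ℝ] TangentSpace I3 p →L[ℝ] ℝ)
    (η : TangentSpace I3 p →L[ℝ] ℝ) : Prop :=
  ∃ v, (∀ w, b v w = η w) ∧ η v = 1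

/-- `b` is symmetric and positive definite. -/
def IsScalarProduct {p : M} (b : TangentSpace I3 p →L[ℝ] TangentSpace I3 p →L[ℝ] ℝ) : Prop :=
  (∀ v w, b v w = b w v) ∧ ∀ v, v ≠ 0 → 0 < b v v

/-- The differential of a function, as a covector. -/
def dAt (f : M → ℝ) (p : M) : TangentSpace I3 p →L[ℝ] ℝ := mfderiv I3 𝓘(ℝ, ℝ) f p

/-- `ρ` is a smooth defining function for the boundary. -/
structure IsDefiningFunction (ρ : M → ℝ) : Prop where
  smooth : ContMDiff I3 𝓘(ℝ, ℝ) ∞ ρ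
  nonneg : ∀ p, 0 ≤ ρ p
  zero_iff : ∀ p, ρ p = 0 ↔ p ∈ I3.boundary M
  d_ne_zero : ∀ p ∈ I3.boundary M, dAt ρ p ≠ 0

/-- `ḡ = ρ² g` -/
def gBar (ρ : M → ℝ) (g : Cov2 M) : Cov2 M := fun p => ρ p ^ 2 • g p

/-- `Σ̄ = ρ Σ`, where `Σ = K + g` -/
def sigmaBar (ρ : M → ℝ) (g K : Cov2 M) : Cov2 M := fun p => ρ p • (K p + g p)

/-- The traceless Hessian of `ρ` with respect to `ḡ`. -/
def tracelessHessComps (ρ : M → ℝ) (g : Cov2 M) : CovComps M 2 := fun φ x J =>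
  tracelessHess (mat (cov2Comps (gBar ρ g)) φ) (inChart ρ φ) (J 0) (J 1) x

/-- The tensor `H_ḡ(ρ)`. -/
def calHComps (ρ : M → ℝ) (g : Cov2 M) : CovComps M 2 := fun φ x J =>
  calH (mat (cov2Comps (gBar ρ g)) φ) (inChart ρ φ) (J 0) (J 1) x

/-- The metrics `g` on the interior of `M` of class `M_weak^{k,α;2}`. Values of `g` at boundary
points are irrelevant. -/
structure IsWeaklyAH (ρ : M → ℝ) (h : CovComps M 2) (k : ℕ) (α : ℝ) (g : Cov2 M) : Prop where
  riemannian : ∀ p ∈ I3.interior M, IsScalarProduct (g p)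
  regular : MemScriptC ρ h k α 2 (cov2Comps (gBar ρ g))
  boundary : ∀ p ∈ I3.boundary M, ∃ t : TangentSpace I3 p →L[ℝ] TangentSpace I3 p →L[ℝ] ℝ,
    HasBoundaryValue (cov2Comps (gBar ρ g)) p t ∧ IsScalarProduct t ∧ IsUnitCovector t (dAt ρ p)

/-- `Div_g X = 0` in the interior of `M`, in the sense of distributions: in every chart
`∫ X^i ∂_i f √(det g) dx = 0` for all test functions `f`. -/
def DivFree (g : Cov2 M) (X : VecField M) : Prop :=
  ∀ φ ∈ smoothCharts M, ∀ f : E3 → ℝ, ContDiff ℝ ∞ f → HasCompactSupport f → tsupport f ⊆ dom φ →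
    ∫ x, Real.sqrt (mat (cov2Comps g) φ x).det * ∑ i, vecComps X φ x i * pd i f x = 0

/-- The components `(E ×_g B)^♭_i = ± √(det g) ε_{ijk} E^j B^k`, where the sign is the sign of the
coordinate frame with respect to the orientation given by the
nonzero 3-form `vol`. For an oriented manifold `vol` is a positive 3-form; `vol` need not be continuous
in the point, so that a choice of orientations of the single tangent spaces is enough. -/
def crossFlat (vol : ∀ p : M, TangentSpace I3 p [⋀^Fin 3]→ₗ[ℝ] ℝ) (g : Cov2 M) (E B : VecField M)
    (φ : Chart M) (x : E3) (i : Fin 3) : ℝ :=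
  Real.sign (vol ((φ.extend I3).symm x) (coordVec φ x)) *
    Real.sqrt (mat (cov2Comps g) φ x).det *
      crossProduct (vecComps E φ x) (vecComps B φ x) i

/-- The mean curvature `τ = tr_g K` in a chart. -/
def meanCurv (g K : Cov2 M) (φ : Chart M) (x : E3) : ℝ :=
  trG (mat (cov2Comps g) φ) (mat (cov2Comps K) φ x) x

/-- The Einstein--Maxwell--fluid constraint equations in the interior of `M`. -/
structure SatisfiesConstraints (vol : ∀ p : M, TangentSpace I3 p [⋀^Fin 3]→ₗ[ℝ] ℝ)
    (g K : Cov2 M) (E B J : VecField M) (ξ : M → ℝ) : Prop where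
  hamiltonian : ∀ φ ∈ smoothCharts M, ∀ x ∈ dom φ,
    scalarCurv (mat (cov2Comps g) φ) x
        - normSqCov2 (mat (cov2Comps g) φ) (mat (cov2Comps K) φ x) x + meanCurv g K φ x ^ 2
      = normSqVec (mat (cov2Comps g) φ) (vecComps E φ x) x
        + normSqVec (mat (cov2Comps g) φ) (vecComps B φ x) x + 2 * inChart ξ φ x
  momentum : ∀ φ ∈ smoothCharts M, ∀ x ∈ dom φ, ∀ i,
    divCov2 (mat (cov2Comps g) φ) (mat (cov2Comps K) φ) i x - pd i (meanCurv g K φ) x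
      = crossFlat vol g E B φ x i + ∑ j, mat (cov2Comps g) φ x i j * vecComps J φ x j
  maxwellE : DivFree g E
  maxwellB : DivFree g B

/-- All conditions on a constant-mean-curvature shear-free hyperboloidal initial data set of class
`C^{k,α}` except for the shear-free condition. Values of the fields at boundary points are
irrelevant. -/
structure IsHyperboloidalData (ρ : M → ℝ) (h : CovComps M 2)
    (vol : ∀ p : M, TangentSpace I3 p [⋀^Fin 3]→ₗ[ℝ] ℝ) (k : ℕ) (α : ℝ)
    (g K : Cov2 M) (E B J : VecField M) (ξ : M → ℝ) : Prop where
  metric : IsWeaklyAH ρ h k α g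
  symm : ∀ p ∈ I3.interior M, ∀ v w, K p v w = K p w v
  traceless : ∀ φ ∈ smoothCharts M, ∀ x ∈ dom φ,
    trG (mat (cov2Comps g) φ) (mat (cov2Comps fun p => K p + g p) φ x) x = 0
  sigma_regular : MemScriptC ρ h (k - 1) α 1 (cov2Comps (sigmaBar ρ g K))
  E_regular : MemHolder ρ (k - 2) α 1 (-1) (vecComps E)
  B_regular : MemHolder ρ (k - 2) α 1 (-1) (vecComps B)
  J_regular : MemHolder ρ (k - 2) α 2 (-1) (vecComps J)
  xi_regular : MemHolder ρ (k - 2) α 2 0 (scalarComps ξ)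
  xi_nonneg : ∀ p ∈ I3.interior M, 0 ≤ ξ p
  constraints : SatisfiesConstraints vol g K E B J ξ

end Fields

end Hyperboloidal

end

/-!
All statements are checked in charts of the manifold, whose ranges are relatively open subsets
`halfSet U` of the half space `0 ≤ x 0`. There the defining function `r` is comparable to the
coordinate `x 0` (`isBoundaryChart_inChart`), and `u = O(r ^ m)` means `WBdd U r (-m) u`: a bound by
a multiple of `r ^ m`, locally uniform up to the boundary. Write `G` for the matrix of `ḡ = ρ² g`,
`S` for that of `Σ̄`, and `N = |dr|²`, with norms, `Δ` and curvature taken with respect to `G`.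

*Regularity.* The classes `WHolder U r α n s` consist of functions with `n` derivatives, where the
derivatives of order at most `-s` are bounded and each further one may cost a factor `1 / r`. For
`s ≤ 0` they are algebras, closed under division by functions bounded away from zero. As the
Christoffel symbols of the background metric are smooth up to the boundary, the hypotheses say that
`G` has bounded second, and `S` bounded first derivatives. Hence `calH`, the traceless Hessian and
`S` are all locally Lipschitz up to the boundary.

*The boundary condition and the weighted space.* The difference `T = S - calH` belongs to the class
with `s = -1`, and for such functions the bounds that define the weighted Hölder space of weight 3
reduce to `T = O(r)` (`holderBounds_neg_one_iff`). Since `T` is Lipschitz, this says that `T` is zero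
on the boundary (`WHolder.wbdd_neg_one_of_tendsto`, `WBdd.tendsto_zero`). That the boundary limits of
the components of `Σ̄` in different charts form a tensor is `exists_hasBoundaryValue`.

*The two boundary tensors.* The traceless Hessian of `ρ` and `calH` agree at the boundary for every
solution of the Hamiltonian constraint. As `Σ` is traceless, `τ = -3` and `|K|² = r² |S|² + 3`;
together with the conformal transformation law
`R[g] = r² R[G] + 4 r Δ r - 6 N` (`IsMetricOn.scalarCurv_conformal`) and the decay of the matter
fields, the constraint becomes `N - 1 - (2/3) r Δ r = O(r²)` (`wbdd_of_hamiltonian`). Although `Δ r`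
is only Lipschitz, this estimate can be differentiated once, with the mean value theorem on segments
as long as the distance to the boundary, and gives `dN = (2/3) Δ r dr + O(r)`
(`wbdd_pd_sub_of_wbdd`). Now `calH` is a polynomial in `N`, `dN`, `dr`, `G` and the traceless Hessian
(`IsMetricOn.calH_eq_polyH`), and inserting `N = 1` and `dN = (2/3) Δ r dr` leaves the traceless
Hessian.
-/

noncomputable section

namespace Hyperboloidal

/-! ### Half-space charts -/

/-- The part of `U` in the closed half space: the range of a chart of a manifold with boundary. -/
def halfSet (U : Set E3) : Set E3 := U ∩ {x | 0 ≤ x 0}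

/-- The part of `U` in the open half space: the coordinates of interior points. -/
def posSet (U : Set E3) : Set E3 := U ∩ {x | 0 < x 0}

/-- `r` is the coordinate expression, in a chart with range `halfSet U`, of a smooth defining
function. Nondegeneracy of `dr` at the boundary is recorded in integrated form (`lower`). -/
structure IsBoundaryChart (U : Set E3) (r : E3 → ℝ) : Prop where
  isOpen : IsOpen U
  smooth : ContDiffOn ℝ ∞ r (halfSet U)
  zero : ∀ x ∈ U, x 0 = 0 → r x = 0
  lower : ∀ S ⊆ halfSet U, IsCompact S → ∃ c > 0, ∀ x ∈ S, c * x 0 ≤ r x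

variable {U : Set E3} {r : E3 → ℝ}

theorem posSet_subset_halfSet : posSet U ⊆ halfSet U := fun x hx =>
  ⟨hx.1, show (0 : ℝ) ≤ x 0 from le_of_lt hx.2⟩

theorem isClosed_halfSpace : IsClosed {x : E3 | 0 ≤ x 0} :=
  isClosed_le continuous_const (by fun_prop)

theorem isOpen_posHalfSpace : IsOpen {x : E3 | 0 < x 0} :=
  isOpen_lt continuous_const (by fun_prop)

theorem convex_halfSpace : Convex ℝ {x : E3 | 0 ≤ x 0} := by
  intro x hx y hy a b ha hb _
  simp only [mem_ofPred_eq, PiLp.add_apply, PiLp.smul_apply, smul_eq_mul] at *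
  positivity

theorem convex_posHalfSpace : Convex ℝ {x : E3 | 0 < x 0} := by
  intro x hx y hy a b ha hb hab
  simp only [mem_ofPred_eq, PiLp.add_apply, PiLp.smul_apply, smul_eq_mul] at *
  rcases ha.eq_or_lt with rfl | ha
  · have : b = 1 := by linarith
    simpa [this] using hy
  · have := mul_pos ha hx
    positivity

theorem abs_coord_le_norm (x : E3) (i : Fin 3) : |x i| ≤ ‖x‖ := by
  simpa using PiLp.norm_apply_le x i

/-- A compact subset of `halfSet U` has a compact neighbourhood in `halfSet U` of uniform size. -/
theorem exists_compact_thickening (hU : IsOpen U) {S : Set E3} (hS : S ⊆ halfSet U)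
    (hc : IsCompact S) : ∃ ε > 0, ∃ S' ⊆ halfSet U, IsCompact S' ∧
      ∀ x ∈ S, ∀ y : E3, 0 ≤ y 0 → ‖x - y‖ ≤ ε → y ∈ S' := by
  obtain ⟨ε, hε, h⟩ := hc.exists_cthickening_subset_open hU (hS.trans inter_subset_left)
  refine ⟨ε, hε, Metric.cthickening ε S ∩ {x | 0 ≤ x 0}, fun x hx => ⟨h hx.1, hx.2⟩,
    hc.cthickening.inter_right isClosed_halfSpace, fun x hx y hy hxy => ⟨?_, hy⟩⟩
  exact Metric.mem_cthickening_of_dist_le y x ε S hx (by rwa [dist_comm, dist_eq_norm])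

theorem uniqueDiffOn_halfSet (hU : IsOpen U) : UniqueDiffOn ℝ (halfSet U) := by
  have h : UniqueDiffOn ℝ {x : E3 | 0 ≤ x 0} := by
    refine uniqueDiffOn_convex convex_halfSpace ⟨EuclideanSpace.single 0 1, ?_⟩
    have hsub : {x : E3 | 0 < x 0} ⊆ {x : E3 | 0 ≤ x 0} := fun x hx =>
      show (0 : ℝ) ≤ x 0 from le_of_lt hx
    exact interior_maximal hsub isOpen_posHalfSpace (by simp)
  rw [halfSet, inter_comm]
  exact h.inter hU

/-- A `C¹` function on `halfSet U` is Lipschitz at small scales, uniformly on compact sets. -/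
theorem exists_lipschitz_of_contDiffOn (hU : IsOpen U) {f : E3 → ℝ}
    (hf : ContDiffOn ℝ 1 f (halfSet U)) {S : Set E3} (hS : S ⊆ halfSet U) (hc : IsCompact S) :
    ∃ ε > 0, ∃ C ≥ 0, ∀ x ∈ S, ∀ y : E3, 0 ≤ y 0 → ‖x - y‖ ≤ ε → |f x - f y| ≤ C * ‖x - y‖ := by
  obtain ⟨ε, hε, S', hS', hc', h⟩ := exists_compact_thickening hU hS hc
  obtain ⟨C, hC⟩ := hc'.exists_bound_of_continuousOn
    ((hf.continuousOn_fderivWithin (uniqueDiffOn_halfSet hU) le_rfl).mono hS')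
  refine ⟨ε, hε, max C 0, le_max_right _ _, fun x hx y hy hxy => ?_⟩
  have hconv : Convex ℝ (Metric.closedBall x ε ∩ {z : E3 | 0 ≤ z 0}) :=
    (convex_closedBall x ε).inter convex_halfSpace
  have hsub : Metric.closedBall x ε ∩ {z : E3 | 0 ≤ z 0} ⊆ S' := fun z hz =>
    h x hx z hz.2 (by rw [← dist_eq_norm, dist_comm]; exact hz.1)
  have := hconv.norm_image_sub_le_of_norm_hasFDerivWithin_le (f := f)
    (f' := fderivWithin ℝ f (halfSet U)) (C := max C 0) (x := y) (y := x)
    (fun z hz => ((hf.differentiableOn one_ne_zero z (hS' (hsub hz))).hasFDerivWithinAt.mono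
      (hsub.trans hS'))) (fun z hz => (hC z (hsub hz)).trans (le_max_left _ _))
    ⟨by rw [Metric.mem_closedBall, dist_comm, dist_eq_norm]; exact hxy, hy⟩
    ⟨Metric.mem_closedBall_self hε.le, (hS hx).2⟩
  simpa using this

namespace IsBoundaryChart

theorem isOpen_posSet (hc : IsBoundaryChart U r) : IsOpen (posSet U) :=
  hc.isOpen.inter isOpen_posHalfSpace

theorem pos (hc : IsBoundaryChart U r) {x : E3} (hx : x ∈ posSet U) : 0 < r x := by
  obtain ⟨c, hc0, h⟩ := hc.lower {x} (by simpa using posSet_subset_halfSet hx) isCompact_singleton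
  exact (mul_pos hc0 hx.2).trans_le (h x rfl)

theorem exists_bound (hc : IsBoundaryChart U r) {S : Set E3} (hS : S ⊆ halfSet U)
    (hS' : IsCompact S) : ∃ C > 0, ∀ x ∈ S, |r x| ≤ C := by
  obtain ⟨C, hC⟩ := hS'.exists_bound_of_continuousOn (hc.smooth.continuousOn.mono hS)
  exact ⟨max C 1, by positivity, fun x hx => (hC x hx).trans (le_max_left _ _)⟩

theorem upper (hc : IsBoundaryChart U r) {S : Set E3} (hS : S ⊆ halfSet U)
    (hS' : IsCompact S) : ∃ C > 0, ∀ x ∈ S, r x ≤ C * x 0 := by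
  obtain ⟨ε, hε, L, hL, h⟩ := exists_lipschitz_of_contDiffOn hc.isOpen
    (hc.smooth.of_le (by simp)) hS hS'
  obtain ⟨B, hB, hb⟩ := hc.exists_bound hS hS'
  obtain ⟨ε', hε', S1, hS1, -, h1⟩ := exists_compact_thickening hc.isOpen hS hS'
  refine ⟨L + B / min ε ε', by positivity, fun x hx => ?_⟩
  have hx0 : 0 ≤ x 0 := (hS hx).2
  by_cases hxe : x 0 ≤ min ε ε'
  · set y : E3 := x - EuclideanSpace.single 0 (x 0) with hy
    have hy0 : y 0 = 0 := by simp [hy]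
    have hxy : ‖x - y‖ = x 0 := by simp [hy, abs_of_nonneg hx0]
    have := h x hx y hy0.ge (hxy ▸ hxe.trans (min_le_left _ _))
    have hyU := hS1 (h1 x hx y hy0.ge (hxy ▸ hxe.trans (min_le_right _ _)))
    rw [hc.zero y hyU.1 hy0, hxy, sub_zero] at this
    have h3 : 0 ≤ B / min ε ε' * x 0 := by positivity
    have := le_abs_self (r x)
    linarith
  · push Not at hxe
    have h2 : B ≤ B / min ε ε' * x 0 := by
      rw [div_mul_eq_mul_div, le_div_iff₀ (by positivity)]
      gcongr
    have h3 : 0 ≤ L * x 0 := by positivity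
    have := (le_abs_self (r x)).trans (hb x hx)
    linarith

/-- At distance at most `r`, values of `r` are comparable. -/
theorem comparable (hc : IsBoundaryChart U r) {S : Set E3} (hS : S ⊆ halfSet U)
    (hS' : IsCompact S) : ∃ κ ≥ 1, ∀ x ∈ S ∩ posSet U, ∀ y ∈ S ∩ posSet U,
      ‖x - y‖ ≤ r y → r x ≤ κ * r y := by
  obtain ⟨c, hc0, hl⟩ := hc.lower S hS hS'
  obtain ⟨C, hC0, hu⟩ := hc.upper hS hS'
  refine ⟨max 1 (C * (1 / c + 1)), le_max_left _ _, fun x hx y hy hxy => ?_⟩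
  have h1 := hl y hy.1
  have h2 := hu x hx.1
  have h3 : |x 0 - y 0| ≤ ‖x - y‖ := by simpa using abs_coord_le_norm (x - y) 0
  have h4 : x 0 ≤ y 0 + r y := by linarith [le_abs_self (x 0 - y 0)]
  have h5 : y 0 ≤ r y / c := by rw [le_div_iff₀ hc0]; linarith
  have h6 := hc.pos hy.2
  calc r x ≤ C * (r y / c + r y) := h2.trans (by gcongr; linarith)
    _ = (C * (1 / c + 1)) * r y := by ring
    _ ≤ _ := by gcongr; exact le_max_right _ _

/-- Small segments of length at most `r` stay in the chart, and `r` is comparable to a constant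
along them. -/
theorem segment_comparable (hc : IsBoundaryChart U r) {S : Set E3} (hS : S ⊆ halfSet U)
    (hS' : IsCompact S) : ∃ ε > 0, ∃ κ ≥ 1, ∃ S' ⊆ halfSet U, IsCompact S' ∧
      ∀ x ∈ S ∩ posSet U, ∀ y ∈ S ∩ posSet U, ‖x - y‖ ≤ min (r x) (r y) → ‖x - y‖ ≤ ε →
        ∀ z ∈ segment ℝ x y, z ∈ S' ∩ posSet U ∧ r z ≤ κ * r x ∧ r x ≤ κ * r z := by
  obtain ⟨ε, hε, S', hSS, hcS, h⟩ := exists_compact_thickening hc.isOpen hS hS'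
  obtain ⟨c, hc0, hl⟩ := hc.lower S' hSS hcS
  obtain ⟨C, hC0, hu⟩ := hc.upper hSS hcS
  refine ⟨ε, hε, max 1 (max (C * (1 / c + 1)) (C * (1 + C) / c)), le_max_left _ _, S', hSS, hcS,
    fun x hx y hy hxy hxe z hz => ?_⟩
  have hx' := h x hx.1 x hx.2.2.le (by simpa using hε.le)
  have hy' := h y hy.1 y hy.2.2.le (by simpa using hε.le)
  have hzx : ‖x - z‖ ≤ ‖x - y‖ := by
    have := (segment_subset_closedBall_left x y) hz
    rwa [Metric.mem_closedBall, dist_comm, dist_eq_norm, dist_eq_norm] at this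
  have hzpos : 0 < z 0 := convex_posHalfSpace.segment_subset hx.2.2 hy.2.2 hz
  have hzS := h x hx.1 z hzpos.le (hzx.trans hxe)
  have hrx := hc.pos hx.2
  have hry := hc.pos hy.2
  have hz2 : z ∈ posSet U := ⟨(hSS hzS).1, hzpos⟩
  have hrz := hc.pos hz2
  have hmin : min (x 0) (y 0) ≤ z 0 := by
    obtain ⟨a, b, ha, hb, hab, rfl⟩ := hz
    simp only [PiLp.add_apply, PiLp.smul_apply, smul_eq_mul]
    calc min (x 0) (y 0) = a * min (x 0) (y 0) + b * min (x 0) (y 0) := by rw [← add_mul, hab, one_mul]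
      _ ≤ _ := by gcongr <;> simp
  have hxr := hxy.trans (min_le_left _ _)
  have hyr := hxy.trans (min_le_right _ _)
  refine ⟨⟨hzS, hz2⟩, ?_, ?_⟩
  · have h1 := hl x hx'
    have h2 := hu z hzS
    have h3 : |x 0 - z 0| ≤ ‖x - z‖ := by simpa using abs_coord_le_norm (x - z) 0
    have h4 : z 0 ≤ x 0 + r x := by linarith [neg_abs_le (x 0 - z 0)]
    have h5 : x 0 ≤ r x / c := by rw [le_div_iff₀ hc0]; linarith
    calc r z ≤ C * (r x / c + r x) := h2.trans (by gcongr; linarith)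
      _ = (C * (1 / c + 1)) * r x := by ring
      _ ≤ _ := by gcongr; exact (le_max_left _ _).trans (le_max_right _ _)
  · have h1 := hu x hx'
    have h2 := hu y hy'
    have h3 : |x 0 - y 0| ≤ ‖x - y‖ := by simpa using abs_coord_le_norm (x - y) 0
    have h4 : x 0 ≤ (1 + C) * y 0 := by linarith [le_abs_self (x 0 - y 0)]
    have hx0 : 0 < x 0 := hx.2.2
    have h5 : x 0 ≤ (1 + C) * z 0 := by
      rcases min_choice (x 0) (y 0) with h | h <;> rw [h] at hmin
      · nlinarith
      · exact h4.trans (by gcongr)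
    have h6 := hl z hzS
    have h7 : z 0 ≤ r z / c := by rw [le_div_iff₀ hc0]; linarith
    calc r x ≤ C * ((1 + C) * (r z / c)) := h1.trans (by gcongr; exact h5.trans (by gcongr))
      _ = (C * (1 + C) / c) * r z := by ring
      _ ≤ _ := by gcongr; exact (le_max_right _ _).trans (le_max_right _ _)

end IsBoundaryChart

/-! ### Weighted bounds and Hölder seminorms -/

section Weighted

variable {F F' : Type*} [NormedAddCommGroup F] [NormedAddCommGroup F']

/-- `r ^ e * u` is bounded, locally uniformly up to the boundary. -/
def WBdd (U : Set E3) (r : E3 → ℝ) (e : ℝ) (u : E3 → F) : Prop :=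
  ∀ S ⊆ halfSet U, IsCompact S → ∃ C : ℝ, ∀ x ∈ S ∩ posSet U, r x ^ e * ‖u x‖ ≤ C

/-- The Hölder quotients of `u` for pairs of points at distance at most `r`, with the weight
`r ^ (e + α)` that makes them scale invariant companions of `r ^ e * u`, are bounded, locally
uniformly up to the boundary. -/
def WSemi (U : Set E3) (r : E3 → ℝ) (α e : ℝ) (u : E3 → F) : Prop :=
  ∀ S ⊆ halfSet U, IsCompact S → ∃ C : ℝ, ∀ x ∈ S ∩ posSet U, ∀ y ∈ S ∩ posSet U,
    ‖x - y‖ ≤ min (r x) (r y) → r x ^ (e + α) * ‖u x - u y‖ ≤ C * ‖x - y‖ ^ α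

variable {U : Set E3} {r : E3 → ℝ} {α e e' : ℝ} {u v : E3 → F}

theorem rpow_le_of_comparable {a b κ : ℝ} (ha : 0 < a) (hb : 0 < b) (hκ : 1 ≤ κ)
    (hab : a ≤ κ * b) (hba : b ≤ κ * a) (e : ℝ) : a ^ e ≤ κ ^ |e| * b ^ e := by
  have hκ0 : 0 < κ := by linarith
  rcases le_total 0 e with he | he
  · rw [abs_of_nonneg he, ← Real.mul_rpow hκ0.le hb.le]
    exact Real.rpow_le_rpow ha.le hab he
  · rw [abs_of_nonpos he, Real.rpow_neg hκ0.le, ← Real.inv_rpow hκ0.le,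
      ← Real.mul_rpow (by positivity) hb.le]
    refine Real.rpow_le_rpow_of_nonpos (by positivity) ?_ he
    rw [inv_mul_le_iff₀ hκ0]
    exact hba

theorem WBdd.nonneg (h : WBdd U r e u) {S : Set E3} (hS : S ⊆ halfSet U) (hc : IsCompact S) :
    ∃ C ≥ 0, ∀ x ∈ S ∩ posSet U, r x ^ e * ‖u x‖ ≤ C := by
  obtain ⟨C, hC⟩ := h S hS hc
  exact ⟨max C 0, le_max_right _ _, fun x hx => (hC x hx).trans (le_max_left _ _)⟩

theorem WSemi.nonneg (h : WSemi U r α e u) {S : Set E3} (hS : S ⊆ halfSet U) (hc : IsCompact S) :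
    ∃ C ≥ 0, ∀ x ∈ S ∩ posSet U, ∀ y ∈ S ∩ posSet U,
      ‖x - y‖ ≤ min (r x) (r y) → r x ^ (e + α) * ‖u x - u y‖ ≤ C * ‖x - y‖ ^ α := by
  obtain ⟨C, hC⟩ := h S hS hc
  refine ⟨max C 0, le_max_right _ _, fun x hx y hy hxy => (hC x hx y hy hxy).trans ?_⟩
  gcongr
  exact le_max_left _ _

theorem WBdd.congr (h : WBdd U r e u) (huv : ∀ x ∈ posSet U, u x = v x) : WBdd U r e v := by
  intro S hS hc
  obtain ⟨C, hC⟩ := h S hS hc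
  exact ⟨C, fun x hx => huv x hx.2 ▸ hC x hx⟩

theorem WSemi.congr (h : WSemi U r α e u) (huv : ∀ x ∈ posSet U, u x = v x) :
    WSemi U r α e v := by
  intro S hS hc
  obtain ⟨C, hC⟩ := h S hS hc
  exact ⟨C, fun x hx y hy => huv x hx.2 ▸ huv y hy.2 ▸ hC x hx y hy⟩

theorem WBdd.mono_exp (h : WBdd U r e u) (hc : IsBoundaryChart U r) (he : e ≤ e') :
    WBdd U r e' u := by
  intro S hS hS'
  obtain ⟨C, hC0, hC⟩ := h.nonneg hS hS'
  obtain ⟨B, hB0, hB⟩ := hc.exists_bound hS hS'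
  refine ⟨B ^ (e' - e) * C, fun x hx => ?_⟩
  have hr := hc.pos hx.2
  have : r x ^ e' = r x ^ (e' - e) * r x ^ e := by rw [← Real.rpow_add hr]; ring_nf
  rw [this, mul_assoc]
  have h1 : r x ≤ B := (le_abs_self _).trans (hB x hx.1)
  have h2 : r x ^ (e' - e) ≤ B ^ (e' - e) := Real.rpow_le_rpow hr.le h1 (by linarith)
  exact mul_le_mul h2 (hC x hx) (by positivity) (by positivity)

theorem WSemi.mono_exp (h : WSemi U r α e u) (hc : IsBoundaryChart U r) (he : e ≤ e') :
    WSemi U r α e' u := by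
  intro S hS hS'
  obtain ⟨C, hC0, hC⟩ := h.nonneg hS hS'
  obtain ⟨B, hB0, hB⟩ := hc.exists_bound hS hS'
  refine ⟨B ^ (e' - e) * C, fun x hx y hy hxy => ?_⟩
  have hr := hc.pos hx.2
  have : r x ^ (e' + α) = r x ^ (e' - e) * r x ^ (e + α) := by
    rw [← Real.rpow_add hr]; ring_nf
  rw [this, mul_assoc, mul_assoc]
  have h1 : r x ≤ B := (le_abs_self _).trans (hB x hx.1)
  have h2 : r x ^ (e' - e) ≤ B ^ (e' - e) := Real.rpow_le_rpow hr.le h1 (by linarith)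
  exact mul_le_mul h2 (hC x hx y hy hxy) (by positivity) (by positivity)

theorem WBdd.add (hu : WBdd U r e u) (hv : WBdd U r e v) (hc : IsBoundaryChart U r) :
    WBdd U r e (fun x => u x + v x) := by
  intro S hS hS'
  obtain ⟨C, hC⟩ := hu S hS hS'
  obtain ⟨C', hC'⟩ := hv S hS hS'
  refine ⟨C + C', fun x hx => ?_⟩
  have hr := hc.pos hx.2
  calc r x ^ e * ‖u x + v x‖ ≤ r x ^ e * (‖u x‖ + ‖v x‖) := by gcongr; exact norm_add_le _ _
    _ = r x ^ e * ‖u x‖ + r x ^ e * ‖v x‖ := by ring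
    _ ≤ _ := add_le_add (hC x hx) (hC' x hx)

theorem WSemi.add (hu : WSemi U r α e u) (hv : WSemi U r α e v) (hc : IsBoundaryChart U r) :
    WSemi U r α e (fun x => u x + v x) := by
  intro S hS hS'
  obtain ⟨C, hC⟩ := hu S hS hS'
  obtain ⟨C', hC'⟩ := hv S hS hS'
  refine ⟨C + C', fun x hx y hy hxy => ?_⟩
  have hr := hc.pos hx.2
  calc r x ^ (e + α) * ‖u x + v x - (u y + v y)‖
      ≤ r x ^ (e + α) * (‖u x - u y‖ + ‖v x - v y‖) := by
        gcongr
        rw [add_sub_add_comm]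
        exact norm_add_le _ _
    _ = r x ^ (e + α) * ‖u x - u y‖ + r x ^ (e + α) * ‖v x - v y‖ := by ring
    _ ≤ _ := by rw [add_mul]; exact add_le_add (hC x hx y hy hxy) (hC' x hx y hy hxy)

theorem WBdd.of_norm_le {w : E3 → F'} (hu : WBdd U r e u) (hc : IsBoundaryChart U r) (c : ℝ)
    (h : ∀ x ∈ posSet U, ‖w x‖ ≤ c * ‖u x‖) : WBdd U r e w := by
  intro S hS hS'
  obtain ⟨C, hC0, hC⟩ := hu.nonneg hS hS'
  refine ⟨max c 0 * C, fun x hx => ?_⟩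
  have hr := hc.pos hx.2
  calc r x ^ e * ‖w x‖ ≤ r x ^ e * (max c 0 * ‖u x‖) := by
        gcongr
        exact (h x hx.2).trans (by gcongr; exact le_max_left _ _)
    _ = max c 0 * (r x ^ e * ‖u x‖) := by ring
    _ ≤ _ := by gcongr; exact hC x hx

theorem WSemi.of_norm_le {w : E3 → F'} (hu : WSemi U r α e u) (hc : IsBoundaryChart U r) (c : ℝ)
    (h : ∀ x ∈ posSet U, ∀ y ∈ posSet U, ‖w x - w y‖ ≤ c * ‖u x - u y‖) : WSemi U r α e w := by
  intro S hS hS'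
  obtain ⟨C, hC0, hC⟩ := hu.nonneg hS hS'
  refine ⟨max c 0 * C, fun x hx y hy hxy => ?_⟩
  have hr := hc.pos hx.2
  calc r x ^ (e + α) * ‖w x - w y‖ ≤ r x ^ (e + α) * (max c 0 * ‖u x - u y‖) := by
        gcongr
        exact (h x hx.2 y hy.2).trans (by gcongr; exact le_max_left _ _)
    _ = max c 0 * (r x ^ (e + α) * ‖u x - u y‖) := by ring
    _ ≤ max c 0 * (C * ‖x - y‖ ^ α) :=
        mul_le_mul_of_nonneg_left (hC x hx y hy hxy) (le_max_right _ _)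
    _ = _ := by ring

theorem WBdd.mul {u v : E3 → ℝ} (hu : WBdd U r e u) (hv : WBdd U r e' v)
    (hc : IsBoundaryChart U r) : WBdd U r (e + e') (fun x => u x * v x) := by
  intro S hS hS'
  obtain ⟨C, hC0, hC⟩ := hu.nonneg hS hS'
  obtain ⟨C', hC0', hC'⟩ := hv.nonneg hS hS'
  refine ⟨C * C', fun x hx => ?_⟩
  have hr := hc.pos hx.2
  rw [norm_mul, Real.rpow_add hr, mul_mul_mul_comm]
  exact mul_le_mul (hC x hx) (hC' x hx) (by positivity) (by positivity)

theorem IsBoundaryChart.exists_rpow_le (hc : IsBoundaryChart U r) (e : ℝ) {S : Set E3}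
    (hS : S ⊆ halfSet U) (hS' : IsCompact S) : ∃ c > 0, ∀ x ∈ S ∩ posSet U, ∀ y ∈ S ∩ posSet U,
      ‖x - y‖ ≤ min (r x) (r y) → r x ^ e ≤ c * r y ^ e := by
  obtain ⟨κ, hκ, h⟩ := hc.comparable hS hS'
  have hκ0 : 0 < κ := by linarith
  refine ⟨κ ^ |e|, by positivity, fun x hx y hy hxy => ?_⟩
  refine rpow_le_of_comparable (hc.pos hx.2) (hc.pos hy.2) hκ
    (h x hx y hy (hxy.trans (min_le_right _ _))) (h y hy x hx ?_) e
  rw [norm_sub_rev]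
  exact hxy.trans (min_le_left _ _)

theorem WSemi.mul {u v : E3 → ℝ} (hu : WBdd U r e u) (hv : WBdd U r e' v)
    (hu' : WSemi U r α e u) (hv' : WSemi U r α e' v)
    (hc : IsBoundaryChart U r) : WSemi U r α (e + e') (fun x => u x * v x) := by
  intro S hS hS'
  obtain ⟨A, hA0, hA⟩ := hu.nonneg hS hS'
  obtain ⟨A', hA0', hA'⟩ := hv.nonneg hS hS'
  obtain ⟨B, hB0, hB⟩ := hu'.nonneg hS hS'
  obtain ⟨B', hB0', hB'⟩ := hv'.nonneg hS hS'
  obtain ⟨c, hc0, hcc⟩ := hc.exists_rpow_le e hS hS'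
  refine ⟨B * A' + c * A * B', fun x hx y hy hxy => ?_⟩
  have hr := hc.pos hx.2
  have hry := hc.pos hy.2
  have h1 : r x ^ (e + e' + α) = r x ^ (e + α) * r x ^ e' := by
    rw [← Real.rpow_add hr]; ring_nf
  have h2 : r x ^ (e + e' + α) = r x ^ e * r x ^ (e' + α) := by
    rw [← Real.rpow_add hr]; ring_nf
  have h3 : ‖u x * v x - u y * v y‖ ≤ ‖u x - u y‖ * ‖v x‖ + ‖u y‖ * ‖v x - v y‖ := by
    rw [← norm_mul, ← norm_mul]
    refine le_trans (le_of_eq ?_) (norm_add_le _ _)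
    ring_nf
  calc r x ^ (e + e' + α) * ‖u x * v x - u y * v y‖
      ≤ r x ^ (e + e' + α) * (‖u x - u y‖ * ‖v x‖ + ‖u y‖ * ‖v x - v y‖) := by gcongr
    _ = (r x ^ (e + α) * ‖u x - u y‖) * (r x ^ e' * ‖v x‖)
        + r x ^ e * ‖u y‖ * (r x ^ (e' + α) * ‖v x - v y‖) := by
      rw [mul_add]; nth_rewrite 1 [h1]; rw [h2]; ring
    _ ≤ (B * ‖x - y‖ ^ α) * A' + c * A * (B' * ‖x - y‖ ^ α) := by
      have h4 : r x ^ e * ‖u y‖ ≤ c * A := by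
        calc r x ^ e * ‖u y‖ ≤ c * r y ^ e * ‖u y‖ := by gcongr; exact hcc x hx y hy hxy
          _ = c * (r y ^ e * ‖u y‖) := by ring
          _ ≤ _ := by gcongr; exact hA y hy
      exact add_le_add
        (mul_le_mul (hB x hx y hy hxy) (hA' x hx) (by positivity) (by positivity))
        (mul_le_mul h4 (hB' x hx y hy hxy) (by positivity) (by positivity))
    _ = _ := by ring

theorem norm_le_sum_abs_basis (f : E3 →L[ℝ] ℝ) :
    ‖f‖ ≤ ∑ i, |f (EuclideanSpace.single i 1)| := by
  refine f.opNorm_le_bound (Finset.sum_nonneg fun i _ => abs_nonneg _) fun v => ?_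
  have hv : v = ∑ i, v i • EuclideanSpace.single i (1 : ℝ) := by
    ext j
    simp [Pi.single_apply]
  calc ‖f v‖ = |∑ i, v i * f (EuclideanSpace.single i 1)| := by
        conv_lhs => rw [hv]
        simp [map_sum, Real.norm_eq_abs]
    _ ≤ ∑ i, |v i| * |f (EuclideanSpace.single i 1)| :=
        (Finset.abs_sum_le_sum_abs _ _).trans (by simp [abs_mul])
    _ ≤ ∑ i, ‖v‖ * |f (EuclideanSpace.single i 1)| := by
        gcongr with i; exact abs_coord_le_norm v i
    _ = _ := by rw [← Finset.mul_sum, mul_comm]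

/-- Weighted bounds on a function and its derivatives imply the weighted Hölder bound. -/
theorem WSemi.of_pd {u : E3 → ℝ} (hc : IsBoundaryChart U r) (hα : 0 < α ∧ α < 1)
    (hd : DifferentiableOn ℝ u (posSet U)) (hu : WBdd U r e u)
    (hpd : ∀ i, WBdd U r (e + 1) (pd i u)) : WSemi U r α e u := by
  intro S hS hS'
  obtain ⟨ε, hε, κ, hκ, S1, hS1, hS1c, hseg⟩ := hc.segment_comparable hS hS'
  choose C hC0 hC using fun i => (hpd i).nonneg hS1 hS1c
  obtain ⟨A, hA0, hA⟩ := hu.nonneg hS hS'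
  obtain ⟨B, hB0, hB⟩ := hc.exists_bound hS hS'
  obtain ⟨c, hc0, hcc⟩ := hc.exists_rpow_le e hS hS'
  have hκ0 : 0 < κ := by linarith
  set C1 : ℝ := κ ^ |e + 1| * ∑ i, C i
  have hC1 : 0 ≤ C1 := mul_nonneg (by positivity) (Finset.sum_nonneg fun i _ => hC0 i)
  refine ⟨C1 + B ^ α * (A + c * A) / ε ^ α, fun x hx y hy hxy => ?_⟩
  have hr := hc.pos hx.2
  have hry := hc.pos hy.2
  rw [add_mul]
  by_cases hxe : ‖x - y‖ ≤ ε
  · have hb : ∀ z ∈ segment ℝ x y, ‖fderiv ℝ u z‖ ≤ C1 * (r x ^ (e + 1))⁻¹ := by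
      intro z hz
      obtain ⟨hz1, hz2, hz3⟩ := hseg x hx y hy hxy hxe z hz
      have hrz := hc.pos hz1.2
      rw [← div_eq_mul_inv, le_div_iff₀ (by positivity), mul_comm]
      calc r x ^ (e + 1) * ‖fderiv ℝ u z‖
          ≤ (κ ^ |e + 1| * r z ^ (e + 1)) * ∑ i, |pd i u z| := by
            gcongr
            · exact rpow_le_of_comparable hr hrz hκ hz3 hz2 _
            · exact norm_le_sum_abs_basis _
        _ = κ ^ |e + 1| * ∑ i, r z ^ (e + 1) * |pd i u z| := by rw [mul_assoc, Finset.mul_sum]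
        _ ≤ _ := by
            simp only [C1]
            gcongr with i
            exact hC i z hz1
    have h1 := (convex_segment x y).norm_image_sub_le_of_norm_hasFDerivWithin_le (f := u)
      (f' := fderiv ℝ u) (x := y) (y := x) (fun z hz =>
        ((hd.differentiableAt (hc.isOpen_posSet.mem_nhds
          (hseg x hx y hy hxy hxe z hz).1.2)).hasFDerivAt.hasFDerivWithinAt)) hb
        (right_mem_segment _ _ _) (left_mem_segment _ _ _)
    have h2 : r x ^ (e + α) * ((r x ^ (e + 1))⁻¹ * ‖x - y‖) ≤ ‖x - y‖ ^ α := by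
      rcases (norm_nonneg (x - y)).eq_or_lt with h0 | h0
      · rw [← h0]; simp [Real.zero_rpow hα.1.ne']
      have h3 : ‖x - y‖ = ‖x - y‖ ^ (1 - α) * ‖x - y‖ ^ α := by
        rw [← Real.rpow_add h0]; simp
      have h4 : r x ^ (e + α) * (r x ^ (e + 1))⁻¹ = (r x ^ (1 - α))⁻¹ := by
        rw [← Real.rpow_neg hr.le, ← Real.rpow_neg hr.le, ← Real.rpow_add hr]; ring_nf
      have h5 : ‖x - y‖ ^ (1 - α) ≤ r x ^ (1 - α) :=
        Real.rpow_le_rpow h0.le (hxy.trans (min_le_left _ _)) (by linarith [hα.2])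
      rw [← mul_assoc, h4, h3, ← mul_assoc, ← h3]
      have : (r x ^ (1 - α))⁻¹ * ‖x - y‖ ^ (1 - α) ≤ 1 := by
        rw [inv_mul_le_iff₀ (by positivity)]; simpa using h5
      calc _ ≤ 1 * ‖x - y‖ ^ α := by gcongr
        _ = _ := one_mul _
    have h6 : 0 ≤ B ^ α * (A + c * A) / ε ^ α * ‖x - y‖ ^ α := by positivity
    calc r x ^ (e + α) * ‖u x - u y‖
        ≤ r x ^ (e + α) * (C1 * (r x ^ (e + 1))⁻¹ * ‖x - y‖) := by gcongr
      _ = C1 * (r x ^ (e + α) * ((r x ^ (e + 1))⁻¹ * ‖x - y‖)) := by ring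
      _ ≤ C1 * ‖x - y‖ ^ α := by gcongr
      _ ≤ _ := by linarith
  · push Not at hxe
    have h1 : r x ^ (e + α) * ‖u x - u y‖ ≤ B ^ α * (A + c * A) := by
      calc r x ^ (e + α) * ‖u x - u y‖ ≤ r x ^ (e + α) * (‖u x‖ + ‖u y‖) := by
            gcongr; exact norm_sub_le _ _
        _ = r x ^ α * (r x ^ e * ‖u x‖ + r x ^ e * ‖u y‖) := by rw [Real.rpow_add hr]; ring
        _ ≤ B ^ α * (A + c * (r y ^ e * ‖u y‖)) := by
            have hbx := (le_abs_self _).trans (hB x hx.1)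
            have ha := hA x hx
            have hcx := hcc x hx y hy hxy
            have : r x ^ e * ‖u y‖ ≤ c * (r y ^ e * ‖u y‖) := by rw [← mul_assoc]; gcongr
            gcongr
            exact hα.1.le
        _ ≤ _ := by gcongr; exact hA y hy
    have h2 : 1 ≤ ‖x - y‖ ^ α / ε ^ α := by
      rw [le_div_iff₀ (by positivity), one_mul]
      exact Real.rpow_le_rpow hε.le hxe.le hα.1.le
    have h3 : 0 ≤ C1 * ‖x - y‖ ^ α := by positivity
    have h4 : 0 ≤ B ^ α * (A + c * A) := by positivity
    calc _ ≤ B ^ α * (A + c * A) := h1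
      _ ≤ B ^ α * (A + c * A) * (‖x - y‖ ^ α / ε ^ α) := le_mul_of_one_le_right h4 h2
      _ = B ^ α * (A + c * A) / ε ^ α * ‖x - y‖ ^ α := by ring
      _ ≤ _ := by linarith

/-- `u` is bounded away from zero, locally uniformly up to the boundary. -/
def AwayFromZero (U : Set E3) (u : E3 → ℝ) : Prop :=
  ∀ S ⊆ halfSet U, IsCompact S → ∃ c > 0, ∀ x ∈ S ∩ posSet U, c ≤ |u x|

theorem AwayFromZero.ne_zero {u : E3 → ℝ} (h : AwayFromZero U u) {x : E3} (hx : x ∈ posSet U) :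
    u x ≠ 0 := by
  obtain ⟨c, hc, h⟩ := h {x} (by simpa using posSet_subset_halfSet hx) isCompact_singleton
  exact abs_pos.1 (hc.trans_le (h x ⟨rfl, hx⟩))

theorem AwayFromZero.wbdd_inv {u : E3 → ℝ} (h : AwayFromZero U u) :
    WBdd U r 0 (fun x => (u x)⁻¹) := by
  intro S hS hS'
  obtain ⟨c, hc, h⟩ := h S hS hS'
  refine ⟨c⁻¹, fun x hx => ?_⟩
  rw [Real.rpow_zero, one_mul, norm_inv]
  exact inv_anti₀ hc (h x hx)

theorem WSemi.inv {u : E3 → ℝ} (hu : WSemi U r α 0 u) (h : AwayFromZero U u)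
    (hc : IsBoundaryChart U r) : WSemi U r α 0 (fun x => (u x)⁻¹) := by
  intro S hS hS'
  obtain ⟨C, hC0, hC⟩ := hu.nonneg hS hS'
  obtain ⟨c, hc0, hcc⟩ := h S hS hS'
  refine ⟨c⁻¹ * c⁻¹ * C, fun x hx y hy hxy => ?_⟩
  have hr := hc.pos hx.2
  have hux := h.ne_zero hx.2
  have huy := h.ne_zero hy.2
  rw [inv_sub_inv hux huy, norm_div, norm_mul, norm_sub_rev, div_eq_mul_inv, mul_inv]
  calc r x ^ (0 + α) * (‖u x - u y‖ * (‖u x‖⁻¹ * ‖u y‖⁻¹))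
      = ‖u x‖⁻¹ * ‖u y‖⁻¹ * (r x ^ (0 + α) * ‖u x - u y‖) := by ring
    _ ≤ c⁻¹ * c⁻¹ * (C * ‖x - y‖ ^ α) := by
        have h1 : ‖u x‖⁻¹ ≤ c⁻¹ := inv_anti₀ hc0 (hcc x hx)
        have h2 : ‖u y‖⁻¹ ≤ c⁻¹ := inv_anti₀ hc0 (hcc y hy)
        exact mul_le_mul (mul_le_mul h1 h2 (by positivity) (by positivity)) (hC x hx y hy hxy)
          (by positivity) (by positivity)
    _ = _ := by ring

end Weighted

/-! ### Partial derivatives -/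

section PartialDerivatives

variable {u v : E3 → ℝ} {x : E3} (i : Fin 3)

theorem pd_congr_of_eventuallyEq (h : u =ᶠ[𝓝 x] v) : pd i u x = pd i v x := by
  rw [pd, pd, h.fderiv_eq]

theorem pd_congr_of_eqOn {D : Set E3} (hD : IsOpen D) (h : ∀ x ∈ D, u x = v x) (hx : x ∈ D) :
    pd i u x = pd i v x :=
  pd_congr_of_eventuallyEq i (Filter.eventuallyEq_of_mem (hD.mem_nhds hx) h)

theorem pd_const (c : ℝ) : pd i (fun _ => c) x = 0 := by simp [pd]

theorem pd_add (hu : DifferentiableAt ℝ u x) (hv : DifferentiableAt ℝ v x) :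
    pd i (fun y => u y + v y) x = pd i u x + pd i v x := by
  rw [pd, fderiv_fun_add hu hv]; rfl

theorem pd_sub (hu : DifferentiableAt ℝ u x) (hv : DifferentiableAt ℝ v x) :
    pd i (fun y => u y - v y) x = pd i u x - pd i v x := by
  rw [pd, fderiv_fun_sub hu hv]; rfl

theorem pd_neg : pd i (fun y => -u y) x = -pd i u x := by
  rw [pd, fderiv_fun_neg]; rfl

theorem pd_mul (hu : DifferentiableAt ℝ u x) (hv : DifferentiableAt ℝ v x) :
    pd i (fun y => u y * v y) x = pd i u x * v x + u x * pd i v x := by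
  rw [pd, fderiv_fun_mul hu hv]
  simp only [pd, add_apply, smul_apply, smul_eq_mul]
  ring

theorem pd_sum {ι : Type*} (t : Finset ι) {w : ι → E3 → ℝ}
    (h : ∀ a ∈ t, DifferentiableAt ℝ (w a) x) :
    pd i (fun y => ∑ a ∈ t, w a y) x = ∑ a ∈ t, pd i (w a) x := by
  rw [pd, fderiv_fun_sum h]
  simp [pd]

theorem pd_inv (hu : DifferentiableAt ℝ u x) (h : u x ≠ 0) :
    pd i (fun y => (u y)⁻¹) x = -((u x)⁻¹ * (u x)⁻¹) * pd i u x := by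
  have h1 : HasFDerivAt (fun y => (u y)⁻¹) (-(u x ^ 2)⁻¹ • fderiv ℝ u x) x :=
    (hasDerivAt_inv h).comp_hasFDerivAt x hu.hasFDerivAt
  rw [pd, h1.fderiv, smul_apply, smul_eq_mul, pd, sq, mul_inv]

theorem fderiv_eq_sum_pd : fderiv ℝ u x = ∑ j, pd j u x • EuclideanSpace.proj j := by
  ext v
  have hv : v = ∑ j, v j • EuclideanSpace.single j (1 : ℝ) := by
    ext j
    simp [Pi.single_apply]
  conv_lhs => rw [hv]
  simp [pd, mul_comm, map_sum]

end PartialDerivatives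

/-! ### The algebra of functions with weighted Hölder bounds -/

/-- Functions `u` on `posSet U` with `n` derivatives, the `j`-th bounded by `r ^ (-max (s + j) 0)`,
and with the corresponding Hölder bound on the last; all bounds are locally uniform up to the
boundary. Negative `s` means that the first `-s` derivatives are bounded. -/
def WHolder (U : Set E3) (r : E3 → ℝ) (α : ℝ) : ℕ → ℤ → (E3 → ℝ) → Prop
  | 0, s, u => ContinuousOn u (posSet U) ∧ WBdd U r (s.toNat : ℝ) u ∧ WSemi U r α (s.toNat : ℝ) u
  | n + 1, s, u => DifferentiableOn ℝ u (posSet U) ∧ WBdd U r (s.toNat : ℝ) u ∧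
      ∀ i, WHolder U r α n (s + 1) (pd i u)

namespace WHolder

variable {U : Set E3} {r : E3 → ℝ} {α : ℝ} {n : ℕ} {s t q : ℤ} {u v : E3 → ℝ}

theorem wbdd : ∀ {n : ℕ}, WHolder U r α n s u → WBdd U r (s.toNat : ℝ) u
  | 0, h => h.2.1
  | _ + 1, h => h.2.1

theorem wbdd_zero (h : WHolder U r α n s u) (hs : s ≤ 0) : WBdd U r 0 u := by
  have := h.wbdd
  rwa [Int.toNat_of_nonpos hs, Nat.cast_zero] at this

theorem continuousOn : ∀ {n : ℕ}, WHolder U r α n s u → ContinuousOn u (posSet U)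
  | 0, h => h.1
  | _ + 1, h => h.1.continuousOn

theorem pd (h : WHolder U r α (n + 1) s u) (i : Fin 3) :
    WHolder U r α n (s + 1) (Hyperboloidal.pd i u) := h.2.2 i

theorem differentiableAt (h : WHolder U r α (n + 1) s u) (hc : IsBoundaryChart U r) {x : E3}
    (hx : x ∈ posSet U) : DifferentiableAt ℝ u x :=
  h.1.differentiableAt (hc.isOpen_posSet.mem_nhds hx)

theorem congr (hc : IsBoundaryChart U r) (h : WHolder U r α n s u)
    (huv : ∀ x ∈ posSet U, u x = v x) : WHolder U r α n s v := by
  induction n generalizing s u v with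
  | zero => exact ⟨h.1.congr fun x hx => (huv x hx).symm, h.2.1.congr huv, h.2.2.congr huv⟩
  | succ n ih =>
    exact ⟨h.1.congr fun x hx => (huv x hx).symm, h.2.1.congr huv, fun i =>
      ih (h.2.2 i) fun x hx => pd_congr_of_eqOn i hc.isOpen_posSet huv hx⟩

theorem of_succ (hc : IsBoundaryChart U r) (hα : 0 < α ∧ α < 1)
    (h : WHolder U r α (n + 1) s u) : WHolder U r α n s u := by
  induction n generalizing s u with
  | zero =>
    refine ⟨h.1.continuousOn, h.2.1, WSemi.of_pd hc hα h.1 h.2.1 fun i => ?_⟩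
    exact (h.2.2 i).wbdd.mono_exp hc (by exact_mod_cast (by omega : (s + 1).toNat ≤ s.toNat + 1))
  | succ n ih => exact ⟨h.1, h.2.1, fun i => ih (h.2.2 i)⟩

theorem mono (hc : IsBoundaryChart U r) (hst : s ≤ t) (h : WHolder U r α n s u) :
    WHolder U r α n t u := by
  have he : (s.toNat : ℝ) ≤ t.toNat := by exact_mod_cast (by omega : s.toNat ≤ t.toNat)
  induction n generalizing s t u with
  | zero => exact ⟨h.1, h.2.1.mono_exp hc he, h.2.2.mono_exp hc he⟩
  | succ n ih => exact ⟨h.1, h.2.1.mono_exp hc he, fun i => ih (by omega) (h.2.2 i)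
      (by exact_mod_cast (by omega : (s + 1).toNat ≤ (t + 1).toNat))⟩

theorem add (hc : IsBoundaryChart U r) (hu : WHolder U r α n s u) (hv : WHolder U r α n s v) :
    WHolder U r α n s (fun x => u x + v x) := by
  induction n generalizing s u v with
  | zero => exact ⟨hu.1.add hv.1, hu.2.1.add hv.2.1 hc, hu.2.2.add hv.2.2 hc⟩
  | succ n ih =>
    refine ⟨hu.1.add hv.1, hu.2.1.add hv.2.1 hc, fun i => ?_⟩
    exact (ih (hu.2.2 i) (hv.2.2 i)).congr hc fun x hx =>
      (pd_add i (hu.differentiableAt hc hx) (hv.differentiableAt hc hx)).symm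

theorem mul (hc : IsBoundaryChart U r) (hα : 0 < α ∧ α < 1) (hu : WHolder U r α n s u)
    (hv : WHolder U r α n t v) (hs : s ≤ q) (ht : t ≤ q) (hst : s + t ≤ q) :
    WHolder U r α n q (fun x => u x * v x) := by
  have he : (s.toNat : ℝ) + t.toNat ≤ q.toNat := by
    exact_mod_cast (by omega : s.toNat + t.toNat ≤ q.toNat)
  induction n generalizing s t q u v with
  | zero => exact ⟨hu.1.mul hv.1, (hu.2.1.mul hv.2.1 hc).mono_exp hc he,
      (hu.2.2.mul hu.2.1 hv.2.1 hv.2.2 hc).mono_exp hc he⟩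
  | succ n ih =>
    refine ⟨hu.1.mul hv.1, (hu.2.1.mul hv.2.1 hc).mono_exp hc he, fun i => ?_⟩
    refine (add hc (ih (q := q + 1) (hu.2.2 i) (hv.of_succ hc hα) ?_ ?_ ?_ ?_)
      (ih (q := q + 1) (hu.of_succ hc hα) (hv.2.2 i) ?_ ?_ ?_ ?_)).congr hc fun x hx =>
        (pd_mul i (hu.differentiableAt hc hx) (hv.differentiableAt hc hx)).symm
    all_goals first | omega | exact_mod_cast (by omega)

/-- For `s ≤ 0` the class is closed under products. -/
theorem mul' (hc : IsBoundaryChart U r) (hα : 0 < α ∧ α < 1) (hs : s ≤ 0)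
    (hu : WHolder U r α n s u) (hv : WHolder U r α n s v) :
    WHolder U r α n s (fun x => u x * v x) :=
  hu.mul hc hα hv le_rfl le_rfl (by omega)

/-- Functions that are smooth up to the boundary belong to all the classes. -/
theorem of_contDiffOn (hc : IsBoundaryChart U r) (hα : 0 < α ∧ α < 1)
    (hu : ContDiffOn ℝ ∞ u (halfSet U)) (n : ℕ) (s : ℤ) : WHolder U r α n s u := by
  have hbdd : ∀ {v : E3 → ℝ}, ContDiffOn ℝ ∞ v (halfSet U) → ∀ k : ℕ, WBdd U r k v := by
    intro v hv k
    refine WBdd.mono_exp (e := 0) (fun S hS hS' => ?_) hc (Nat.cast_nonneg k)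
    obtain ⟨C, hC⟩ := hS'.exists_bound_of_continuousOn (hv.continuousOn.mono hS)
    exact ⟨C, fun x hx => by simpa using hC x hx.1⟩
  have hpd : ∀ {v : E3 → ℝ}, ContDiffOn ℝ ∞ v (halfSet U) → ∀ i,
      ∃ w, ContDiffOn ℝ ∞ w (halfSet U) ∧ ∀ x ∈ posSet U, w x = Hyperboloidal.pd i v x := by
    intro v hv i
    refine ⟨fun x => fderivWithin ℝ v (halfSet U) x (EuclideanSpace.single i 1), ?_, fun x hx => ?_⟩
    · exact (hv.fderivWithin (uniqueDiffOn_halfSet hc.isOpen) (by simp)).clm_apply contDiffOn_const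
    · beta_reduce
      rw [Hyperboloidal.pd, fderivWithin_of_mem_nhds]
      exact mem_of_superset (hc.isOpen_posSet.mem_nhds hx) posSet_subset_halfSet
  have hdiff : ∀ {v : E3 → ℝ}, ContDiffOn ℝ ∞ v (halfSet U) → DifferentiableOn ℝ v (posSet U) :=
    fun hv => (hv.differentiableOn (by simp)).mono posSet_subset_halfSet
  induction n generalizing s u with
  | zero =>
    refine ⟨hu.continuousOn.mono posSet_subset_halfSet, hbdd hu _,
      WSemi.of_pd hc hα (hdiff hu) (hbdd hu _) fun i => ?_⟩
    obtain ⟨w, hw, hwu⟩ := hpd hu i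
    exact_mod_cast (hbdd hw (s.toNat + 1)).congr hwu
  | succ n ih =>
    refine ⟨hdiff hu, hbdd hu _, fun i => ?_⟩
    obtain ⟨w, hw, hwu⟩ := hpd hu i
    exact (ih hw (s + 1)).congr hc hwu

theorem const (hc : IsBoundaryChart U r) (hα : 0 < α ∧ α < 1) (c : ℝ) :
    WHolder U r α n s (fun _ => c) :=
  of_contDiffOn hc hα contDiffOn_const n s

theorem const_mul (hc : IsBoundaryChart U r) (hα : 0 < α ∧ α < 1) (c : ℝ)
    (hu : WHolder U r α n s u) : WHolder U r α n s (fun x => c * u x) :=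
  (const hc hα c : WHolder U r α n (min s 0) _).mul hc hα hu (min_le_left _ _) le_rfl (by omega)

theorem neg (hc : IsBoundaryChart U r) (hα : 0 < α ∧ α < 1) (hu : WHolder U r α n s u) :
    WHolder U r α n s (fun x => -u x) :=
  (hu.const_mul hc hα (-1)).congr hc fun x _ => by ring

theorem sub (hc : IsBoundaryChart U r) (hα : 0 < α ∧ α < 1) (hu : WHolder U r α n s u)
    (hv : WHolder U r α n s v) : WHolder U r α n s (fun x => u x - v x) :=
  (hu.add hc (hv.neg hc hα)).congr hc fun x _ => by ring

theorem sum (hc : IsBoundaryChart U r) (hα : 0 < α ∧ α < 1) {ι : Type*} (T : Finset ι)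
    {w : ι → E3 → ℝ} (h : ∀ a ∈ T, WHolder U r α n s (w a)) :
    WHolder U r α n s (fun x => ∑ a ∈ T, w a x) := by
  classical
  induction T using Finset.induction_on with
  | empty => simpa using const hc hα 0
  | insert a T ha ih =>
    refine ((h a (by simp)).add hc (ih fun b hb => h b (by simp [hb]))).congr hc fun x _ => ?_
    rw [Finset.sum_insert ha]

theorem inv (hc : IsBoundaryChart U r) (hα : 0 < α ∧ α < 1) (hs : s ≤ 0)
    (hu : WHolder U r α n s u) (h0 : AwayFromZero U u) :
    WHolder U r α n s (fun x => (u x)⁻¹) := by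
  have hs0 : (s.toNat : ℝ) = 0 := by simp [Int.toNat_of_nonpos hs]
  induction n with
  | zero =>
    refine ⟨hu.1.inv₀ fun x hx => h0.ne_zero hx, hs0 ▸ h0.wbdd_inv, ?_⟩
    have := hu.2.2
    rw [hs0] at this ⊢
    exact this.inv h0 hc
  | succ n ih =>
    refine ⟨hu.1.fun_inv fun x hx => h0.ne_zero hx, hs0 ▸ h0.wbdd_inv, fun i => ?_⟩
    have h1 := ih (hu.of_succ hc hα)
    refine (((h1.mul' hc hα hs h1).neg hc hα).mul hc hα (hu.2.2 i) (q := s + 1) (by omega) le_rfl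
      (by omega)).congr hc fun x hx => ?_
    exact (pd_inv i (hu.differentiableAt hc hx) (h0.ne_zero hx)).symm

end WHolder

/-! ### Iterated derivatives -/

/-- The bounds that define the weighted Hölder spaces of exponent `e`, in one chart, in terms of
iterated derivatives. -/
def HolderBounds (U : Set E3) (r : E3 → ℝ) (α : ℝ) (n : ℕ) (e : ℝ) (u : E3 → ℝ) : Prop :=
  ContDiffOn ℝ n u (posSet U) ∧ (∀ j ≤ n, WBdd U r (e + j) (iteratedFDeriv ℝ j u)) ∧
    WSemi U r α (e + n) (iteratedFDeriv ℝ n u)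

section Iterated

variable {U : Set E3} {r : E3 → ℝ} {α e : ℝ} {n : ℕ} {s : ℤ} {u : E3 → ℝ}

theorem norm_iteratedFDeriv_succ_sub (j : ℕ) (x y : E3) :
    ‖iteratedFDeriv ℝ (j + 1) u x - iteratedFDeriv ℝ (j + 1) u y‖
      = ‖iteratedFDeriv ℝ j (fderiv ℝ u) x - iteratedFDeriv ℝ j (fderiv ℝ u) y‖ := by
  have h : ∀ z, iteratedFDeriv ℝ (j + 1) u z = (continuousMultilinearCurryRightEquiv' ℝ j E3 ℝ).symm
      (iteratedFDeriv ℝ j (fderiv ℝ u) z) := fun z => by rw [iteratedFDeriv_succ_eq_comp_right]; rfl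
  rw [h x, h y, ← dist_eq_norm, ← dist_eq_norm]
  exact (continuousMultilinearCurryRightEquiv' ℝ j E3 ℝ).symm.isometry.dist_eq _ _

theorem norm_iteratedFDeriv_zero_sub (x y : E3) :
    ‖iteratedFDeriv ℝ 0 u x - iteratedFDeriv ℝ 0 u y‖ = ‖u x - u y‖ := by
  rw [iteratedFDeriv_zero_eq_comp]
  simp only [Function.comp_apply]
  rw [← map_sub, LinearIsometryEquiv.norm_map]

theorem wbdd_iteratedFDeriv_zero (hc : IsBoundaryChart U r) :
    WBdd U r e (iteratedFDeriv ℝ 0 u) ↔ WBdd U r e u :=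
  ⟨fun h => h.of_norm_le hc 1 fun x _ => by simp, fun h => h.of_norm_le hc 1 fun x _ => by simp⟩

theorem holderBounds_zero (hc : IsBoundaryChart U r) :
    HolderBounds U r α 0 e u ↔
      ContinuousOn u (posSet U) ∧ WBdd U r e u ∧ WSemi U r α e u := by
  simp only [HolderBounds, Nat.le_zero, forall_eq, Nat.cast_zero, add_zero,
    wbdd_iteratedFDeriv_zero hc, contDiffOn_zero]
  refine and_congr Iff.rfl (and_congr Iff.rfl ⟨fun h => ?_, fun h => ?_⟩)
  · exact h.of_norm_le hc 1 fun x _ y _ => by rw [norm_iteratedFDeriv_zero_sub, one_mul]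
  · exact h.of_norm_le hc 1 fun x _ y _ => by rw [norm_iteratedFDeriv_zero_sub, one_mul]

theorem wbdd_iteratedFDeriv_succ (hc : IsBoundaryChart U r) (j : ℕ) :
    WBdd U r e (iteratedFDeriv ℝ (j + 1) u) ↔ WBdd U r e (iteratedFDeriv ℝ j (fderiv ℝ u)) :=
  ⟨fun h => h.of_norm_le hc 1 fun x _ => by rw [← norm_iteratedFDeriv_fderiv, one_mul],
    fun h => h.of_norm_le hc 1 fun x _ => by rw [← norm_iteratedFDeriv_fderiv, one_mul]⟩

theorem wsemi_iteratedFDeriv_succ (hc : IsBoundaryChart U r) (j : ℕ) :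
    WSemi U r α e (iteratedFDeriv ℝ (j + 1) u)
      ↔ WSemi U r α e (iteratedFDeriv ℝ j (fderiv ℝ u)) :=
  ⟨fun h => h.of_norm_le hc 1 fun x _ y _ => by rw [norm_iteratedFDeriv_succ_sub, one_mul],
    fun h => h.of_norm_le hc 1 fun x _ y _ => by rw [norm_iteratedFDeriv_succ_sub, one_mul]⟩

theorem iteratedFDeriv_pd {j : ℕ} {x : E3} (h : ContDiffAt ℝ j (fderiv ℝ u) x) (i : Fin 3) :
    iteratedFDeriv ℝ j (pd i u) x =
      (ContinuousLinearMap.apply ℝ ℝ (EuclideanSpace.single i (1 : ℝ) : E3)).compContinuousMultilinearMap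
        (iteratedFDeriv ℝ j (fderiv ℝ u) x) :=
  ContinuousLinearMap.iteratedFDeriv_comp_left
    (ContinuousLinearMap.apply ℝ ℝ (EuclideanSpace.single i (1 : ℝ) : E3)) h le_rfl

theorem iteratedFDeriv_fderiv_eq_sum {j : ℕ} {x : E3} (h : ∀ i, ContDiffAt ℝ j (pd i u) x) :
    iteratedFDeriv ℝ j (fderiv ℝ u) x =
      ∑ i, (ContinuousLinearMap.toSpanSingleton ℝ
        (EuclideanSpace.proj i : E3 →L[ℝ] ℝ)).compContinuousMultilinearMap
          (iteratedFDeriv ℝ j (pd i u) x) := by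
  have h1 : fderiv ℝ u = fun x => ∑ i, (ContinuousLinearMap.toSpanSingleton ℝ
      (EuclideanSpace.proj i : E3 →L[ℝ] ℝ)) (pd i u x) := by
    ext1 x
    rw [fderiv_eq_sum_pd]
    simp [ContinuousLinearMap.toSpanSingleton_apply]
  rw [h1, iteratedFDeriv_fun_sum_apply (by exact fun i _ => (ContinuousLinearMap.contDiff _).contDiffAt.comp x (h i))]
  refine Finset.sum_congr rfl fun i _ => ?_
  exact ContinuousLinearMap.iteratedFDeriv_comp_left _ (h i) le_rfl

theorem contDiffAt_of_contDiffOn_posSet (hc : IsBoundaryChart U r) {F : Type*}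
    [NormedAddCommGroup F] [NormedSpace ℝ F] {f : E3 → F} {k : ℕ} (h : ContDiffOn ℝ n f (posSet U))
    (hk : k ≤ n) {x : E3} (hx : x ∈ posSet U) : ContDiffAt ℝ k f x :=
  (h.contDiffAt (hc.isOpen_posSet.mem_nhds hx)).of_le (by exact_mod_cast hk)

theorem contDiffOn_succ_iff_pd (hc : IsBoundaryChart U r) :
    ContDiffOn ℝ (n + 1 : ℕ) u (posSet U) ↔
      DifferentiableOn ℝ u (posSet U) ∧ ∀ i, ContDiffOn ℝ n (pd i u) (posSet U) := by
  rw [Nat.cast_add, Nat.cast_one, contDiffOn_succ_iff_fderiv_of_isOpen hc.isOpen_posSet]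
  simp only [WithTop.natCast_ne_top, false_implies, true_and]
  refine and_congr_right fun _ => ⟨fun h i => h.clm_apply contDiffOn_const, fun h => ?_⟩
  have h1 : fderiv ℝ u = fun x => ∑ i, pd i u x • (EuclideanSpace.proj i : E3 →L[ℝ] ℝ) :=
    funext fun x => fderiv_eq_sum_pd
  rw [h1]
  exact ContDiffOn.sum fun i _ => (h i).smul contDiffOn_const

theorem holderBounds_succ (hc : IsBoundaryChart U r) :
    HolderBounds U r α (n + 1) e u ↔
      DifferentiableOn ℝ u (posSet U) ∧ WBdd U r e u ∧
        ∀ i, HolderBounds U r α n (e + 1) (pd i u) := by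
  have hexp : ∀ j : ℕ, e + 1 + (j : ℝ) = e + ((j + 1 : ℕ) : ℝ) := fun j => by push_cast; ring
  constructor
  · rintro ⟨h1, h2, h3⟩
    obtain ⟨h4, h5⟩ := (contDiffOn_succ_iff_pd hc).1 h1
    have h6 : ∀ x ∈ posSet U, ∀ j ≤ n, ContDiffAt ℝ j (fderiv ℝ u) x := by
      intro x hx j hj
      rw [Nat.cast_add, Nat.cast_one, contDiffOn_succ_iff_fderiv_of_isOpen hc.isOpen_posSet] at h1
      exact contDiffAt_of_contDiffOn_posSet hc h1.2.2 hj hx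
    refine ⟨h4, ?_, fun i => ⟨h5 i, fun j hj => ?_, ?_⟩⟩
    · simpa using (wbdd_iteratedFDeriv_zero hc).1 (h2 0 (by omega))
    · rw [hexp]
      refine ((wbdd_iteratedFDeriv_succ hc j).1 (h2 (j + 1) (by omega))).of_norm_le hc
        ‖ContinuousLinearMap.apply ℝ ℝ (EuclideanSpace.single i (1 : ℝ) : E3)‖ fun x hx => ?_
      rw [iteratedFDeriv_pd (h6 x hx j hj)]
      exact ContinuousLinearMap.norm_compContinuousMultilinearMap_le _ _
    · rw [hexp]
      refine ((wsemi_iteratedFDeriv_succ hc n).1 h3).of_norm_le hc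
        ‖ContinuousLinearMap.apply ℝ ℝ (EuclideanSpace.single i (1 : ℝ) : E3)‖ fun x hx y hy => ?_
      rw [iteratedFDeriv_pd (h6 x hx n le_rfl), iteratedFDeriv_pd (h6 y hy n le_rfl)]
      refine le_trans (le_of_eq ?_)
        (ContinuousLinearMap.norm_compContinuousMultilinearMap_le _ _)
      congr 1
  · rintro ⟨h1, h2, h3⟩
    have h4 : ∀ x ∈ posSet U, ∀ j ≤ n, ∀ i, ContDiffAt ℝ j (pd i u) x := fun x hx j hj i =>
      contDiffAt_of_contDiffOn_posSet hc (h3 i).1 hj hx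
    refine ⟨(contDiffOn_succ_iff_pd hc).2 ⟨h1, fun i => (h3 i).1⟩, fun j hj => ?_, ?_⟩
    · rcases j with _ | j
      · simpa using (wbdd_iteratedFDeriv_zero hc).2 h2
      rw [wbdd_iteratedFDeriv_succ hc]
      have h5 : ∀ i, WBdd U r (e + ((j + 1 : ℕ) : ℝ)) (fun x => (ContinuousLinearMap.toSpanSingleton ℝ
          (EuclideanSpace.proj i : E3 →L[ℝ] ℝ)).compContinuousMultilinearMap
          (iteratedFDeriv ℝ j (pd i u) x)) := fun i => by
        rw [← hexp]
        exact ((h3 i).2.1 j (by omega)).of_norm_le hc _ fun x hx =>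
          ContinuousLinearMap.norm_compContinuousMultilinearMap_le _ _
      refine (((h5 0).add (h5 1) hc).add (h5 2) hc).congr fun x hx => ?_
      rw [iteratedFDeriv_fderiv_eq_sum (h4 x hx j (by omega)), Fin.sum_univ_three]
    · rw [wsemi_iteratedFDeriv_succ hc]
      have h5 : ∀ i, WSemi U r α (e + ((n + 1 : ℕ) : ℝ)) (fun x => (ContinuousLinearMap.toSpanSingleton ℝ
          (EuclideanSpace.proj i : E3 →L[ℝ] ℝ)).compContinuousMultilinearMap
          (iteratedFDeriv ℝ n (pd i u) x)) := fun i => by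
        rw [← hexp]
        refine (h3 i).2.2.of_norm_le hc ‖ContinuousLinearMap.toSpanSingleton ℝ
          (EuclideanSpace.proj i : E3 →L[ℝ] ℝ)‖ fun x hx y hy => ?_
        refine le_trans (le_of_eq ?_)
          (ContinuousLinearMap.norm_compContinuousMultilinearMap_le _ _)
        congr 1
        ext
        simp [sub_smul]
      refine (((h5 0).add (h5 1) hc).add (h5 2) hc).congr fun x hx => ?_
      rw [iteratedFDeriv_fderiv_eq_sum (h4 x hx n le_rfl), Fin.sum_univ_three]

theorem holderBounds_iff_wHolder (hc : IsBoundaryChart U r) (hs : 0 ≤ s) :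
    HolderBounds U r α n s u ↔ WHolder U r α n s u := by
  have hcast : ∀ {s : ℤ}, 0 ≤ s → ((s.toNat : ℕ) : ℝ) = (s : ℝ) := fun hs => by
    exact_mod_cast Int.toNat_of_nonneg hs
  induction n generalizing s u with
  | zero => rw [holderBounds_zero hc, WHolder, hcast hs]
  | succ n ih =>
    rw [holderBounds_succ hc, WHolder, hcast hs]
    refine and_congr_right fun _ => and_congr_right fun _ => forall_congr' fun i => ?_
    refine Iff.trans ?_ (ih (s := s + 1) (u := pd i u) (by omega))
    rw [Int.cast_add, Int.cast_one]

/-- The bounds of weight `-1` are those of the class `WHolder U r α (n + 1) (-1)` together with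
vanishing of first order at the boundary. -/
theorem holderBounds_neg_one_iff (hc : IsBoundaryChart U r) (hu : WHolder U r α (n + 1) (-1) u) :
    HolderBounds U r α (n + 1) (-1) u ↔ WBdd U r (-1) u := by
  rw [holderBounds_succ hc]
  refine ⟨fun h => h.2.1, fun h => ⟨hu.1, h, fun i => ?_⟩⟩
  have := (holderBounds_iff_wHolder hc le_rfl).2 (hu.2.2 i)
  simpa using this

end Iterated

/-! ### Ricci curvature of a conformally rescaled metric: algebra -/

/-- The effect on the Ricci tensor of adding `C = δ f + f δ - g u` to the Christoffel symbols `Γ` of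
the metric `g`, as an algebraic identity at a point; `u` is the vector dual to the covector `f`, and
`df`, `du`, `dg` are the partial derivatives of `f`, `u` and `g`. -/
theorem ricci_conformal_algebra (g df du : Fin 3 → Fin 3 → ℝ) (Γ dg C : Fin 3 → Fin 3 → Fin 3 → ℝ)
    (dC : Fin 3 → Fin 3 → Fin 3 → Fin 3 → ℝ) (f u : Fin 3 → ℝ)
    (hg : ∀ i j, g i j = g j i) (hΓ : ∀ l i j, Γ l i j = Γ l j i) (hdf : ∀ i j, df i j = df j i)
    (hf : ∀ i, f i = ∑ l, g i l * u l)
    (hdf' : ∀ p i, df p i = ∑ l, (dg p i l * u l + g i l * du p l))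
    (hdg : ∀ m i j, dg m i j = ∑ l, (g i l * Γ l m j + g j l * Γ l m i))
    (hC : ∀ l i j, C l i j = (if l = i then 1 else 0) * f j + (if l = j then 1 else 0) * f i
      - g i j * u l)
    (hdC : ∀ p l i j, dC p l i j = (if l = i then 1 else 0) * df p j
      + (if l = j then 1 else 0) * df p i - (dg p i j * u l + g i j * du p l))
    (i j : Fin 3) :
    ∑ l, (dC l l i j - dC j l i l + ∑ m, (Γ l l m * C m i j + C l l m * Γ m i j + C l l m * C m i j
      - Γ l j m * C m i l - C l j m * Γ m i l - C l j m * C m i l))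
    = -(df i j - ∑ l, Γ l i j * f l) - g i j * (∑ l, (du l l + ∑ m, Γ l l m * u m))
      + f i * f j - g i j * ∑ m, u m * f m := by
  have h1 := hg 1 0
  have h2 := hg 2 0
  have h3 := hg 2 1
  have h4 := fun l => hΓ l 1 0
  have h5 := fun l => hΓ l 2 0
  have h6 := fun l => hΓ l 2 1
  have h7 := hdf 1 0
  have h8 := hdf 2 0
  have h9 := hdf 2 1
  have h10 := hdf' j i
  fin_cases i <;> fin_cases j <;>
  · simp only [Fin.sum_univ_three, hdC, hC, hdg, hf, Fin.zero_eta, Fin.mk_one, Fin.reduceFinMk]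
      at h10 ⊢
    simp only [Fin.isValue, if_true, Fin.reduceEq, if_false, h1, h2, h3, h4, h5, h6, h7, h8, h9]
      at h10 ⊢
    linear_combination -h10

/-! ### Local Riemannian geometry -/

theorem adjugate_apply_cyclic (A : Matrix (Fin 3) (Fin 3) ℝ) (i j : Fin 3) :
    A.adjugate i j = A (j + 1) (i + 1) * A (j + 2) (i + 2) - A (j + 1) (i + 2) * A (j + 2) (i + 1) := by
  rw [Matrix.adjugate_fin_three]
  fin_cases i <;> fin_cases j <;> simp [Matrix.of_apply] <;> ring

theorem inv_apply_eq (A : Matrix (Fin 3) (Fin 3) ℝ) (i j : Fin 3) :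
    A⁻¹ i j = (A.det)⁻¹ * (A (j + 1) (i + 1) * A (j + 2) (i + 2)
      - A (j + 1) (i + 2) * A (j + 2) (i + 1)) := by
  rw [← adjugate_apply_cyclic, Matrix.inv_def, Ring.inverse_eq_inv', Matrix.smul_apply, smul_eq_mul]

theorem det_eq_sum (A : Matrix (Fin 3) (Fin 3) ℝ) :
    A.det = ∑ j, A 0 j * (A 1 (j + 1) * A 2 (j + 2) - A 1 (j + 2) * A 2 (j + 1)) := by
  rw [Matrix.det_eq_sum_mul_adjugate_row A 0]
  simp only [adjugate_apply_cyclic]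
  rfl

/-- `G` is the matrix of a `C²` Riemannian metric on the open set `D`. -/
structure IsMetricOn (D : Set E3) (G : E3 → Matrix (Fin 3) (Fin 3) ℝ) : Prop where
  isOpen : IsOpen D
  posDef : ∀ x ∈ D, (G x).PosDef
  smooth : ∀ i j, ContDiffOn ℝ 2 (fun y => G y i j) D

/-- `|df|²`, the radicand in `normD`. -/
def gradSq (G : E3 → Matrix (Fin 3) (Fin 3) ℝ) (f : E3 → ℝ) (x : E3) : ℝ :=
  ∑ i, ∑ j, (G x)⁻¹ i j * pd i f x * pd j f x

theorem ContDiffOn.pd_of_isOpen {D : Set E3} (hD : IsOpen D) {f : E3 → ℝ} {n : ℕ}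
    (hf : ContDiffOn ℝ (n + 1 : ℕ) f D) (i : Fin 3) : ContDiffOn ℝ n (pd i f) D := by
  rw [Nat.cast_add, Nat.cast_one, contDiffOn_succ_iff_fderiv_of_isOpen hD] at hf
  exact hf.2.2.clm_apply contDiffOn_const

theorem pd_comm {D : Set E3} (hD : IsOpen D) {f : E3 → ℝ} (hf : ContDiffOn ℝ 2 f D) {x : E3}
    (hx : x ∈ D) (i j : Fin 3) : pd i (pd j f) x = pd j (pd i f) x := by
  have h1 : ContDiffAt ℝ 2 f x := hf.contDiffAt (hD.mem_nhds hx)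
  have h2 : DifferentiableAt ℝ (fderiv ℝ f) x :=
    (h1.fderiv_right (m := 1) (by norm_num)).differentiableAt (by simp)
  have h3 : ∀ i j, pd i (pd j f) x
      = fderiv ℝ (fderiv ℝ f) x (EuclideanSpace.single i 1) (EuclideanSpace.single j 1) := by
    intro i j
    unfold pd
    rw [fderiv_clm_apply h2 (differentiableAt_const _)]
    simp
  rw [h3, h3]
  exact (h1.isSymmSndFDerivAt (by simp)) _ _

namespace IsMetricOn

variable {D : Set E3} {G : E3 → Matrix (Fin 3) (Fin 3) ℝ} {x : E3}

theorem symm (hG : IsMetricOn D G) (hx : x ∈ D) (i j : Fin 3) : G x i j = G x j i := by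
  simpa using ((hG.posDef x hx).isHermitian.apply i j).symm

theorem inv_symm (hG : IsMetricOn D G) (hx : x ∈ D) (i j : Fin 3) :
    (G x)⁻¹ i j = (G x)⁻¹ j i := by
  simpa using ((hG.posDef x hx).inv.isHermitian.apply i j).symm

theorem isUnit_det (hG : IsMetricOn D G) (hx : x ∈ D) : IsUnit (G x).det :=
  (hG.posDef x hx).det_pos.ne'.isUnit

theorem sum_inv_mul (hG : IsMetricOn D G) (hx : x ∈ D) (i l : Fin 3) :
    ∑ j, (G x)⁻¹ i j * G x j l = if i = l then 1 else 0 := by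
  rw [← Matrix.mul_apply, Matrix.nonsing_inv_mul _ (hG.isUnit_det hx), Matrix.one_apply]

theorem sum_mul_inv (hG : IsMetricOn D G) (hx : x ∈ D) (i l : Fin 3) :
    ∑ j, G x i j * (G x)⁻¹ j l = if i = l then 1 else 0 := by
  rw [← Matrix.mul_apply, Matrix.mul_nonsing_inv _ (hG.isUnit_det hx), Matrix.one_apply]

theorem differentiableAt (hG : IsMetricOn D G) (hx : x ∈ D) (i j : Fin 3) :
    DifferentiableAt ℝ (fun y => G y i j) x :=
  ((hG.smooth i j).contDiffAt (hG.isOpen.mem_nhds hx)).differentiableAt (by simp)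

theorem contDiffOn_inv (hG : IsMetricOn D G) (i j : Fin 3) :
    ContDiffOn ℝ 2 (fun y => (G y)⁻¹ i j) D := by
  have hs := hG.smooth
  have hdet : ContDiffOn ℝ 2 (fun y => (G y).det) D := by
    simp only [det_eq_sum]
    exact ContDiffOn.sum fun j _ => (hs _ _).mul (((hs _ _).mul (hs _ _)).sub ((hs _ _).mul (hs _ _)))
  simp only [inv_apply_eq]
  exact (hdet.inv fun x hx => (hG.posDef x hx).det_pos.ne').mul
    (((hs _ _).mul (hs _ _)).sub ((hs _ _).mul (hs _ _)))

theorem differentiableAt_inv (hG : IsMetricOn D G) (hx : x ∈ D) (i j : Fin 3) :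
    DifferentiableAt ℝ (fun y => (G y)⁻¹ i j) x :=
  ((hG.contDiffOn_inv i j).contDiffAt (hG.isOpen.mem_nhds hx)).differentiableAt (by simp)

theorem contDiffOn_pd (hG : IsMetricOn D G) (m i j : Fin 3) :
    ContDiffOn ℝ 1 (pd m (fun y => G y i j)) D :=
  ContDiffOn.pd_of_isOpen (n := 1) hG.isOpen (hG.smooth i j) m

theorem contDiffOn_christoffel (hG : IsMetricOn D G) (l i j : Fin 3) :
    ContDiffOn ℝ 1 (christoffel G l i j) D := by
  unfold christoffel
  exact contDiffOn_const.mul (ContDiffOn.sum fun m _ => ((hG.contDiffOn_inv l m).of_le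
    (by norm_num)).mul (((hG.contDiffOn_pd _ _ _).add (hG.contDiffOn_pd _ _ _)).sub
      (hG.contDiffOn_pd _ _ _)))

theorem differentiableAt_christoffel (hG : IsMetricOn D G) (hx : x ∈ D) (l i j : Fin 3) :
    DifferentiableAt ℝ (christoffel G l i j) x :=
  ((hG.contDiffOn_christoffel l i j).contDiffAt (hG.isOpen.mem_nhds hx)).differentiableAt (by simp)

theorem pd_symm (hG : IsMetricOn D G) (hx : x ∈ D) (m i j : Fin 3) :
    pd m (fun y => G y i j) x = pd m (fun y => G y j i) x :=
  pd_congr_of_eqOn m hG.isOpen (fun _ hy => hG.symm hy i j) hx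

theorem christoffel_symm (hG : IsMetricOn D G) (hx : x ∈ D) (l i j : Fin 3) :
    christoffel G l i j x = christoffel G l j i x := by
  unfold christoffel
  congr 1
  refine Finset.sum_congr rfl fun m _ => ?_
  rw [hG.pd_symm hx m i j]
  ring

/-- Lowering the index of the Christoffel symbols. -/
theorem sum_mul_christoffel (hG : IsMetricOn D G) (hx : x ∈ D) (p i j : Fin 3) :
    ∑ l, G x p l * christoffel G l i j x = (1 / 2) * (pd i (fun y => G y p j) x
      + pd j (fun y => G y p i) x - pd p (fun y => G y i j) x) := by
  calc ∑ l, G x p l * christoffel G l i j x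
      = (1 / 2) * ∑ m, (∑ l, G x p l * (G x)⁻¹ l m) * (pd i (fun y => G y m j) x
        + pd j (fun y => G y m i) x - pd m (fun y => G y i j) x) := by
        unfold christoffel
        simp only [Fin.sum_univ_three]
        ring
    _ = _ := by simp [hG.sum_mul_inv hx]

/-- Compatibility of the connection with the metric. -/
theorem pd_metric (hG : IsMetricOn D G) (hx : x ∈ D) (m i j : Fin 3) :
    pd m (fun y => G y i j) x
      = ∑ l, (G x i l * christoffel G l m j x + G x j l * christoffel G l m i x) := by
  rw [Finset.sum_add_distrib, hG.sum_mul_christoffel hx, hG.sum_mul_christoffel hx,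
    hG.pd_symm hx m j i, hG.pd_symm hx j i m, hG.pd_symm hx i m j]
  ring

theorem sum_mul_raise (hG : IsMetricOn D G) (hx : x ∈ D) (w : Fin 3 → ℝ) (i : Fin 3) :
    ∑ l, G x i l * ∑ m, (G x)⁻¹ l m * w m = w i := by
  calc ∑ l, G x i l * ∑ m, (G x)⁻¹ l m * w m
      = ∑ m, (∑ l, G x i l * (G x)⁻¹ l m) * w m := by simp only [Fin.sum_univ_three]; ring
    _ = _ := by simp [hG.sum_mul_inv hx]

variable {f : Fin 3 → E3 → ℝ}

theorem differentiableAt_raise (hG : IsMetricOn D G) (hx : x ∈ D)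
    (hf : ∀ i, DifferentiableAt ℝ (f i) x) (l : Fin 3) :
    DifferentiableAt ℝ (fun y => ∑ m, (G y)⁻¹ l m * f m y) x :=
  DifferentiableAt.fun_sum fun m _ => (hG.differentiableAt_inv hx l m).mul (hf m)

theorem pd_lower (hG : IsMetricOn D G) (hx : x ∈ D) (hf : ∀ i, DifferentiableAt ℝ (f i) x)
    (p i : Fin 3) :
    pd p (f i) x = ∑ l, (pd p (fun y => G y i l) x * ∑ m, (G x)⁻¹ l m * f m x
      + G x i l * pd p (fun y => ∑ m, (G y)⁻¹ l m * f m y) x) := by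
  have h1 : pd p (f i) x = pd p (fun y => ∑ l, G y i l * ∑ m, (G y)⁻¹ l m * f m y) x :=
    pd_congr_of_eqOn p hG.isOpen
      (fun y hy => (hG.sum_mul_raise hy (fun m => f m y) i).symm) hx
  rw [h1]
  refine (pd_sum p Finset.univ (w := fun l y => G y i l * ∑ m, (G y)⁻¹ l m * f m y) fun l _ =>
    (hG.differentiableAt hx i l).mul (hG.differentiableAt_raise hx hf l)).trans ?_
  exact Finset.sum_congr rfl fun l _ =>
    pd_mul p (hG.differentiableAt hx i l) (hG.differentiableAt_raise hx hf l)

/-- The Lie derivative of the metric along the vector field dual to the covector field `f` is the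
symmetrized covariant derivative of `f`. -/
theorem lieMetric_raise (hG : IsMetricOn D G) (hx : x ∈ D)
    (hf : ∀ i, DifferentiableAt ℝ (f i) x) (i j : Fin 3) :
    (1 / 2) * lieMetric G (fun l y => ∑ m, (G y)⁻¹ l m * f m y) i j x
      = (1 / 2) * (pd i (f j) x + pd j (f i) x) - ∑ l, christoffel G l i j x * f l x := by
  set u : Fin 3 → E3 → ℝ := fun l y => ∑ m, (G y)⁻¹ l m * f m y with hu
  have h1 : ∑ l, christoffel G l i j x * f l x
      = ∑ p, u p x * ((1 / 2) * (pd i (fun y => G y p j) x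
        + pd j (fun y => G y p i) x - pd p (fun y => G y i j) x)) := by
    calc ∑ l, christoffel G l i j x * f l x
        = ∑ l, christoffel G l i j x * ∑ p, G x l p * u p x := by
          refine Finset.sum_congr rfl fun l _ => ?_
          rw [hu, hG.sum_mul_raise hx (fun m => f m x) l]
      _ = ∑ p, u p x * ∑ l, G x l p * christoffel G l i j x := by
          simp only [Fin.sum_univ_three]; ring
      _ = _ := by
          refine Finset.sum_congr rfl fun p _ => ?_
          rw [← hG.sum_mul_christoffel hx]
          simp only [hG.symm hx p]
  have h2 := hG.pd_lower hx hf i j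
  have h3 := hG.pd_lower hx hf j i
  rw [h1, h2, h3, lieMetric]
  have h4 : ∀ l, G x l j = G x j l := fun l => hG.symm hx l j
  have h5 : ∀ l, pd i (fun y => G y l j) x = pd i (fun y => G y j l) x :=
    fun l => hG.pd_symm hx i l j
  have h6 : ∀ l, pd j (fun y => G y l i) x = pd j (fun y => G y i l) x :=
    fun l => hG.pd_symm hx j l i
  simp only [h4, h5, h6, Fin.sum_univ_three, show ∀ l, ∑ m, (G x)⁻¹ l m * f m x = u l x from
    fun l => rfl]
  have h7 : ∀ l, (fun y => (G y)⁻¹ l 0 * f 0 y + (G y)⁻¹ l 1 * f 1 y + (G y)⁻¹ l 2 * f 2 y) = u l :=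
    fun l => by rw [hu]; simp only [Fin.sum_univ_three]
  simp only [h7]
  ring

/-- The divergence is the trace of half the Lie derivative of the metric. -/
theorem divVec_eq_trace (hG : IsMetricOn D G) (hx : x ∈ D) (X : Fin 3 → E3 → ℝ) :
    divVec G X x = ∑ i, ∑ j, (G x)⁻¹ i j * ((1 / 2) * lieMetric G X i j x) := by
  have h1 : ∀ l, ∑ i, christoffel G i i l x
      = (1 / 2) * ∑ i, ∑ j, (G x)⁻¹ i j * pd l (fun y => G y i j) x := by
    intro l
    have h2 : ∑ i, ∑ j, (G x)⁻¹ i j * pd i (fun y => G y j l) x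
        = ∑ i, ∑ j, (G x)⁻¹ i j * pd j (fun y => G y i l) x := by
      rw [Finset.sum_comm]
      simp only [hG.inv_symm hx]
    calc ∑ i, christoffel G i i l x
        = (1 / 2) * (∑ i, ∑ j, (G x)⁻¹ i j * pd l (fun y => G y j i) x
          + (∑ i, ∑ j, (G x)⁻¹ i j * pd i (fun y => G y j l) x
          - ∑ i, ∑ j, (G x)⁻¹ i j * pd j (fun y => G y i l) x)) := by
          unfold christoffel
          simp only [Fin.sum_univ_three]
          ring
      _ = _ := by
          rw [h2, sub_self, add_zero]
          simp only [hG.pd_symm hx l]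
  calc divVec G X x = ∑ i, pd i (X i) x + ∑ l, (∑ i, christoffel G i i l x) * X l x := by
        unfold divVec
        simp only [Fin.sum_univ_three]
        ring
    _ = ∑ i, ∑ l, (∑ j, (G x)⁻¹ i j * G x j l) * pd i (X l) x
        + ∑ l, ((1 / 2) * ∑ i, ∑ j, (G x)⁻¹ i j * pd l (fun y => G y i j) x) * X l x := by
        simp only [h1, hG.sum_inv_mul hx]
        simp
    _ = _ := by
        unfold lieMetric
        have e1 := hG.inv_symm hx 1 0
        have e2 := hG.inv_symm hx 2 0
        have e3 := hG.inv_symm hx 2 1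
        have e4 := hG.symm hx 1 0
        have e5 := hG.symm hx 2 0
        have e6 := hG.symm hx 2 1
        simp only [Fin.sum_univ_three, e1, e2, e3, e4, e5, e6]
        ring

theorem divVec_raise (hG : IsMetricOn D G) (hx : x ∈ D)
    (hf : ∀ i, DifferentiableAt ℝ (f i) x) :
    divVec G (fun l y => ∑ m, (G y)⁻¹ l m * f m y) x
      = ∑ i, ∑ j, (G x)⁻¹ i j *
        ((1 / 2) * (pd i (f j) x + pd j (f i) x) - ∑ l, christoffel G l i j x * f l x) := by
  rw [hG.divVec_eq_trace hx]
  simp only [hG.lieMetric_raise hx hf]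

end IsMetricOn

/-! ### The conformally covariant traceless Hessian -/

/-- `⟨dN, df⟩` for `N = |df|²`. -/
def gradSqDeriv (G : E3 → Matrix (Fin 3) (Fin 3) ℝ) (f : E3 → ℝ) (x : E3) : ℝ :=
  ∑ l, gradient G f l x * pd l (gradSq G f) x

/-- The expansion of `calH` as a polynomial in the derivatives of `f` and of `N = |df|²`. -/
def polyH (G : E3 → Matrix (Fin 3) (Fin 3) ℝ) (f : E3 → ℝ) (i j : Fin 3) (x : E3) : ℝ :=
  gradSq G f x ^ 2 * tracelessHess G f i j x
    - gradSq G f x * ((1 / 2) * (pd i (gradSq G f) x * pd j f x + pd j (gradSq G f) x * pd i f x)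
      - (1 / 3) * gradSqDeriv G f x * G x i j)
    + ((1 / 2) * gradSq G f x * laplacian G f x + (1 / 4) * gradSqDeriv G f x)
      * (pd i f x * pd j f x - (1 / 3) * gradSq G f x * G x i j)

section Congr

variable {G : E3 → Matrix (Fin 3) (Fin 3) ℝ} {X Y : Fin 3 → E3 → ℝ} {D : Set E3} {x : E3}

theorem lieMetric_congr (hD : IsOpen D) (h : ∀ l, ∀ y ∈ D, X l y = Y l y) (hx : x ∈ D)
    (i j : Fin 3) : lieMetric G X i j x = lieMetric G Y i j x := by
  unfold lieMetric
  refine Finset.sum_congr rfl fun l _ => ?_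
  rw [h l x hx, pd_congr_of_eqOn i hD (h l) hx, pd_congr_of_eqOn j hD (h l) hx]

theorem divVec_congr (hD : IsOpen D) (h : ∀ l, ∀ y ∈ D, X l y = Y l y) (hx : x ∈ D) :
    divVec G X x = divVec G Y x := by
  unfold divVec
  refine Finset.sum_congr rfl fun l _ => ?_
  rw [pd_congr_of_eqOn l hD (h l) hx]
  congr 1
  exact Finset.sum_congr rfl fun m _ => by rw [h m x hx]

end Congr

namespace IsMetricOn

variable {D : Set E3} {G : E3 → Matrix (Fin 3) (Fin 3) ℝ} {x : E3} {f q : E3 → ℝ}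

theorem differentiableAt_pd (hG : IsMetricOn D G) (hf : ContDiffOn ℝ 2 f D) (hx : x ∈ D)
    (i : Fin 3) : DifferentiableAt ℝ (pd i f) x :=
  ((ContDiffOn.pd_of_isOpen (n := 1) hG.isOpen hf i).contDiffAt
    (hG.isOpen.mem_nhds hx)).differentiableAt (by simp)

theorem differentiableAt_gradSq (hG : IsMetricOn D G) (hf : ContDiffOn ℝ 2 f D) (hx : x ∈ D) :
    DifferentiableAt ℝ (gradSq G f) x :=
  DifferentiableAt.fun_sum fun i _ => DifferentiableAt.fun_sum fun j _ =>
    ((hG.differentiableAt_inv hx i j).mul (hG.differentiableAt_pd hf hx i)).mul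
      (hG.differentiableAt_pd hf hx j)

theorem gradient_eq_raise :
    (fun l y => q y * gradient G f l y) = fun l y => ∑ m, (G y)⁻¹ l m * (q y * pd m f y) := by
  funext l y
  unfold gradient
  rw [Finset.mul_sum]
  exact Finset.sum_congr rfl fun m _ => by ring

theorem symmetrized_pd_mul (hG : IsMetricOn D G) (hf : ContDiffOn ℝ 2 f D) (hx : x ∈ D)
    (hq : DifferentiableAt ℝ q x) (i j : Fin 3) :
    (1 / 2) * (pd i (fun y => q y * pd j f y) x + pd j (fun y => q y * pd i f y) x)
        - ∑ l, christoffel G l i j x * (q x * pd l f x)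
      = q x * hessian G f i j x + (1 / 2) * (pd i q x * pd j f x + pd j q x * pd i f x) := by
  rw [pd_mul i hq (hG.differentiableAt_pd hf hx j), pd_mul j hq (hG.differentiableAt_pd hf hx i),
    pd_comm hG.isOpen hf hx j i, hessian]
  simp only [Fin.sum_univ_three]
  ring

/-- The Lie derivative of the metric along a multiple `q grad f` of a gradient is
`2 q Hess f + dq ⊗ df + df ⊗ dq`. -/
theorem lieMetric_gradient (hG : IsMetricOn D G) (hf : ContDiffOn ℝ 2 f D) (hx : x ∈ D)
    (hq : DifferentiableAt ℝ q x) (i j : Fin 3) :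
    (1 / 2) * lieMetric G (fun l y => q y * gradient G f l y) i j x
      = q x * hessian G f i j x + (1 / 2) * (pd i q x * pd j f x + pd j q x * pd i f x) := by
  rw [gradient_eq_raise, ← hG.symmetrized_pd_mul hf hx hq]
  exact hG.lieMetric_raise (f := fun m y => q y * pd m f y) hx
    (fun m => hq.mul (hG.differentiableAt_pd hf hx m)) i j

theorem divVec_gradient (hG : IsMetricOn D G) (hf : ContDiffOn ℝ 2 f D) (hx : x ∈ D)
    (hq : DifferentiableAt ℝ q x) :
    divVec G (fun l y => q y * gradient G f l y) x
      = q x * laplacian G f x + ∑ l, gradient G f l x * pd l q x := by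
  rw [hG.divVec_eq_trace hx]
  simp only [hG.lieMetric_gradient hf hx hq]
  simp only [laplacian, trG, Matrix.of_apply, gradient]
  have e1 := hG.inv_symm hx 1 0
  have e2 := hG.inv_symm hx 2 0
  have e3 := hG.inv_symm hx 2 1
  simp only [Fin.sum_univ_three, e1, e2, e3]
  ring

theorem gradSq_eq (hG : IsMetricOn D G) (hx : x ∈ D) :
    gradSq G f x = ∑ l, ∑ m, G x l m * gradient G f l x * gradient G f m x := by
  calc gradSq G f x = ∑ l, gradient G f l x * pd l f x := by
        unfold gradSq gradient
        simp only [Fin.sum_univ_three]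
        ring
    _ = ∑ l, gradient G f l x * ∑ m, G x l m * gradient G f m x := by
        unfold gradient
        simp only [hG.sum_mul_raise hx fun m => pd m f x]
    _ = _ := by simp only [Fin.sum_univ_three]; ring

theorem quadratic_pos (hG : IsMetricOn D G) (hx : x ∈ D) {v : Fin 3 → ℝ} (hv : v ≠ 0) :
    0 < ∑ l, ∑ m, G x l m * v l * v m := by
  have h := (hG.posDef x hx).dotProduct_mulVec_pos hv
  simp only [dotProduct, Matrix.mulVec, star_trivial, Finset.mul_sum] at h
  refine h.trans_le (le_of_eq ?_)
  exact Finset.sum_congr rfl fun l _ => Finset.sum_congr rfl fun m _ => by ring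

theorem gradSq_nonneg (hG : IsMetricOn D G) (hx : x ∈ D) : 0 ≤ gradSq G f x := by
  rw [hG.gradSq_eq hx]
  by_cases hv : (fun l => gradient G f l x) = 0
  · simp [fun l => congrFun hv l]
  · exact (hG.quadratic_pos hx hv).le

theorem gradient_eq_zero (hG : IsMetricOn D G) (hx : x ∈ D) (h : gradSq G f x = 0) (l : Fin 3) :
    gradient G f l x = 0 := by
  by_contra h1
  have h2 := hG.quadratic_pos hx (v := fun l => gradient G f l x) fun h3 => h1 (congrFun h3 l)
  rw [← hG.gradSq_eq hx, h] at h2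
  exact h2.false

theorem normD_sq (hG : IsMetricOn D G) (hx : x ∈ D) : normD G f x ^ 2 = gradSq G f x :=
  Real.sq_sqrt (hG.gradSq_nonneg hx)

theorem calA_eq (hG : IsMetricOn D G) (hf : ContDiffOn ℝ 2 f D) (hx : x ∈ D) :
    calA G f x = (1 / 2) * gradSq G f x * laplacian G f x + (1 / 4) * gradSqDeriv G f x := by
  rcases (hG.gradSq_nonneg (f := f) hx).eq_or_lt with h0 | h0
  · have h1 : normD G f x = 0 := by rw [normD, ← gradSq, ← h0, Real.sqrt_zero]
    simp [calA, h1, ← h0, gradSqDeriv, hG.gradient_eq_zero hx h0.symm]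
  · have h1 : HasFDerivAt (normD G f)
        ((1 / (2 * Real.sqrt (gradSq G f x))) • fderiv ℝ (gradSq G f) x) x :=
      (hG.differentiableAt_gradSq hf hx).hasFDerivAt.sqrt h0.ne'
    have h2 : ∀ l, pd l (normD G f) x = 1 / (2 * normD G f x) * pd l (gradSq G f) x := fun l => by
      rw [pd, h1.fderiv]; rfl
    have h3 : 0 < normD G f x := Real.sqrt_pos.2 h0
    rw [calA, hG.divVec_gradient hf hx h1.differentiableAt, gradSqDeriv, ← hG.normD_sq hx]
    simp only [h2, Fin.sum_univ_three]
    field_simp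
    ring

/-- The traceless Hessian tensor is a polynomial in `G⁻¹`, the gradient and the Hessian. At critical
points of `f` both sides vanish. -/
theorem calH_eq_polyH (hG : IsMetricOn D G) (hf : ContDiffOn ℝ 2 f D) (hx : x ∈ D) (i j : Fin 3) :
    calH G f i j x = polyH G f i j x := by
  rw [calH, hG.calA_eq hf hx, hG.normD_sq hx, show normD G f x ^ 6 = (normD G f x ^ 2) ^ 3 by ring,
    hG.normD_sq hx, polyH]
  rcases (hG.gradSq_nonneg (f := f) hx).eq_or_lt with h0 | h0
  · simp [← h0, gradSqDeriv, hG.gradient_eq_zero hx h0.symm]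
  · have hN := hG.differentiableAt_gradSq hf hx
    have h1 : ∀ l, ∀ y ∈ D, (normD G f y ^ 2)⁻¹ * gradient G f l y
        = (gradSq G f y)⁻¹ * gradient G f l y := fun l y hy => by rw [hG.normD_sq hy]
    have h2 : DifferentiableAt ℝ (fun y => (gradSq G f y)⁻¹) x := hN.fun_inv h0.ne'
    rw [ahlfors, lieMetric_congr hG.isOpen h1 hx, divVec_congr hG.isOpen h1 hx,
      hG.lieMetric_gradient hf hx h2, hG.divVec_gradient hf hx h2]
    simp only [pd_inv _ hN h0.ne', tracelessHess, gradSqDeriv, Fin.sum_univ_three]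
    field_simp
    ring

/-- If `|df|² - 1` and `d|df|² - (2/3) (Δf) df` are small, then `calH` is close to the traceless
Hessian: the terms without a small factor cancel. -/
theorem polyH_sub_tracelessHess (G : E3 → Matrix (Fin 3) (Fin 3) ℝ) (f : E3 → ℝ) (x : E3)
    (e : Fin 3 → ℝ)
    (he : ∀ i, pd i (gradSq G f) x = (2 / 3) * laplacian G f x * pd i f x + e i) (i j : Fin 3) :
    polyH G f i j x - tracelessHess G f i j x
      = (gradSq G f x - 1) * ((gradSq G f x + 1) * tracelessHess G f i j x)
        - gradSq G f x * ((1 / 2) * (e i * pd j f x + e j * pd i f x)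
          - (1 / 3) * (∑ l, e l * gradient G f l x) * G x i j)
        + (1 / 4) * (∑ l, e l * gradient G f l x)
          * (pd i f x * pd j f x - (1 / 3) * gradSq G f x * G x i j) := by
  have h1 : gradSqDeriv G f x
      = (2 / 3) * laplacian G f x * gradSq G f x + ∑ l, e l * gradient G f l x := by
    simp only [gradSqDeriv, he, gradSq, gradient, Fin.sum_univ_three]
    ring
  rw [polyH, h1, he, he]
  ring

/-! ### Conformal change of the metric -/

section Conformal

variable {g : E3 → Matrix (Fin 3) (Fin 3) ℝ} {r : E3 → ℝ}

/-- The covector `-dr / r`, the differential of `-log r`, which describes the conformal change from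
`G` to `r⁻² G`. -/
def negDlog (r : E3 → ℝ) (i : Fin 3) (y : E3) : ℝ := -(r y)⁻¹ * pd i r y

theorem inv_conformal (hG : IsMetricOn D G) (hr : ∀ y ∈ D, r y ≠ 0)
    (hg : ∀ y ∈ D, g y = (r y ^ 2)⁻¹ • G y) (hx : x ∈ D) (i j : Fin 3) :
    (g x)⁻¹ i j = r x ^ 2 * (G x)⁻¹ i j := by
  have h : (g x)⁻¹ = r x ^ 2 • (G x)⁻¹ := by
    refine Matrix.inv_eq_left_inv ?_
    rw [hg x hx, Matrix.smul_mul, Matrix.mul_smul, Matrix.nonsing_inv_mul _ (hG.isUnit_det hx),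
      smul_smul, mul_inv_cancel₀ (pow_ne_zero 2 (hr x hx)), one_smul]
  rw [h, Matrix.smul_apply, smul_eq_mul]

/-- The change of the Christoffel symbols from `G` to `r⁻² G`. -/
theorem christoffel_conformal (hG : IsMetricOn D G) (hr : ∀ y ∈ D, r y ≠ 0)
    (hr2 : ContDiffOn ℝ 2 r D) (hg : ∀ y ∈ D, g y = (r y ^ 2)⁻¹ • G y) (hx : x ∈ D)
    (l i j : Fin 3) :
    christoffel g l i j x = christoffel G l i j x + ((if l = i then 1 else 0) * negDlog r j x
      + (if l = j then 1 else 0) * negDlog r i x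
      - G x i j * ∑ m, (G x)⁻¹ l m * negDlog r m x) := by
  have hrx := hr x hx
  have hrd : DifferentiableAt ℝ r x :=
    (hr2.contDiffAt (hG.isOpen.mem_nhds hx)).differentiableAt (by simp)
  have hr0 : DifferentiableAt ℝ (fun y => r y * r y) x := hrd.mul hrd
  have h1 : ∀ k a b, pd k (fun y => g y a b) x
      = (r x ^ 2)⁻¹ * pd k (fun y => G y a b) x
        + 2 * (r x ^ 2)⁻¹ * negDlog r k x * G x a b := by
    intro k a b
    have e1 : pd k (fun y => g y a b) x = pd k (fun y => (r y * r y)⁻¹ * G y a b) x :=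
      pd_congr_of_eqOn k hG.isOpen (fun y hy => by
        rw [hg y hy, Matrix.smul_apply, smul_eq_mul, sq]) hx
    rw [e1, pd_mul k (hr0.fun_inv (mul_ne_zero hrx hrx)) (hG.differentiableAt hx a b),
      pd_inv k hr0 (mul_ne_zero hrx hrx), pd_mul k hrd hrd, negDlog]
    field_simp
    ring
  have hi := hG.inv_conformal hr hg hx
  calc christoffel g l i j x
      = r x ^ 2 * (r x ^ 2)⁻¹ * (christoffel G l i j x
        + ((∑ m, (G x)⁻¹ l m * G x m j) * negDlog r i x
          + (∑ m, (G x)⁻¹ l m * G x m i) * negDlog r j x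
          - G x i j * ∑ m, (G x)⁻¹ l m * negDlog r m x)) := by
        simp only [christoffel, h1, hi, Fin.sum_univ_three]
        ring
    _ = _ := by
        rw [mul_inv_cancel₀ (pow_ne_zero 2 hrx), hG.sum_inv_mul hx, hG.sum_inv_mul hx]
        ring

theorem pd_negDlog (hG : IsMetricOn D G) (hr : ∀ y ∈ D, r y ≠ 0) (hr2 : ContDiffOn ℝ 2 r D)
    (hx : x ∈ D) (i j : Fin 3) : pd i (negDlog r j) x = pd j (negDlog r i) x := by
  have hrd : DifferentiableAt ℝ r x :=
    (hr2.contDiffAt (hG.isOpen.mem_nhds hx)).differentiableAt (by simp)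
  have h : ∀ i j, pd i (negDlog r j) x
      = (r x)⁻¹ * (r x)⁻¹ * pd i r x * pd j r x - (r x)⁻¹ * pd i (pd j r) x := by
    intro i j
    unfold negDlog
    rw [pd_mul i (hrd.fun_inv (hr x hx)).fun_neg (hG.differentiableAt_pd hr2 hx j), pd_neg,
      pd_inv i hrd (hr x hx)]
    ring
  rw [h, h, pd_comm hG.isOpen hr2 hx i j]
  ring

theorem differentiableAt_negDlog (hG : IsMetricOn D G) (hr : ∀ y ∈ D, r y ≠ 0)
    (hr2 : ContDiffOn ℝ 2 r D) (hx : x ∈ D) (i : Fin 3) :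
    DifferentiableAt ℝ (negDlog r i) x :=
  ((((hr2.contDiffAt (hG.isOpen.mem_nhds hx)).differentiableAt (by simp)).fun_inv
    (hr x hx)).fun_neg).mul (hG.differentiableAt_pd hr2 hx i)

/-- The Ricci tensor of `r⁻² G`, in terms of the covariant derivative of `negDlog r`. The derivatives
of the Christoffel symbols enter only through `ricci_conformal_algebra`. -/
theorem ricci_conformal (hG : IsMetricOn D G) (hr : ∀ y ∈ D, r y ≠ 0)
    (hr2 : ContDiffOn ℝ 2 r D) (hg : ∀ y ∈ D, g y = (r y ^ 2)⁻¹ • G y) (hx : x ∈ D)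
    (i j : Fin 3) :
    ricci g i j x = ricci G i j x
      - (pd i (negDlog r j) x - ∑ l, christoffel G l i j x * negDlog r l x)
      - G x i j * divVec G (fun l y => ∑ m, (G y)⁻¹ l m * negDlog r m y) x
      + negDlog r i x * negDlog r j x
      - G x i j * ∑ m, (∑ a, (G x)⁻¹ m a * negDlog r a x) * negDlog r m x := by
  set u : Fin 3 → E3 → ℝ := fun l y => ∑ m, (G y)⁻¹ l m * negDlog r m y with hu
  have hf := fun m => hG.differentiableAt_negDlog hr hr2 hx m
  have hud : ∀ l, DifferentiableAt ℝ (u l) x := hG.differentiableAt_raise hx hf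
  set C : Fin 3 → Fin 3 → Fin 3 → E3 → ℝ := fun l i j y =>
    (if l = i then 1 else 0) * negDlog r j y + (if l = j then 1 else 0) * negDlog r i y
      - G y i j * u l y with hC
  have hCd : ∀ l i j, DifferentiableAt ℝ (C l i j) x := fun l i j =>
    (((hf j).const_mul _).add ((hf i).const_mul _)).sub ((hG.differentiableAt hx i j).mul (hud l))
  have hΓ : ∀ l i j, ∀ y ∈ D, christoffel g l i j y = christoffel G l i j y + C l i j y :=
    fun l i j y hy => hG.christoffel_conformal hr hr2 hg hy l i j
  have hdΓ : ∀ p l i j, pd p (christoffel g l i j) x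
      = pd p (christoffel G l i j) x + pd p (C l i j) x := fun p l i j => by
    rw [pd_congr_of_eqOn p hG.isOpen (hΓ l i j) hx,
      pd_add p (hG.differentiableAt_christoffel hx l i j) (hCd l i j)]
  have key := ricci_conformal_algebra (fun i j => G x i j) (fun i j => pd i (negDlog r j) x)
    (fun i l => pd i (u l) x) (fun l i j => christoffel G l i j x)
    (fun m i j => pd m (fun y => G y i j) x) (fun l i j => C l i j x)
    (fun p l i j => pd p (C l i j) x) (fun i => negDlog r i x) (fun l => u l x)
    (hG.symm hx) (hG.christoffel_symm hx) (fun i j => hG.pd_negDlog hr hr2 hx i j)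
    (fun i => (hG.sum_mul_raise hx (fun m => negDlog r m x) i).symm)
    (fun p i => hG.pd_lower hx hf p i) (hG.pd_metric hx) (fun l i j => rfl)
    (fun p l i j => by
      have d1 : ∀ (c : ℝ) m, DifferentiableAt ℝ (fun y => c * negDlog r m y) x :=
        fun c m => (hf m).const_mul c
      have d2 : DifferentiableAt ℝ (fun y => (if l = i then (1 : ℝ) else 0) * negDlog r j y
          + (if l = j then (1 : ℝ) else 0) * negDlog r i y) x := (d1 _ j).add (d1 _ i)
      have d3 : DifferentiableAt ℝ (fun y => G y i j * u l y) x :=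
        (hG.differentiableAt hx i j).mul (hud l)
      refine (pd_sub p d2 d3).trans ?_
      rw [pd_add p (d1 _ j) (d1 _ i), pd_mul p (differentiableAt_const _) (hf j),
        pd_mul p (differentiableAt_const _) (hf i), pd_const, pd_const,
        pd_mul p (hG.differentiableAt hx i j) (hud l)]
      ring) i j
  have h1 : ricci g i j x = ricci G i j x
      + ∑ l, (pd l (C l i j) x - pd j (C l i l) x + ∑ m, (christoffel G l l m x * C m i j x
        + C l l m x * christoffel G m i j x + C l l m x * C m i j x
        - christoffel G l j m x * C m i l x - C l j m x * christoffel G m i l x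
        - C l j m x * C m i l x)) := by
    simp only [ricci, hdΓ, hΓ _ _ _ x hx, Fin.sum_univ_three]
    ring
  rw [h1, key, divVec]
  ring

/-- The scalar curvature of `r⁻² G`. -/
theorem scalarCurv_conformal (hG : IsMetricOn D G) (hr : ∀ y ∈ D, r y ≠ 0)
    (hr2 : ContDiffOn ℝ 2 r D) (hg : ∀ y ∈ D, g y = (r y ^ 2)⁻¹ • G y) (hx : x ∈ D) :
    scalarCurv g x = r x ^ 2 * scalarCurv G x + 4 * r x * laplacian G r x - 6 * gradSq G r x := by
  have hf := fun m => hG.differentiableAt_negDlog hr hr2 hx m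
  have hrd : DifferentiableAt ℝ r x :=
    (hr2.contDiffAt (hG.isOpen.mem_nhds hx)).differentiableAt (by simp)
  set δ : ℝ := divVec G (fun l y => ∑ m, (G y)⁻¹ l m * negDlog r m y) x with hδ
  have h1 : δ = ∑ i, ∑ j, (G x)⁻¹ i j * (pd i (negDlog r j) x
      - ∑ l, christoffel G l i j x * negDlog r l x) := by
    rw [hδ, hG.divVec_raise hx hf]
    refine Finset.sum_congr rfl fun i _ => Finset.sum_congr rfl fun j _ => ?_
    rw [hG.pd_negDlog hr hr2 hx j i]
    ring
  have h2 : δ = -(r x)⁻¹ * laplacian G r x + (r x)⁻¹ * (r x)⁻¹ * gradSq G r x := by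
    have e1 : (fun l y => ∑ m, (G y)⁻¹ l m * negDlog r m y)
        = fun l y => (-(r y)⁻¹) * gradient G r l y := gradient_eq_raise.symm
    rw [hδ, e1, hG.divVec_gradient hr2 hx (hrd.fun_inv (hr x hx)).fun_neg]
    simp only [pd_neg, pd_inv _ hrd (hr x hx), gradSq, gradient, Fin.sum_univ_three]
    ring
  have h3 : ∑ i, ∑ j, (G x)⁻¹ i j * G x i j = 3 := by
    have : ∀ i, ∑ j, (G x)⁻¹ i j * G x i j = 1 := fun i => by
      simp only [hG.symm hx i]
      simpa using hG.sum_inv_mul hx i i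
    simp [this]
  set s : ℝ := ∑ i, ∑ j, (G x)⁻¹ i j * negDlog r i x * negDlog r j x with hs
  have h4 : s = (r x)⁻¹ * (r x)⁻¹ * gradSq G r x := by
    simp only [hs, negDlog, gradSq, Fin.sum_univ_three]
    ring
  have h5 : ∑ m, (∑ a, (G x)⁻¹ m a * negDlog r a x) * negDlog r m x = s := by
    simp only [hs, Fin.sum_univ_three]
    ring
  calc scalarCurv g x = r x ^ 2 * (scalarCurv G x - (∑ i, ∑ j, (G x)⁻¹ i j *
          (pd i (negDlog r j) x - ∑ l, christoffel G l i j x * negDlog r l x))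
        - (∑ i, ∑ j, (G x)⁻¹ i j * G x i j) * δ + s
        - (∑ i, ∑ j, (G x)⁻¹ i j * G x i j) * s) := by
        simp only [scalarCurv, hG.inv_conformal hr hg hx, hG.ricci_conformal hr hr2 hg hx, h5, ← hδ]
        simp only [hs, Fin.sum_univ_three]
        ring
    _ = r x ^ 2 * (scalarCurv G x - 4 * δ - 2 * s) := by rw [← h1, h3]; ring
    _ = _ := by
        rw [h2, h4]
        have := hr x hx
        field_simp
        ring

end Conformal

end IsMetricOn

/-! ### Charts of the manifold -/

section ChartGeometry

variable {M : Type*} [TopologicalSpace M] {φ ψ : Chart M} {x : E3}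

/-- The open subset of `E3` whose part in the closed half space is the range of the chart. -/
def chartOpen (φ : Chart M) : Set E3 := I3.symm ⁻¹' φ.target

theorem isOpen_chartOpen (φ : Chart M) : IsOpen (chartOpen φ) :=
  φ.open_target.preimage I3.continuous_symm

theorem range_I3 : range I3 = {x : E3 | 0 ≤ x 0} :=
  range_modelWithCornersEuclideanHalfSpace 3

theorem extend_target_eq (φ : Chart M) : (φ.extend I3).target = halfSet (chartOpen φ) := by
  rw [φ.extend_target, range_I3]
  rfl

theorem symm_mem_source (hx : x ∈ halfSet (chartOpen φ)) : (φ.extend I3).symm x ∈ φ.source := by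
  rw [← extend_target_eq] at hx
  rw [← φ.extend_source (I := I3)]
  exact (φ.extend I3).map_target hx

theorem extend_symm_apply (hx : x ∈ halfSet (chartOpen φ)) :
    φ.extend I3 ((φ.extend I3).symm x) = x := by
  rw [← extend_target_eq] at hx
  exact (φ.extend I3).right_inv hx

theorem extend_mem_halfSet {p : M} (hp : p ∈ φ.source) :
    φ.extend I3 p ∈ halfSet (chartOpen φ) := by
  rw [← extend_target_eq]
  exact (φ.extend I3).map_source (by rwa [φ.extend_source])

theorem symm_extend_apply {p : M} (hp : p ∈ φ.source) :
    (φ.extend I3).symm (φ.extend I3 p) = p := φ.extend_left_inv hp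

theorem uniqueMDiffWithinAt_range (hx : x ∈ halfSet (chartOpen φ)) :
    UniqueMDiffWithinAt 𝓘(ℝ, E3) (range I3) x :=
  I3.uniqueDiffOn.uniqueMDiffOn x (by rw [range_I3]; exact hx.2)

theorem halfSet_mem_nhdsWithin_range (hx : x ∈ halfSet (chartOpen φ)) :
    halfSet (chartOpen φ) ∈ 𝓝[range I3] x := by
  rw [range_I3, halfSet, inter_comm]
  exact inter_mem_nhdsWithin _ ((isOpen_chartOpen φ).mem_nhds hx.1)

/-- The part of `chartOpen φ` that corresponds to the overlap with `ψ`. -/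
def overlapOpen (φ ψ : Chart M) : Set E3 := I3.symm ⁻¹' (φ.target ∩ φ.symm ⁻¹' ψ.source)

theorem isOpen_overlapOpen (φ ψ : Chart M) : IsOpen (overlapOpen φ ψ) :=
  (φ.isOpen_inter_preimage_symm ψ.open_source).preimage I3.continuous_symm

theorem mem_halfSet_overlapOpen :
    x ∈ halfSet (overlapOpen φ ψ) ↔
      x ∈ halfSet (chartOpen φ) ∧ (φ.extend I3).symm x ∈ ψ.source :=
  ⟨fun h => ⟨⟨h.1.1, h.2⟩, h.1.2⟩, fun h => ⟨⟨h.1.1, h.2⟩, h.1.2⟩⟩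

variable [ChartedSpace (EuclideanHalfSpace 3) M]

/-- A chart maps exactly the interior points into the open half space. -/
theorem isInteriorPoint_iff_extend [IsManifold I3 ∞ M] (hφ : φ ∈ smoothCharts M) {p : M} (hp : p ∈ φ.source) :
    I3.IsInteriorPoint p ↔ 0 < (φ.extend I3 p) 0 := by
  have : IsManifold I3 1 M := IsManifold.of_le (n := ∞) (by simp)
  have hd : ∀ q ∈ φ.source, MDifferentiableAt I3 I3 φ q := fun q hq =>
    (contMDiffAt_of_mem_maximalAtlas hφ hq).mdifferentiableAt (by simp)
  have hd' : ∀ q ∈ φ.target, MDifferentiableAt I3 I3 φ.symm q := fun q hq =>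
    (contMDiffAt_symm_of_mem_maximalAtlas hφ hq).mdifferentiableAt (by simp)
  have hφp : φ p ∈ φ.target := φ.map_source hp
  have hmd := hd p hp
  have hmd' := hd' _ hφp
  have hM : φ.MDifferentiable I3 I3 :=
    ⟨fun q hq => (hd q hq).mdifferentiableWithinAt,
      fun q hq => (hd' q hq).mdifferentiableWithinAt⟩
  have h1 : I3.IsInteriorPoint p ↔ I3.IsInteriorPoint (φ p) := by
    refine ⟨fun h => hmd.isInteriorPoint_of_surjective_mfderiv (hM.mfderiv_surjective hp) h,
      fun h => ?_⟩
    have := hmd'.isInteriorPoint_of_surjective_mfderiv (hM.symm.mfderiv_surjective hφp) h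
    rwa [φ.left_inv hp] at this
  have h2 : I3.IsInteriorPoint (φ p) ↔ I3 (φ p) ∈ interior (range I3) := by
    rw [ModelWithCorners.IsInteriorPoint, extChartAt_self_apply]
  rw [h1, h2, interior_range_modelWithCornersEuclideanHalfSpace]
  rfl

theorem mdifferentiableWithinAt_extend_symm (hφ : φ ∈ smoothCharts M)
    (hx : x ∈ halfSet (chartOpen φ)) :
    MDifferentiableWithinAt 𝓘(ℝ, E3) I3 (φ.extend I3).symm (halfSet (chartOpen φ)) x := by
  have h := contMDiffOn_extend_symm hφ
  rw [← φ.extend_target', extend_target_eq] at h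
  exact (h x hx).mdifferentiableWithinAt (by simp)

theorem contMDiffOn_extend_symm_halfSet (hφ : φ ∈ smoothCharts M) :
    ContMDiffOn 𝓘(ℝ, E3) I3 ∞ (φ.extend I3).symm (halfSet (chartOpen φ)) := by
  have h := contMDiffOn_extend_symm hφ
  rwa [← φ.extend_target', extend_target_eq] at h

theorem mfderivWithin_range_eq (hφ : φ ∈ smoothCharts M) (hx : x ∈ halfSet (chartOpen φ)) :
    mfderivWithin 𝓘(ℝ, E3) I3 (φ.extend I3).symm (range I3) x
      = mfderivWithin 𝓘(ℝ, E3) I3 (φ.extend I3).symm (halfSet (chartOpen φ)) x :=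
  (mdifferentiableWithinAt_extend_symm hφ hx).mfderivWithin_mono_of_mem_nhdsWithin
    (uniqueMDiffWithinAt_range hx) (halfSet_mem_nhdsWithin_range hx)

theorem mdifferentiableAt_extend (hφ : φ ∈ smoothCharts M) {p : M} (hp : p ∈ φ.source) :
    MDifferentiableAt I3 𝓘(ℝ, E3) (φ.extend I3) p :=
  (φ.contMDiffAt_extend hφ hp).mdifferentiableAt (by simp)

theorem mfderiv_extend_comp_mfderivWithin_symm (hφ : φ ∈ smoothCharts M)
    (hx : x ∈ halfSet (chartOpen φ)) :
    (mfderiv I3 𝓘(ℝ, E3) (φ.extend I3) ((φ.extend I3).symm x)).comp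
      (mfderivWithin 𝓘(ℝ, E3) I3 (φ.extend I3).symm (range I3) x)
      = ContinuousLinearMap.id ℝ (TangentSpace 𝓘(ℝ, E3) x) := by
  have hU := uniqueMDiffWithinAt_range hx
  rw [← mfderiv_comp_mfderivWithin]; rotate_left
  · exact mdifferentiableAt_extend hφ (symm_mem_source hx)
  · exact (mdifferentiableWithinAt_extend_symm hφ hx).mono_of_mem_nhdsWithin
      (halfSet_mem_nhdsWithin_range hx)
  · exact hU
  rw [← mfderivWithin_id hU]
  apply Filter.EventuallyEq.mfderivWithin_eq
  · filter_upwards [halfSet_mem_nhdsWithin_range hx] with z hz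
    exact extend_symm_apply hz
  · exact extend_symm_apply hx

theorem mfderiv_symm_comp_mfderiv_extend (hφ : φ ∈ smoothCharts M)
    (hx : x ∈ halfSet (chartOpen φ)) :
    (mfderivWithin 𝓘(ℝ, E3) I3 (φ.extend I3).symm (range I3) x).comp
      (mfderiv I3 𝓘(ℝ, E3) (φ.extend I3) ((φ.extend I3).symm x))
      = ContinuousLinearMap.id ℝ (TangentSpace I3 ((φ.extend I3).symm x)) := by
  have h := mfderiv_extend_comp_mfderivWithin_symm hφ hx
  ext1 v
  have h1 : ∀ A B : E3 →L[ℝ] E3, A.comp B = ContinuousLinearMap.id ℝ E3 →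
      B.comp A = ContinuousLinearMap.id ℝ E3 := by
    intro A B hAB
    have h2 : A.toLinearMap * B.toLinearMap = 1 := by
      ext v
      have := congrArg (fun L : E3 →L[ℝ] E3 => L v) hAB
      simpa using congrArg (fun z : E3 => z _) this
    have h3 := mul_eq_one_comm.1 h2
    ext1 w
    exact congrArg (fun L : E3 →ₗ[ℝ] E3 => L w) h3
  exact congrArg (fun L : E3 →L[ℝ] E3 => L v) (h1 _ _ h)

theorem dom_eq_posSet [IsManifold I3 ∞ M] (hφ : φ ∈ smoothCharts M) :
    dom φ = posSet (chartOpen φ) := by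
  ext x
  have key : x ∈ halfSet (chartOpen φ) →
      ((φ.extend I3).symm x ∈ I3.interior M ↔ 0 < x 0) := fun hx => by
    have := isInteriorPoint_iff_extend hφ (symm_mem_source hx)
    rwa [extend_symm_apply hx] at this
  rw [dom, extend_target_eq]
  exact ⟨fun h => ⟨h.1.1, (key h.1).1 h.2⟩, fun h =>
    ⟨posSet_subset_halfSet h, (key (posSet_subset_halfSet h)).2 h.2⟩⟩

theorem symm_mem_boundary_iff [IsManifold I3 ∞ M] (hφ : φ ∈ smoothCharts M)
    (hx : x ∈ halfSet (chartOpen φ)) : (φ.extend I3).symm x ∈ I3.boundary M ↔ x 0 = 0 := by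
  have h := isInteriorPoint_iff_extend hφ (symm_mem_source hx)
  rw [extend_symm_apply hx] at h
  have h2 : (φ.extend I3).symm x ∈ I3.boundary M ↔ ¬ I3.IsInteriorPoint ((φ.extend I3).symm x) := by
    rw [← ModelWithCorners.compl_interior]; rfl
  rw [h2, h, not_lt]
  exact ⟨fun h => le_antisymm h hx.2, fun h => h.le⟩

theorem symm_mem_interior [IsManifold I3 ∞ M] (hφ : φ ∈ smoothCharts M)
    (hx : x ∈ posSet (chartOpen φ)) : (φ.extend I3).symm x ∈ I3.interior M := by
  rw [← dom_eq_posSet hφ] at hx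
  exact hx.2

/-! ### The defining function in a chart -/

theorem contDiffOn_inChart {ρ : M → ℝ} (hρ : ContMDiff I3 𝓘(ℝ, ℝ) ∞ ρ) (hφ : φ ∈ smoothCharts M) :
    ContDiffOn ℝ ∞ (inChart ρ φ) (halfSet (chartOpen φ)) :=
  contMDiffOn_iff_contDiffOn.1 (hρ.comp_contMDiffOn (contMDiffOn_extend_symm_halfSet hφ))

theorem fderivWithin_inChart {ρ : M → ℝ} (hρ : ContMDiff I3 𝓘(ℝ, ℝ) ∞ ρ) (hφ : φ ∈ smoothCharts M)
    (hx : x ∈ halfSet (chartOpen φ)) (v : E3) :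
    fderivWithin ℝ (inChart ρ φ) (halfSet (chartOpen φ)) x v
      = dAt ρ ((φ.extend I3).symm x)
        (mfderivWithin 𝓘(ℝ, E3) I3 (φ.extend I3).symm (range I3) x v) := by
  have hu : UniqueMDiffWithinAt 𝓘(ℝ, E3) (halfSet (chartOpen φ)) x :=
    (uniqueDiffOn_halfSet (isOpen_chartOpen φ)).uniqueMDiffOn x hx
  have h1 : mfderivWithin 𝓘(ℝ, E3) 𝓘(ℝ, ℝ) (ρ ∘ (φ.extend I3).symm) (halfSet (chartOpen φ)) x
      = (mfderiv I3 𝓘(ℝ, ℝ) ρ ((φ.extend I3).symm x)).comp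
        (mfderivWithin 𝓘(ℝ, E3) I3 (φ.extend I3).symm (halfSet (chartOpen φ)) x) :=
    mfderiv_comp_mfderivWithin x ((hρ _).mdifferentiableAt (by simp))
      (mdifferentiableWithinAt_extend_symm hφ hx) hu
  rw [mfderivWithin_range_eq hφ hx]
  rw [mfderivWithin_eq_fderivWithin] at h1
  exact congrArg (fun L : E3 →L[ℝ] ℝ => L v) h1

theorem mem_posTangentConeAt_halfSet {U : Set E3} (hU : IsOpen U) (hx : x ∈ halfSet U) {v : E3}
    (hv : 0 ≤ v 0) : v ∈ posTangentConeAt (halfSet U) x := by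
  refine mem_posTangentConeAt_of_frequently_mem (Filter.Eventually.frequently ?_)
  have h1 : Tendsto (fun t : ℝ => x + t • v) (𝓝[>] 0) (𝓝 x) := by
    have : Continuous fun t : ℝ => x + t • v := by fun_prop
    simpa using (this.tendsto 0).mono_left nhdsWithin_le_nhds
  filter_upwards [h1.eventually (hU.mem_nhds hx.1), self_mem_nhdsWithin] with t ht ht0
  refine ⟨ht, ?_⟩
  have h2 : (0 : ℝ) ≤ x 0 := hx.2
  have h3 : (0 : ℝ) < t := ht0
  show (0 : ℝ) ≤ x 0 + t * v 0
  positivity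

/-- The inward derivative of a defining function is positive at boundary points. -/
theorem fderivWithin_inChart_pos [IsManifold I3 ∞ M] {ρ : M → ℝ} (hρ : IsDefiningFunction ρ)
    (hφ : φ ∈ smoothCharts M) (hx : x ∈ halfSet (chartOpen φ)) (hx0 : x 0 = 0) :
    0 < fderivWithin ℝ (inChart ρ φ) (halfSet (chartOpen φ)) x (EuclideanSpace.single 0 1) := by
  have hb := (symm_mem_boundary_iff hφ hx).2 hx0
  have hmin : IsLocalMinOn (inChart ρ φ) (halfSet (chartOpen φ)) x :=
    Filter.Eventually.of_forall fun y => by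
      rw [inChart, (hρ.zero_iff _).2 hb]
      exact hρ.nonneg _
  set L := fderivWithin ℝ (inChart ρ φ) (halfSet (chartOpen φ)) x with hL
  have hnn : ∀ v : E3, 0 ≤ v 0 → 0 ≤ L v := fun v hv =>
    hmin.fderivWithin_nonneg (mem_posTangentConeAt_halfSet (isOpen_chartOpen φ) hx hv)
  refine (hnn _ (by simp)).lt_of_ne fun h0 => hρ.d_ne_zero _ hb ?_
  have hLz : ∀ v : E3, v 0 = 0 → L v = 0 := fun v hv =>
    le_antisymm (by simpa using hnn (-v) (by simp [hv])) (hnn v hv.ge)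
  have hL0 : ∀ v : E3, L v = 0 := fun v => by
    have h1 := hLz (v - v 0 • EuclideanSpace.single 0 1) (by simp)
    rwa [map_sub, map_smul, ← h0, smul_zero, sub_zero] at h1
  ext1 w
  have h2 := (fderivWithin_inChart hρ.smooth hφ hx _).symm.trans
    (hL0 (mfderiv I3 𝓘(ℝ, E3) (φ.extend I3) ((φ.extend I3).symm x) w))
  have h3 := congrArg (fun A : E3 →L[ℝ] E3 => A w) (mfderiv_symm_comp_mfderiv_extend hφ hx)
  exact (congrArg (dAt ρ ((φ.extend I3).symm x)) h3).symm.trans h2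

/-- A smooth function which is zero on the boundary of the half space, and has positive inward
derivative there, grows linearly. -/
theorem exists_linear_lower_bound {U : Set E3} (hU : IsOpen U) {r : E3 → ℝ}
    (hsm : ContDiffOn ℝ ∞ r (halfSet U)) (hzero : ∀ x ∈ U, x 0 = 0 → r x = 0)
    (hpos : ∀ x ∈ posSet U, 0 < r x)
    (hd : ∀ x ∈ halfSet U, x 0 = 0 →
      0 < fderivWithin ℝ r (halfSet U) x (EuclideanSpace.single 0 1))
    {S : Set E3} (hS : S ⊆ halfSet U) (hc : IsCompact S) :
    ∃ c > 0, ∀ x ∈ S, c * x 0 ≤ r x := by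
  suffices h : ∃ c > 0, ∀ x ∈ S, 0 ≤ x 0 → c * x 0 ≤ r x by
    obtain ⟨c, hc, h⟩ := h
    exact ⟨c, hc, fun x hx => h x hx (hS hx).2⟩
  refine hc.induction_on (p := fun S => ∃ c > 0, ∀ x ∈ S, 0 ≤ x 0 → c * x 0 ≤ r x)
    ⟨1, one_pos, by simp⟩ (fun A B hAB ⟨c, hc, h⟩ => ⟨c, hc, fun x hx => h x (hAB hx)⟩) ?_ ?_
  · rintro A B ⟨c, hc, h⟩ ⟨c', hc', h'⟩
    refine ⟨min c c', lt_min hc hc', fun x hx hx0 => ?_⟩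
    rcases hx with hx | hx
    · exact (mul_le_mul_of_nonneg_right (min_le_left _ _) hx0).trans (h x hx hx0)
    · exact (mul_le_mul_of_nonneg_right (min_le_right _ _) hx0).trans (h' x hx hx0)
  intro x hx
  have hxh := hS hx
  rcases (show (0 : ℝ) ≤ x 0 from hxh.2).eq_or_lt with hx0 | hx0
  · have hp := hd x hxh hx0.symm
    set c := fderivWithin ℝ r (halfSet U) x (EuclideanSpace.single 0 1)
    have hc1 : ContinuousOn (fun y => fderivWithin ℝ r (halfSet U) y
        (EuclideanSpace.single 0 1)) (halfSet U) :=
      (hsm.continuousOn_fderivWithin (uniqueDiffOn_halfSet hU) (by simp)).clm_apply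
        continuousOn_const
    have hev := (hc1 x hxh).eventually (lt_mem_nhds (half_lt_self hp))
    obtain ⟨ε, hε, hball⟩ := Metric.mem_nhdsWithin_iff.1 hev
    obtain ⟨δ, hδ, hballU⟩ := Metric.isOpen_iff.1 hU x hxh.1
    refine ⟨Metric.ball x (min ε δ / 2) ∩ S,
      inter_mem (mem_nhdsWithin_of_mem_nhds (Metric.ball_mem_nhds x (by positivity)))
        self_mem_nhdsWithin, c / 2, by positivity, fun y hy hy0 => ?_⟩
    set e : E3 := EuclideanSpace.single 0 1 with he
    -- the foot point of `y` on the boundary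
    set b : E3 := y - y 0 • e with hb
    have hmem : ∀ t ∈ Icc 0 (y 0), b + t • e ∈ halfSet U ∧ dist (b + t • e) x < ε := by
      intro t ht
      have hy1 : ‖y - x‖ < min ε δ / 2 := by simpa [dist_eq_norm] using hy.1
      have hy2 : |y 0 - x 0| ≤ ‖y - x‖ := by simpa using abs_coord_le_norm (y - x) 0
      have hy3 : y 0 ≤ ‖y - x‖ := by rw [← hx0, sub_zero] at hy2; exact (le_abs_self _).trans hy2
      have hdist : dist (b + t • e) x < min ε δ := by
        rw [dist_eq_norm]
        have h1 : b + t • e - x = (y - x) - (y 0 - t) • e := by rw [hb, sub_smul]; abel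
        have h2 : ‖(y 0 - t) • e‖ ≤ y 0 := by
          rw [norm_smul, he]
          simp [abs_of_nonneg (sub_nonneg.2 ht.2), ht.1]
        rw [h1]
        linarith [norm_sub_le (y - x) ((y 0 - t) • e)]
      refine ⟨⟨hballU (Metric.mem_ball.2 (hdist.trans_le (min_le_right _ _))), ?_⟩,
        hdist.trans_le (min_le_left _ _)⟩
      show (0 : ℝ) ≤ (b + t • e) 0
      simpa [hb, he] using ht.1
    have hcoord : ∀ t : ℝ, (b + t • e) 0 = t := fun t => by simp [hb, he]
    have hder : ∀ t ∈ interior (Icc 0 (y 0)),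
        HasDerivAt (fun t : ℝ => r (b + t • e)) (fderivWithin ℝ r (halfSet U) (b + t • e) e) t := by
      intro t ht
      rw [interior_Icc] at ht
      have hm := (hmem t (Ioo_subset_Icc_self ht)).1
      have hnb : halfSet U ∈ 𝓝 (b + t • e) :=
        Filter.mem_of_superset ((hU.inter isOpen_posHalfSpace).mem_nhds
          ⟨hm.1, show (0 : ℝ) < (b + t • e) 0 from (hcoord t).symm ▸ ht.1⟩)
          posSet_subset_halfSet
      have h1 : HasFDerivAt r (fderivWithin ℝ r (halfSet U) (b + t • e)) (b + t • e) :=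
        ((hsm.differentiableOn (by simp) _ hm).hasFDerivWithinAt).hasFDerivAt hnb
      have h2 : HasDerivAt (fun t : ℝ => b + t • e) e t := by
        simpa using ((hasDerivAt_id t).smul_const e).const_add b
      exact h1.comp_hasDerivAt t h2
    have hmvt := (convex_Icc 0 (y 0)).mul_sub_le_image_sub_of_le_deriv
      (f := fun t : ℝ => r (b + t • e)) (C := c / 2)
      (hsm.continuousOn.comp (by fun_prop) fun t ht => (hmem t ht).1)
      (fun t ht => (hder t ht).differentiableAt.differentiableWithinAt)
      (fun t ht => by
        rw [(hder t ht).deriv]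
        have := hmem t (interior_subset ht)
        exact le_of_lt (hball ⟨this.2, this.1⟩))
      0 (left_mem_Icc.2 hy0) (y 0) (right_mem_Icc.2 hy0) hy0
    have hb0 : r (b + (0 : ℝ) • e) = 0 :=
      hzero _ (hmem 0 (left_mem_Icc.2 hy0)).1.1 (hcoord 0)
    have hby : b + y 0 • e = y := by simp [hb]
    simp only [hb0, hby, sub_zero] at hmvt
    exact hmvt
  · have hr := hpos x ⟨hxh.1, hx0⟩
    have h1 : ∀ᶠ y in 𝓝[S] x, r x / 2 < r y :=
      ((hsm.continuousOn x hxh).mono hS).eventually (lt_mem_nhds (half_lt_self hr))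
    have h2 : ∀ᶠ y : E3 in 𝓝[S] x, y 0 < 2 * x 0 := by
      have : Continuous fun y : E3 => y 0 := by fun_prop
      exact (this.continuousWithinAt (s := S) (x := x)).eventually
        (gt_mem_nhds (by linarith : x 0 < 2 * x 0))
    refine ⟨_, h1.and h2, r x / (4 * x 0), by positivity, fun y hy _ => ?_⟩
    calc r x / (4 * x 0) * y 0 ≤ r x / (4 * x 0) * (2 * x 0) := by gcongr; exact hy.2.le
      _ = r x / 2 := by field_simp; ring
      _ ≤ r y := hy.1.le

theorem isBoundaryChart_inChart [IsManifold I3 ∞ M] {ρ : M → ℝ} (hρ : IsDefiningFunction ρ)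
    (hφ : φ ∈ smoothCharts M) : IsBoundaryChart (chartOpen φ) (inChart ρ φ) := by
  have hsm := contDiffOn_inChart hρ.smooth hφ
  have hzero : ∀ x ∈ chartOpen φ, x 0 = 0 → inChart ρ φ x = 0 := fun x hx hx0 =>
    (hρ.zero_iff _).2 ((symm_mem_boundary_iff hφ ⟨hx, hx0.ge⟩).2 hx0)
  refine ⟨isOpen_chartOpen φ, hsm, hzero, fun S hS hc =>
    exists_linear_lower_bound (isOpen_chartOpen φ) hsm hzero (fun x hx => ?_)
      (fun x hx hx0 => fderivWithin_inChart_pos hρ hφ hx hx0) hS hc⟩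
  refine (hρ.nonneg _).lt_of_ne fun h0 => ?_
  have h1 := (symm_mem_boundary_iff hφ (posSet_subset_halfSet hx)).1 ((hρ.zero_iff _).1 h0.symm)
  exact (ne_of_gt hx.2) h1

end ChartGeometry

/-! ### Boundary behaviour of functions of the weighted Hölder classes -/

section BoundaryBehaviour

variable {U : Set E3} {r : E3 → ℝ} {α : ℝ} {n : ℕ} {s : ℤ} {u : E3 → ℝ}

theorem WBdd.of_contDiffOn (hu : ContDiffOn ℝ ∞ u (halfSet U)) : WBdd U r 0 u := fun S hS hc => by
  obtain ⟨C, hC⟩ := hc.exists_bound_of_continuousOn (hu.continuousOn.mono hS)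
  exact ⟨C, fun x hx => by simpa using hC x hx.1⟩

theorem wbdd_self (hc : IsBoundaryChart U r) : WBdd U r (-1) r := fun S _ _ => by
  refine ⟨1, fun x hx => ?_⟩
  have hr := hc.pos hx.2
  rw [Real.rpow_neg_one, Real.norm_of_nonneg hr.le, inv_mul_cancel₀ hr.ne']

theorem exists_mem_posSet (hU : IsOpen U) {S : Set E3} (hS : S ⊆ halfSet U) (hc : IsCompact S) :
    ∃ ε > 0, ∃ S' ⊆ halfSet U, IsCompact S' ∧
      ∀ x ∈ S, ∀ y : E3, 0 < y 0 → ‖x - y‖ ≤ ε → y ∈ S' ∩ posSet U := by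
  obtain ⟨ε, hε, S', hS', hc', h⟩ := exists_compact_thickening hU hS hc
  refine ⟨ε, hε, S', hS', hc', fun x hx y hy hxy => ?_⟩
  have h1 := h x hx y hy.le hxy
  exact ⟨h1, (hS' h1).1, hy⟩

/-- Functions with bounded first derivatives are Lipschitz up to the boundary. -/
theorem WHolder.exists_lipschitz (hc : IsBoundaryChart U r) (hs : s ≤ -1)
    (hu : WHolder U r α (n + 1) s u) {S : Set E3} (hS : S ⊆ halfSet U) (hcS : IsCompact S) :
    ∃ ε > 0, ∃ C ≥ 0, ∀ x ∈ S, ∀ y z : E3, 0 < y 0 → 0 < z 0 → ‖x - y‖ ≤ ε → ‖x - z‖ ≤ ε →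
      |u y - u z| ≤ C * ‖y - z‖ := by
  obtain ⟨ε, hε, S', hS', hc', h⟩ := exists_mem_posSet hc.isOpen hS hcS
  choose C hC0 hC using fun i => ((hu.pd i).wbdd_zero (by omega)).nonneg hS' hc'
  refine ⟨ε, hε, ∑ i, C i, Finset.sum_nonneg fun i _ => hC0 i, fun x hx y z hy hz hxy hxz => ?_⟩
  have hconv : Convex ℝ (Metric.closedBall x ε ∩ {z : E3 | 0 < z 0}) :=
    (convex_closedBall x ε).inter convex_posHalfSpace
  have hmem : ∀ w ∈ Metric.closedBall x ε ∩ {z : E3 | 0 < z 0}, w ∈ S' ∩ posSet U := fun w hw =>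
    h x hx w hw.2 (by rw [← dist_eq_norm, dist_comm]; exact hw.1)
  have hle := hconv.norm_image_sub_le_of_norm_hasFDerivWithin_le (f := u) (f' := fderiv ℝ u)
    (C := ∑ i, C i) (x := z) (y := y)
    (fun w hw => ((hu.differentiableAt hc (hmem w hw).2).hasFDerivAt).hasFDerivWithinAt)
    (fun w hw => (norm_le_sum_abs_basis _).trans (Finset.sum_le_sum fun i _ => by
      simpa [Hyperboloidal.pd] using hC i w (hmem w hw)))
    ⟨by rw [Metric.mem_closedBall, dist_comm, dist_eq_norm]; exact hxz, hz⟩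
    ⟨by rw [Metric.mem_closedBall, dist_comm, dist_eq_norm]; exact hxy, hy⟩
  simpa using hle

/-- Functions with bounded first derivatives have limits at the boundary. -/
theorem WHolder.exists_tendsto (hc : IsBoundaryChart U r) (hs : s ≤ -1)
    (hu : WHolder U r α (n + 1) s u) {x : E3} (hx : x ∈ halfSet U) :
    ∃ l, Tendsto u (𝓝[posSet U] x) (𝓝 l) := by
  obtain ⟨ε, hε, C, hC0, h⟩ := hu.exists_lipschitz hc hs (singleton_subset_iff.2 hx)
    isCompact_singleton
  have hlip : LipschitzOnWith ⟨C, hC0⟩ u (Metric.closedBall x ε ∩ posSet U) :=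
    LipschitzOnWith.of_dist_le_mul fun y hy z hz => by
      rw [dist_eq_norm, dist_eq_norm]
      refine h x rfl y z hy.2.2 hz.2.2 ?_ ?_
      · rw [← dist_eq_norm, dist_comm]; exact hy.1
      · rw [← dist_eq_norm, dist_comm]; exact hz.1
  -- the value of a Lipschitz extension at `x` is the limit
  obtain ⟨v, hv, huv⟩ := hlip.extend_real
  refine ⟨v x, ?_⟩
  refine ((hv.continuous.tendsto x).mono_left nhdsWithin_le_nhds).congr' ?_
  filter_upwards [inter_mem_nhdsWithin (posSet U) (Metric.closedBall_mem_nhds x hε)] with y hy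
  exact (huv ⟨hy.2, hy.1⟩).symm

/-- It is enough to check `u = O(r)` in terms of the coordinate `x 0`, near the boundary. -/
theorem WBdd.neg_one_of_near (hc : IsBoundaryChart U r) (hu : WBdd U r 0 u)
    (h : ∀ S ⊆ halfSet U, IsCompact S → ∃ ε > 0, ∃ C ≥ 0, ∀ x ∈ S ∩ posSet U, x 0 ≤ ε →
      |u x| ≤ C * x 0) : WBdd U r (-1) u := by
  intro S hS hcS
  obtain ⟨ε, hε, C, hC0, hC⟩ := h S hS hcS
  obtain ⟨B, hB0, hB⟩ := hu.nonneg hS hcS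
  obtain ⟨c, hc0, hl⟩ := hc.lower S hS hcS
  refine ⟨max (C / c) (B / (c * ε)), fun x hx => ?_⟩
  have hr := hc.pos hx.2
  have hx0 : 0 < x 0 := hx.2.2
  have h1 := hl x hx.1
  rw [Real.rpow_neg_one, Real.norm_eq_abs, inv_mul_le_iff₀ hr]
  rcases le_total (x 0) ε with hxe | hxe
  · calc |u x| ≤ C * x 0 := hC x hx hxe
      _ = c * x 0 * (C / c) := by field_simp
      _ ≤ r x * max (C / c) (B / (c * ε)) := by gcongr; exact le_max_left _ _
  · calc |u x| ≤ B := by simpa using hB x hx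
      _ = c * ε * (B / (c * ε)) := by field_simp
      _ ≤ c * x 0 * (B / (c * ε)) := by gcongr
      _ ≤ r x * max (C / c) (B / (c * ε)) := by gcongr; exact le_max_right _ _

/-- A Lipschitz function which is zero on the boundary is `O(r)`. -/
theorem WHolder.wbdd_neg_one_of_tendsto (hc : IsBoundaryChart U r) (hs : s ≤ -1)
    (hu : WHolder U r α (n + 1) s u)
    (h0 : ∀ x ∈ U, x 0 = 0 → Tendsto u (𝓝[posSet U] x) (𝓝 0)) : WBdd U r (-1) u := by
  refine WBdd.neg_one_of_near hc (hu.wbdd_zero (by omega)) fun S hS hcS => ?_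
  obtain ⟨ε, hε, C, hC0, hC⟩ := hu.exists_lipschitz hc hs hS hcS
  obtain ⟨ε', hε', S', hS', -, h'⟩ := exists_compact_thickening hc.isOpen hS hcS
  refine ⟨min ε ε', lt_min hε hε', C, hC0, fun x hx hxe => ?_⟩
  have hx0 : 0 < x 0 := hx.2.2
  set e : E3 := EuclideanSpace.single 0 1 with he
  set b : E3 := x - x 0 • e with hb
  have hcoord : ∀ t : ℝ, (b + t • e) 0 = t := fun t => by simp [hb, he]
  have hdist : ∀ t : ℝ, x - (b + t • e) = (x 0 - t) • e := fun t => by rw [hb, sub_smul]; abel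
  have hnorm : ∀ t : ℝ, ‖x - (b + t • e)‖ = |x 0 - t| := fun t => by
    rw [hdist, norm_smul, he]; simp
  have hle : ∀ t ∈ Ioc 0 (x 0), |u x| ≤ C * x 0 + |u (b + t • e)| := by
    intro t ht
    have h1 : ‖x - (b + t • e)‖ ≤ x 0 := by
      rw [hnorm, abs_of_nonneg (sub_nonneg.2 ht.2)]; linarith [ht.1]
    have h2 := hC x hx.1 x (b + t • e) hx0 (by rw [hcoord]; exact ht.1) (by simpa using hε.le)
      (h1.trans (hxe.trans (min_le_left _ _)))
    have h3 : C * ‖x - (b + t • e)‖ ≤ C * x 0 := by gcongr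
    have h4 := abs_sub_abs_le_abs_sub (u x) (u (b + t • e))
    linarith
  have hbU : b ∈ halfSet U := hS' (h' x hx.1 b (by simp [hb, he]) (by
    have := hnorm 0
    rw [zero_smul, add_zero, sub_zero, abs_of_pos hx0] at this
    rw [this]
    exact hxe.trans (min_le_right _ _)))
  have hcont : Tendsto (fun t : ℝ => b + t • e) (𝓝[>] 0) (𝓝[posSet U] b) := by
    refine tendsto_nhdsWithin_iff.2 ⟨?_, ?_⟩
    · have : Continuous fun t : ℝ => b + t • e := by fun_prop
      simpa using (this.tendsto 0).mono_left nhdsWithin_le_nhds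
    · have h5 : Tendsto (fun t : ℝ => b + t • e) (𝓝[>] 0) (𝓝 b) := by
        have : Continuous fun t : ℝ => b + t • e := by fun_prop
        simpa using (this.tendsto 0).mono_left nhdsWithin_le_nhds
      filter_upwards [h5.eventually (hc.isOpen.mem_nhds hbU.1), self_mem_nhdsWithin] with t ht ht0
      exact ⟨ht, show (0 : ℝ) < (b + t • e) 0 from (hcoord t).symm ▸ ht0⟩
  -- compare `u x` with the values on the segment to the foot point `b`, where the limit is zero
  have hlim := (((h0 b hbU.1 (by simp [hb, he])).comp hcont).abs).const_add (C * x 0)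
  rw [abs_zero, add_zero] at hlim
  refine ge_of_tendsto hlim ?_
  filter_upwards [Ioc_mem_nhdsGT hx0] with t ht using hle t ht

/-- A function which is `O(r)` tends to zero at the boundary. -/
theorem WBdd.tendsto_zero (hc : IsBoundaryChart U r) (hu : WBdd U r (-1) u) {x : E3} (hx : x ∈ U)
    (hx0 : x 0 = 0) : Tendsto u (𝓝[posSet U] x) (𝓝 0) := by
  have hxh : x ∈ halfSet U := ⟨hx, hx0.ge⟩
  obtain ⟨ε, hε, S', hS', hc', h⟩ := exists_mem_posSet hc.isOpen (singleton_subset_iff.2 hxh)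
    isCompact_singleton
  obtain ⟨C, hC⟩ := hu S' hS' hc'
  have hr : Tendsto (fun y => r y * C) (𝓝[posSet U] x) (𝓝 0) := by
    have h1 : Tendsto r (𝓝[posSet U] x) (𝓝 (r x)) :=
      (hc.smooth.continuousOn x hxh).mono posSet_subset_halfSet
    simpa [hc.zero x hx hx0] using h1.mul_const C
  refine squeeze_zero_norm' ?_ hr
  filter_upwards [inter_mem_nhdsWithin (posSet U) (Metric.closedBall_mem_nhds x hε)] with y hy
  have h1 := hC y (h x rfl y hy.1.2 (by rw [← dist_eq_norm, dist_comm]; exact hy.2))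
  have hry := hc.pos hy.1
  rwa [Real.rpow_neg_one, inv_mul_le_iff₀ hry] at h1

/-- Being bounded away from zero can be checked pointwise, in terms of limits up to the boundary. -/
theorem AwayFromZero.of_tendsto
    (h : ∀ x ∈ halfSet U, ∃ l ≠ 0, Tendsto u (𝓝[posSet U] x) (𝓝 l)) : AwayFromZero U u := by
  intro S hS hc
  refine hc.induction_on (p := fun S => ∃ c > 0, ∀ x ∈ S ∩ posSet U, c ≤ |u x|)
    ⟨1, one_pos, by simp⟩
    (fun A B hAB ⟨c, hc, h⟩ => ⟨c, hc, fun x hx => h x ⟨hAB hx.1, hx.2⟩⟩) ?_ fun x hx => ?_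
  · rintro A B ⟨c, hc, h⟩ ⟨c', hc', h'⟩
    refine ⟨min c c', lt_min hc hc', ?_⟩
    rintro x ⟨hx | hx, hxp⟩
    · exact (min_le_left _ _).trans (h x ⟨hx, hxp⟩)
    · exact (min_le_right _ _).trans (h' x ⟨hx, hxp⟩)
  · obtain ⟨l, hl, hlim⟩ := h x (hS hx)
    have h1 : ∀ᶠ y in 𝓝[posSet U] x, |l| / 2 < |u y| :=
      hlim.abs.eventually (lt_mem_nhds (half_lt_self (abs_pos.2 hl)))
    obtain ⟨V, hV, hVx⟩ := mem_nhdsWithin_iff_exists_mem_nhds_inter.1 h1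
    exact ⟨V, mem_nhdsWithin_of_mem_nhds hV, |l| / 2, by positivity, fun y hy => (hVx hy).le⟩

/-- If `N - 1 - b r = O(r²)`, where `N` has bounded second derivatives and `b` is Lipschitz, then
`dN - b dr = O(r)`. For a point at distance `s` to the boundary, this follows from the mean value
theorem on a segment of length `s`. -/
theorem wbdd_pd_sub_of_wbdd (hc : IsBoundaryChart U r) (hα : 0 < α ∧ α < 1) {N b : E3 → ℝ}
    (hN : WHolder U r α (n + 2) (-2) N) (hb : WHolder U r α (n + 1) (-1) b)
    (h : WBdd U r (-2) fun x => N x - 1 - b x * r x) (i : Fin 3) :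
    WBdd U r (-1) fun x => pd i N x - b x * pd i r x := by
  have hr : ∀ n s, WHolder U r α n s r := WHolder.of_contDiffOn hc hα hc.smooth
  have hNi : WHolder U r α (n + 1) (-1) (pd i N) := (hN.pd i).mono hc (by norm_num)
  have hri : WHolder U r α (n + 1) (-1) (pd i r) :=
    ((hr (n + 2) (-2)).pd i).mono hc (by norm_num)
  refine WBdd.neg_one_of_near hc
    ((hNi.sub hc hα (hb.mul' hc hα (by norm_num) hri)).wbdd_zero (by norm_num)) fun S hS hcS => ?_
  obtain ⟨ε, hε, S', hS', hc', hS''⟩ := exists_mem_posSet hc.isOpen hS hcS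
  obtain ⟨ε₁, hε₁, C₁, hC₁, h₁⟩ := hNi.exists_lipschitz hc le_rfl hS hcS
  obtain ⟨ε₂, hε₂, C₂, hC₂, h₂⟩ := hri.exists_lipschitz hc le_rfl hS hcS
  obtain ⟨ε₃, hε₃, C₃, hC₃, h₃⟩ := hb.exists_lipschitz hc le_rfl hS hcS
  obtain ⟨B, hB0, hB⟩ := (hb.wbdd_zero (by norm_num)).nonneg hS hcS
  obtain ⟨A, hA0, hA⟩ := h.nonneg hS' hc'
  obtain ⟨R, hR0, hR⟩ := hc.upper hS' hc'
  -- the distance to the boundary is comparable to `s = x 0`, and the segment has length `s`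
  refine ⟨min (min ε ε₁) (min ε₂ ε₃), by positivity,
    (A * (2 * R) ^ 2 + C₃ * (2 * R) + A * (2 * R) ^ 2) + C₁ + B * C₂, by positivity,
    fun x hx hxe => ?_⟩
  have hx0 : 0 < x 0 := hx.2.2
  set s := x 0 with hs
  simp only [le_min_iff] at hxe
  obtain ⟨⟨hxe0, hxe1⟩, hxe2, hxe3⟩ := hxe
  set e : E3 := EuclideanSpace.single i 1 with he
  have hnorm : ∀ t ∈ Icc 0 s, ‖x - (x + t • e)‖ ≤ s := fun t ht => by
    rw [sub_add_cancel_left, norm_neg, norm_smul, he]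
    simpa [abs_of_nonneg ht.1] using ht.2
  have hcoord : ∀ t ∈ Icc 0 s, 0 < (x + t • e) 0 ∧ (x + t • e) 0 ≤ 2 * s := fun t ht => by
    have h0 : 0 ≤ e 0 ∧ e 0 ≤ 1 := by
      rw [he]
      by_cases hi : (0 : Fin 3) = i <;> simp [hi]
    have h1 : (x + t • e) 0 = s + t * e 0 := by simp [hs]
    have h2 : 0 ≤ t * e 0 := mul_nonneg ht.1 h0.1
    have h3 : t * e 0 ≤ s * 1 := mul_le_mul ht.2 h0.2 h0.1 hx0.le
    rw [h1]
    constructor <;> linarith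
  have hmem : ∀ t ∈ Icc 0 s, x + t • e ∈ S' ∩ posSet U := fun t ht =>
    hS'' x hx.1 _ (hcoord t ht).1 ((hnorm t ht).trans hxe0)
  have hrle : ∀ t ∈ Icc 0 s, r (x + t • e) ≤ 2 * R * s := fun t ht =>
    (hR _ (hmem t ht).1).trans (by nlinarith [(hcoord t ht).2])
  have hF : ∀ t ∈ Icc 0 s, |N (x + t • e) - 1 - b (x + t • e) * r (x + t • e)|
      ≤ A * (2 * R) ^ 2 * s ^ 2 := fun t ht => by
    have hp := hc.pos (hmem t ht).2
    have h1 := hA _ (hmem t ht)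
    rw [Real.rpow_neg hp.le, inv_mul_le_iff₀ (by positivity), Real.norm_eq_abs,
      show ((2 : ℝ)) = ((2 : ℕ) : ℝ) by norm_num, Real.rpow_natCast] at h1
    refine h1.trans ?_
    calc r (x + t • e) ^ 2 * A ≤ (2 * R * s) ^ 2 * A := by gcongr; exact hrle t ht
      _ = A * (2 * R) ^ 2 * s ^ 2 := by ring
  -- `b` is frozen at `x`: the terms of `df` are then Lipschitz, as only `N` and `r` are differentiated
  set f : ℝ → ℝ := fun t => N (x + t • e) - b x * r (x + t • e) with hf
  have hline : ∀ t : ℝ, HasDerivAt (fun t : ℝ => x + t • e) e t := fun t => by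
    simpa using ((hasDerivAt_id t).smul_const e).const_add x
  have hder : ∀ t ∈ Icc 0 s, HasDerivAt f (pd i N (x + t • e) - b x * pd i r (x + t • e)) t :=
    fun t ht => by
      have hd1 := ((hN.differentiableAt hc (hmem t ht).2).hasFDerivAt).comp_hasDerivAt t (hline t)
      have hd2 := (((hr 1 0).differentiableAt hc (hmem t ht).2).hasFDerivAt).comp_hasDerivAt t
        (hline t)
      exact hd1.sub (hd2.const_mul (b x))
  obtain ⟨ξ, hξ, hξ'⟩ := exists_hasDerivAt_eq_slope f
    (fun t => pd i N (x + t • e) - b x * pd i r (x + t • e)) hx0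
    (fun t ht => (hder t ht).continuousAt.continuousWithinAt)
    (fun t ht => hder t (Ioo_subset_Icc_self ht))
  have hξI := Ioo_subset_Icc_self hξ
  have h0I : (0 : ℝ) ∈ Icc 0 s := left_mem_Icc.2 hx0.le
  have hsI : s ∈ Icc 0 s := right_mem_Icc.2 hx0.le
  have hfs : |f s - f 0| ≤ (A * (2 * R) ^ 2 + C₃ * (2 * R) + A * (2 * R) ^ 2) * s ^ 2 := by
    have e1 := hF s hsI
    have e2 := hF 0 h0I
    have e3 : |b (x + s • e) - b x| ≤ C₃ * s := by
      have := h₃ x hx.1 (x + s • e) x (hcoord s hsI).1 hx0 ((hnorm s hsI).trans hxe3)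
        (by simpa using hε₃.le)
      refine this.trans ?_
      gcongr
      rw [norm_sub_rev]
      exact hnorm s hsI
    have hp := hc.pos (hmem s hsI).2
    have e4 : |(b (x + s • e) - b x) * r (x + s • e)| ≤ C₃ * (2 * R) * s ^ 2 := by
      rw [abs_mul, abs_of_pos hp]
      calc |b (x + s • e) - b x| * r (x + s • e) ≤ C₃ * s * (2 * R * s) := by
            gcongr
            exact hrle s hsI
        _ = _ := by ring
    rw [zero_smul, add_zero] at e2
    have e5 : f s - f 0 = (N (x + s • e) - 1 - b (x + s • e) * r (x + s • e))
        + (b (x + s • e) - b x) * r (x + s • e) - (N x - 1 - b x * r x) := by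
      simp only [hf, zero_smul, add_zero]; ring
    rw [e5]
    refine (abs_sub _ _).trans ?_
    have := abs_add_le (N (x + s • e) - 1 - b (x + s • e) * r (x + s • e))
      ((b (x + s • e) - b x) * r (x + s • e))
    linarith
  have hslope : |pd i N (x + ξ • e) - b x * pd i r (x + ξ • e)|
      ≤ (A * (2 * R) ^ 2 + C₃ * (2 * R) + A * (2 * R) ^ 2) * s := by
    rw [hξ', sub_zero, abs_div, abs_of_pos hx0, div_le_iff₀ hx0]
    linarith [hfs]
  have hξx : ‖x - (x + ξ • e)‖ ≤ s := hnorm ξ hξI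
  have e1 := h₁ x hx.1 x (x + ξ • e) hx0 (hcoord ξ hξI).1 (by simpa using hε₁.le)
    (hξx.trans hxe1)
  have e2 := h₂ x hx.1 x (x + ξ • e) hx0 (hcoord ξ hξI).1 (by simpa using hε₂.le)
    (hξx.trans hxe2)
  have e3 : |b x| ≤ B := by simpa using hB x hx
  have e4 : |pd i N x - pd i N (x + ξ • e)| ≤ C₁ * s := e1.trans (by gcongr)
  have e5 : |b x * (pd i r x - pd i r (x + ξ • e))| ≤ B * C₂ * s := by
    rw [abs_mul, mul_assoc]
    gcongr
    exact e2.trans (by gcongr)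
  have e6 : pd i N x - b x * pd i r x = (pd i N (x + ξ • e) - b x * pd i r (x + ξ • e))
      + (pd i N x - pd i N (x + ξ • e)) - b x * (pd i r x - pd i r (x + ξ • e)) := by ring
  rw [e6]
  refine (abs_sub _ _).trans ?_
  have := abs_add_le (pd i N (x + ξ • e) - b x * pd i r (x + ξ • e))
    (pd i N x - pd i N (x + ξ • e))
  linarith

end BoundaryBehaviour

/-! ### Metrics with coefficients in the weighted Hölder classes -/

section MetricClasses

variable {U : Set E3} {r : E3 → ℝ} {α : ℝ} {n : ℕ} {s : ℤ}
  {G : E3 → Matrix (Fin 3) (Fin 3) ℝ}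

theorem WHolder.matrix_inv (hc : IsBoundaryChart U r) (hα : 0 < α ∧ α < 1) (hs : s ≤ 0)
    (hG : ∀ i j, WHolder U r α n s fun x => G x i j) (h0 : AwayFromZero U fun x => (G x).det)
    (i j : Fin 3) : WHolder U r α n s fun x => (G x)⁻¹ i j := by
  have hm : ∀ i j k l, WHolder U r α n s fun x => G x i j * G x k l := fun i j k l =>
    (hG i j).mul' hc hα hs (hG k l)
  have hdet : WHolder U r α n s fun x => (G x).det := by
    simp only [det_eq_sum]
    exact WHolder.sum hc hα _ fun j _ => (hG _ _).mul' hc hα hs ((hm _ _ _ _).sub hc hα (hm _ _ _ _))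
  simp only [inv_apply_eq]
  exact (hdet.inv hc hα hs h0).mul' hc hα hs ((hm _ _ _ _).sub hc hα (hm _ _ _ _))

theorem WHolder.christoffel (hc : IsBoundaryChart U r) (hα : 0 < α ∧ α < 1) (hs : s ≤ -1)
    (hG : ∀ i j, WHolder U r α (n + 1) s fun x => G x i j)
    (h0 : AwayFromZero U fun x => (G x).det) (l i j : Fin 3) :
    WHolder U r α n (s + 1) (Hyperboloidal.christoffel G l i j) := by
  unfold Hyperboloidal.christoffel
  refine WHolder.const_mul hc hα _ (WHolder.sum hc hα _ fun m _ => ?_)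
  exact (((WHolder.matrix_inv hc hα (by omega) hG h0 l m).of_succ hc hα).mono hc
    (by omega : s ≤ s + 1)).mul' hc hα (by omega)
    ((((hG m j).pd i).add hc ((hG m i).pd j)).sub hc hα ((hG i j).pd m))

end MetricClasses

section WeakMetrics

variable {U : Set E3} {r : E3 → ℝ} {α : ℝ} {n : ℕ} {s : ℤ}
  {G : E3 → Matrix (Fin 3) (Fin 3) ℝ}

theorem WHolder.contDiffOn (hc : IsBoundaryChart U r) {u : E3 → ℝ} (hu : WHolder U r α n s u) :
    ContDiffOn ℝ n u (posSet U) := by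
  induction n generalizing s u with
  | zero => exact contDiffOn_zero.2 hu.continuousOn
  | succ n ih => exact (contDiffOn_succ_iff_pd hc).2 ⟨hu.1, fun i => ih (hu.pd i)⟩

theorem IsBoundaryChart.wHolder_pd (hc : IsBoundaryChart U r) (hα : 0 < α ∧ α < 1) (m : ℕ) (s : ℤ)
    (i : Fin 3) : WHolder U r α m s (pd i r) :=
  ((WHolder.of_contDiffOn hc hα hc.smooth (m + 1) (s - 1)).pd i).mono hc (by omega)

theorem IsBoundaryChart.contDiffOn_two (hc : IsBoundaryChart U r) : ContDiffOn ℝ 2 r (posSet U) :=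
  ContDiffOn.mono (hc.smooth.of_le ENat.LEInfty.out) posSet_subset_halfSet

/-- `G` is the coordinate expression of a Riemannian metric in the interior which extends
continuously to the boundary as a metric, has bounded first and second derivatives, and `n + 2`
derivatives with the scale invariant bounds. -/
structure IsWeakMetric (U : Set E3) (r : E3 → ℝ) (α : ℝ) (n : ℕ)
    (G : E3 → Matrix (Fin 3) (Fin 3) ℝ) : Prop where
  wHolder : ∀ i j, WHolder U r α (n + 2) (-2) fun x => G x i j
  posDef : ∀ x ∈ posSet U, (G x).PosDef
  det : AwayFromZero U fun x => (G x).det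

namespace IsWeakMetric

theorem isMetricOn (hG : IsWeakMetric U r α n G) (hc : IsBoundaryChart U r) :
    IsMetricOn (posSet U) G :=
  ⟨hc.isOpen_posSet, hG.posDef, fun i j => ((hG.wHolder i j).contDiffOn hc).of_le (by
    exact_mod_cast (by omega : 2 ≤ n + 2))⟩

theorem wHolder' (hG : IsWeakMetric U r α n G) (hc : IsBoundaryChart U r)
    (hα : 0 < α ∧ α < 1) (i j : Fin 3) : WHolder U r α (n + 1) (-1) fun x => G x i j :=
  ((hG.wHolder i j).of_succ hc hα).mono hc (by norm_num)

theorem inv (hG : IsWeakMetric U r α n G) (hc : IsBoundaryChart U r)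
    (hα : 0 < α ∧ α < 1) (i j : Fin 3) : WHolder U r α (n + 2) (-2) fun x => (G x)⁻¹ i j :=
  WHolder.matrix_inv hc hα (by norm_num) hG.wHolder hG.det i j

theorem inv' (hG : IsWeakMetric U r α n G) (hc : IsBoundaryChart U r)
    (hα : 0 < α ∧ α < 1) (i j : Fin 3) : WHolder U r α (n + 1) (-1) fun x => (G x)⁻¹ i j :=
  ((hG.inv hc hα i j).of_succ hc hα).mono hc (by norm_num)

theorem christoffel (hG : IsWeakMetric U r α n G) (hc : IsBoundaryChart U r)
    (hα : 0 < α ∧ α < 1) (l i j : Fin 3) : WHolder U r α (n + 1) (-1) (christoffel G l i j) :=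
  (WHolder.christoffel hc hα (by norm_num) hG.wHolder hG.det l i j).mono hc (by norm_num)

theorem gradSq (hG : IsWeakMetric U r α n G) (hc : IsBoundaryChart U r)
    (hα : 0 < α ∧ α < 1) : WHolder U r α (n + 2) (-2) (gradSq G r) := by
  unfold Hyperboloidal.gradSq
  exact WHolder.sum hc hα _ fun i _ => WHolder.sum hc hα _ fun j _ =>
    ((hG.inv hc hα i j).mul' hc hα (by norm_num) (hc.wHolder_pd hα _ _ i)).mul' hc hα
      (by norm_num) (hc.wHolder_pd hα _ _ j)

theorem gradSq' (hG : IsWeakMetric U r α n G) (hc : IsBoundaryChart U r)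
    (hα : 0 < α ∧ α < 1) : WHolder U r α (n + 1) (-1) (Hyperboloidal.gradSq G r) :=
  ((hG.gradSq hc hα).of_succ hc hα).mono hc (by norm_num)

theorem pd_gradSq (hG : IsWeakMetric U r α n G) (hc : IsBoundaryChart U r)
    (hα : 0 < α ∧ α < 1) (i : Fin 3) : WHolder U r α (n + 1) (-1) (pd i (Hyperboloidal.gradSq G r)) :=
  ((hG.gradSq hc hα).pd i).mono hc (by norm_num)

theorem gradient (hG : IsWeakMetric U r α n G) (hc : IsBoundaryChart U r)
    (hα : 0 < α ∧ α < 1) (i : Fin 3) : WHolder U r α (n + 1) (-1) (gradient G r i) := by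
  unfold Hyperboloidal.gradient
  exact WHolder.sum hc hα _ fun j _ => (hG.inv' hc hα i j).mul' hc hα (by norm_num)
    (hc.wHolder_pd hα _ _ j)

theorem hessian (hG : IsWeakMetric U r α n G) (hc : IsBoundaryChart U r)
    (hα : 0 < α ∧ α < 1) (i j : Fin 3) : WHolder U r α (n + 1) (-1) (hessian G r i j) := by
  unfold Hyperboloidal.hessian
  refine WHolder.sub hc hα (((hc.wHolder_pd hα (n + 2) (-2) j).pd i).mono hc (by norm_num)) ?_
  exact WHolder.sum hc hα _ fun l _ => (hG.christoffel hc hα l i j).mul' hc hα (by norm_num)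
    (hc.wHolder_pd hα _ _ l)

theorem laplacian (hG : IsWeakMetric U r α n G) (hc : IsBoundaryChart U r)
    (hα : 0 < α ∧ α < 1) : WHolder U r α (n + 1) (-1) (laplacian G r) := by
  unfold Hyperboloidal.laplacian trG
  exact WHolder.sum hc hα _ fun i _ => WHolder.sum hc hα _ fun j _ =>
    (hG.inv' hc hα i j).mul' hc hα (by norm_num) (hG.hessian hc hα i j)

theorem tracelessHess (hG : IsWeakMetric U r α n G) (hc : IsBoundaryChart U r)
    (hα : 0 < α ∧ α < 1) (i j : Fin 3) : WHolder U r α (n + 1) (-1) (tracelessHess G r i j) := by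
  unfold Hyperboloidal.tracelessHess
  exact (hG.hessian hc hα i j).sub hc hα (((hG.laplacian hc hα).const_mul hc hα _).mul' hc hα
    (by norm_num) (hG.wHolder' hc hα i j))

theorem calH (hG : IsWeakMetric U r α n G) (hc : IsBoundaryChart U r)
    (hα : 0 < α ∧ α < 1) (i j : Fin 3) : WHolder U r α (n + 1) (-1) (calH G r i j) := by
  have hm : (-1 : ℤ) ≤ 0 := by norm_num
  have hr := hc.wHolder_pd hα (n + 1) (-1)
  have hN := hG.gradSq' hc hα
  have hdN := hG.pd_gradSq hc hα
  have hG1 := hG.wHolder' hc hα i j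
  have hD : WHolder U r α (n + 1) (-1) (gradSqDeriv G r) := by
    unfold gradSqDeriv
    exact WHolder.sum hc hα _ fun l _ => (hG.gradient hc hα l).mul' hc hα hm (hdN l)
  refine WHolder.congr hc (u := polyH G r i j) ?_ fun x hx =>
    ((hG.isMetricOn hc).calH_eq_polyH hc.contDiffOn_two hx i j).symm
  unfold polyH
  simp only [sq]
  refine (((hN.mul' hc hα hm hN).mul' hc hα hm (hG.tracelessHess hc hα i j)).sub hc hα
    (hN.mul' hc hα hm ((WHolder.const_mul hc hα _ (((hdN i).mul' hc hα hm (hr j)).add hc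
      ((hdN j).mul' hc hα hm (hr i)))).sub hc hα ((hD.const_mul hc hα _).mul' hc hα hm hG1)))).add hc ?_
  exact (((hN.const_mul hc hα _).mul' hc hα hm (hG.laplacian hc hα)).add hc
    (hD.const_mul hc hα _)).mul' hc hα hm (((hr i).mul' hc hα hm (hr j)).sub hc hα
      ((hN.const_mul hc hα _).mul' hc hα hm hG1))

theorem scalarCurv (hG : IsWeakMetric U r α n G) (hc : IsBoundaryChart U r)
    (hα : 0 < α ∧ α < 1) : WHolder U r α n 0 (scalarCurv G) := by
  have hΓ : ∀ l i j, WHolder U r α n 0 (Hyperboloidal.christoffel G l i j) := fun l i j =>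
    ((hG.christoffel hc hα l i j).of_succ hc hα).mono hc (by norm_num)
  have hdΓ : ∀ m l i j, WHolder U r α n 0 (pd m (Hyperboloidal.christoffel G l i j)) :=
    fun m l i j => ((hG.christoffel hc hα l i j).pd m).mono hc (by norm_num)
  unfold Hyperboloidal.scalarCurv ricci
  refine WHolder.sum hc hα _ fun i _ => WHolder.sum hc hα _ fun j _ =>
    (((hG.inv' hc hα i j).of_succ hc hα).mono hc (by norm_num)).mul' hc hα le_rfl
      (WHolder.sum hc hα _ fun l _ => ((hdΓ _ _ _ _).sub hc hα (hdΓ _ _ _ _)).add hc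
        (WHolder.sum hc hα _ fun m _ => ((hΓ _ _ _).mul' hc hα le_rfl (hΓ _ _ _)).sub hc hα
          ((hΓ _ _ _).mul' hc hα le_rfl (hΓ _ _ _))))

end IsWeakMetric

/-! ### The Hamiltonian constraint near the boundary -/

theorem WBdd.sum (hc : IsBoundaryChart U r) {e : ℝ} {ι : Type*} (T : Finset ι) {w : ι → E3 → ℝ}
    (h : ∀ a ∈ T, WBdd U r e (w a)) : WBdd U r e fun x => ∑ a ∈ T, w a x := by
  classical
  induction T using Finset.induction_on with
  | empty => exact fun S _ _ => ⟨0, fun x _ => by simp⟩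
  | insert a T ha ih =>
    refine ((h a (by simp)).add (ih fun b hb => h b (by simp [hb])) hc).congr fun x _ => ?_
    rw [Finset.sum_insert ha]

theorem WBdd.const_mul (hc : IsBoundaryChart U r) {e : ℝ} {u : E3 → ℝ} (hu : WBdd U r e u) (c : ℝ) :
    WBdd U r e fun x => c * u x :=
  hu.of_norm_le hc |c| fun x _ => by rw [norm_mul, Real.norm_eq_abs c]

theorem WBdd.sub (hc : IsBoundaryChart U r) {e : ℝ} {u v : E3 → ℝ} (hu : WBdd U r e u)
    (hv : WBdd U r e v) : WBdd U r e fun x => u x - v x :=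
  (hu.add (hv.const_mul hc (-1)) hc).congr fun x _ => by ring

namespace IsMetricOn

variable {D : Set E3} {x : E3}

theorem trG_self (hG : IsMetricOn D G) (hx : x ∈ D) : trG G (G x) x = 3 := by
  have h : trG G (G x) x = ∑ i, ∑ j, (G x)⁻¹ i j * G x j i := by
    unfold trG
    exact Finset.sum_congr rfl fun i _ => Finset.sum_congr rfl fun j _ => by rw [hG.symm hx i j]
  simp [h, hG.sum_inv_mul hx]

theorem sum_raise_metric (hG : IsMetricOn D G) (hx : x ∈ D) (i j : Fin 3) :
    ∑ k, ∑ l, (G x)⁻¹ i k * (G x)⁻¹ j l * G x k l = (G x)⁻¹ i j := by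
  calc ∑ k, ∑ l, (G x)⁻¹ i k * (G x)⁻¹ j l * G x k l
      = ∑ k, (G x)⁻¹ i k * ∑ l, (G x)⁻¹ j l * G x l k := by
        refine Finset.sum_congr rfl fun k _ => ?_
        rw [Finset.mul_sum]
        exact Finset.sum_congr rfl fun l _ => by rw [hG.symm hx l k]; ring
    _ = _ := by simp [hG.sum_inv_mul hx]

/-- `|T - c G|² = |T|² - 2 c tr T + 3 c²`. -/
theorem normSqCov2_sub_smul (hG : IsMetricOn D G) (hx : x ∈ D) (T : Matrix (Fin 3) (Fin 3) ℝ)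
    (c : ℝ) : normSqCov2 G (T - c • G x) x
      = normSqCov2 G T x - 2 * c * trG G T x + 3 * c ^ 2 := by
  have hP := hG.inv_symm hx
  have h1 : ∑ i, ∑ j, ∑ k, ∑ l, (G x)⁻¹ i k * (G x)⁻¹ j l * T i j * G x k l = trG G T x := by
    refine Finset.sum_congr rfl fun i _ => Finset.sum_congr rfl fun j _ => ?_
    rw [← hG.sum_raise_metric hx i j, Finset.sum_mul]
    refine Finset.sum_congr rfl fun k _ => ?_
    rw [Finset.sum_mul]
    exact Finset.sum_congr rfl fun l _ => by ring
  have h2 : ∑ i, ∑ j, ∑ k, ∑ l, (G x)⁻¹ i k * (G x)⁻¹ j l * G x i j * T k l = trG G T x := by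
    refine Eq.trans ?_ h1
    simp only [Fin.sum_univ_three, hP 1 0, hP 2 0, hP 2 1]
    ring
  have h3 : normSqCov2 G (G x) x = 3 := by
    refine Eq.trans ?_ (hG.trG_self hx)
    refine Finset.sum_congr rfl fun i _ => Finset.sum_congr rfl fun j _ => ?_
    rw [← hG.sum_raise_metric hx i j, Finset.sum_mul]
    refine Finset.sum_congr rfl fun k _ => ?_
    rw [Finset.sum_mul]
    exact Finset.sum_congr rfl fun l _ => by ring
  have h4 : normSqCov2 G (T - c • G x) x = normSqCov2 G T x
      - c * ∑ i, ∑ j, ∑ k, ∑ l, (G x)⁻¹ i k * (G x)⁻¹ j l * T i j * G x k l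
      - c * ∑ i, ∑ j, ∑ k, ∑ l, (G x)⁻¹ i k * (G x)⁻¹ j l * G x i j * T k l
      + c ^ 2 * normSqCov2 G (G x) x := by
    simp only [normSqCov2, Finset.mul_sum, ← Finset.sum_sub_distrib, ← Finset.sum_add_distrib,
      Matrix.sub_apply, Matrix.smul_apply, smul_eq_mul]
    exact Finset.sum_congr rfl fun i _ => Finset.sum_congr rfl fun j _ =>
      Finset.sum_congr rfl fun k _ => Finset.sum_congr rfl fun l _ => by ring
  rw [h4, h1, h2, h3]
  ring

end IsMetricOn

variable {g K S : E3 → Matrix (Fin 3) (Fin 3) ℝ} {E B : Fin 3 → E3 → ℝ} {ξ : E3 → ℝ}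

/-- The terms of the Hamiltonian constraint with the second fundamental form. Here `S = r Σ`. -/
theorem IsMetricOn.secondFundamentalForm_terms {D : Set E3} {x : E3} (hG : IsMetricOn D G)
    (hr : ∀ y ∈ D, r y ≠ 0) (hg : ∀ y ∈ D, g y = (r y ^ 2)⁻¹ • G y)
    (hS : ∀ y ∈ D, S y = r y • (K y + g y)) (hx : x ∈ D) (htr : trG g (K x + g x) x = 0) :
    normSqCov2 g (K x) x = r x ^ 2 * normSqCov2 G (S x) x + 3 ∧ trG g (K x) x = -3 := by
  have hrx := hr x hx
  have hi := hG.inv_conformal hr hg hx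
  have hK : K x = (r x)⁻¹ • (S x - (r x)⁻¹ • G x) := by
    rw [hS x hx, smul_sub, smul_smul, smul_smul, inv_mul_cancel₀ hrx, one_smul, hg x hx, ← mul_inv,
      ← sq, add_sub_cancel_right]
  have hc : ∀ (c : ℝ) (T : Matrix (Fin 3) (Fin 3) ℝ), trG g (c • T) x = r x ^ 2 * (c * trG G T x) := by
    intro c T
    simp only [trG, hi, Finset.mul_sum, Matrix.smul_apply, smul_eq_mul]
    exact Finset.sum_congr rfl fun i _ => Finset.sum_congr rfl fun j _ => by ring
  have hn : ∀ (c : ℝ) (T : Matrix (Fin 3) (Fin 3) ℝ),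
      normSqCov2 g (c • T) x = r x ^ 4 * (c ^ 2 * normSqCov2 G T x) := by
    intro c T
    simp only [normSqCov2, hi, Finset.mul_sum, Matrix.smul_apply, smul_eq_mul]
    exact Finset.sum_congr rfl fun i _ => Finset.sum_congr rfl fun j _ =>
      Finset.sum_congr rfl fun k _ => Finset.sum_congr rfl fun l _ => by ring
  have hsub : ∀ (c : ℝ) (T : Matrix (Fin 3) (Fin 3) ℝ),
      trG G (T - c • G x) x = trG G T x - 3 * c := by
    intro c T
    rw [← hG.trG_self hx]
    simp only [trG, Finset.sum_mul, ← Finset.sum_sub_distrib, Matrix.sub_apply, Matrix.smul_apply,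
      smul_eq_mul]
    exact Finset.sum_congr rfl fun i _ => Finset.sum_congr rfl fun j _ => by ring
  have htS : trG G (S x) x = 0 := by
    have h1 : K x + g x = (r x)⁻¹ • S x := by
      rw [hS x hx, smul_smul, inv_mul_cancel₀ hrx, one_smul]
    rw [h1, hc] at htr
    simpa [hrx] using htr
  rw [hK, hc, hn, hsub, hG.normSqCov2_sub_smul hx, htS]
  constructor <;> field_simp <;> ring

/-- The Hamiltonian constraint implies `|dr|² - 1 - (2/3) r Δ r = O(r²)`. -/
theorem wbdd_of_hamiltonian (hG : IsWeakMetric U r α n G) (hc : IsBoundaryChart U r)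
    (hα : 0 < α ∧ α < 1) (hg : ∀ y ∈ posSet U, g y = (r y ^ 2)⁻¹ • G y)
    (hS : ∀ y ∈ posSet U, S y = r y • (K y + g y))
    (htr : ∀ y ∈ posSet U, trG g (K y + g y) y = 0)
    (hSb : ∀ i j, WBdd U r 0 fun x => S x i j) (hE : ∀ i, WBdd U r (-2) (E i))
    (hB : ∀ i, WBdd U r (-2) (B i)) (hξ : WBdd U r (-2) ξ)
    (ham : ∀ x ∈ posSet U, scalarCurv g x - normSqCov2 g (K x) x + trG g (K x) x ^ 2
      = normSqVec g (fun i => E i x) x + normSqVec g (fun i => B i x) x + 2 * ξ x) :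
    WBdd U r (-2) fun x => gradSq G r x - 1 - (2 / 3) * laplacian G r x * r x := by
  have hM := hG.isMetricOn hc
  have hr : ∀ y ∈ posSet U, r y ≠ 0 := fun y hy => (hc.pos hy).ne'
  have hGb : ∀ i j, WBdd U r 0 fun x => G x i j := fun i j =>
    (hG.wHolder i j).wbdd_zero (by norm_num)
  have hPb : ∀ i j, WBdd U r 0 fun x => (G x)⁻¹ i j := fun i j =>
    (hG.inv hc hα i j).wbdd_zero (by norm_num)
  have hm : ∀ {e e' : ℝ} {u v : E3 → ℝ} (c : ℝ), WBdd U r e u → WBdd U r e' v → e + e' = c →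
      WBdd U r c fun x => u x * v x := fun c hu hv h => h ▸ hu.mul hv hc
  have hrr : WBdd U r (-2) fun x => r x * r x :=
    hm _ (wbdd_self hc) (wbdd_self hc) (by norm_num)
  have hnS : WBdd U r 0 fun x => normSqCov2 G (S x) x := by
    unfold normSqCov2
    exact WBdd.sum hc _ fun i _ => WBdd.sum hc _ fun j _ => WBdd.sum hc _ fun k _ =>
      WBdd.sum hc _ fun l _ => hm 0 (hm 0 (hm 0 (hPb _ _) (hPb _ _) (by norm_num)) (hSb _ _)
        (by norm_num)) (hSb _ _) (by norm_num)
  have hrinv : WBdd U r 2 fun x => (r x ^ 2)⁻¹ := fun S _ _ => ⟨1, fun x hx => by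
    have h0 := hc.pos hx.2
    rw [show ((2 : ℝ)) = ((2 : ℕ) : ℝ) by norm_num, Real.rpow_natCast,
      Real.norm_of_nonneg (by positivity), mul_inv_cancel₀ (by positivity)]⟩
  have hvec : ∀ {X : Fin 3 → E3 → ℝ}, (∀ i, WBdd U r (-2) (X i)) →
      WBdd U r (-2) fun x => normSqVec g (fun i => X i x) x := fun {X} hX => by
    refine WBdd.congr (u := fun x => (r x ^ 2)⁻¹ * ∑ i, ∑ j, G x i j * X i x * X j x) ?_
      fun x hx => ?_
    · exact hm (-2) hrinv (WBdd.sum hc _ fun i _ => WBdd.sum hc _ fun j _ =>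
        hm (-4) (hm (-2) (hGb i j) (hX i) (by norm_num)) (hX j) (by norm_num)) (by norm_num)
    · simp only [normSqVec, hg x hx, Finset.mul_sum, Matrix.smul_apply, smul_eq_mul, mul_assoc]
  have hR : WBdd U r 0 (scalarCurv G) := (hG.scalarCurv hc hα).wbdd_zero le_rfl
  have h1 := (hm (-2) hrr (hR.sub hc hnS) (by norm_num)).sub hc
    (((hvec hE).add (hvec hB) hc).add (hξ.const_mul hc 2) hc)
  refine (h1.const_mul hc (1 / 6)).congr fun x hx => ?_
  have h2 := ham x hx
  obtain ⟨h3, h4⟩ := hM.secondFundamentalForm_terms hr hg hS hx (htr x hx)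
  rw [hM.scalarCurv_conformal hr hc.contDiffOn_two hg hx, h3, h4] at h2
  linarith

/-- Where the Hamiltonian constraint holds, `calH` and the traceless Hessian of the defining
function agree at the boundary. -/
theorem wbdd_calH_sub_tracelessHess (hG : IsWeakMetric U r α n G) (hc : IsBoundaryChart U r)
    (hα : 0 < α ∧ α < 1)
    (h : WBdd U r (-2) fun x => gradSq G r x - 1 - (2 / 3) * laplacian G r x * r x) (i j : Fin 3) :
    WBdd U r (-1) fun x => calH G r i j x - tracelessHess G r i j x := by
  set e : Fin 3 → E3 → ℝ := fun i x =>
    pd i (gradSq G r) x - (2 / 3) * laplacian G r x * pd i r x with he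
  have hb : WHolder U r α (n + 1) (-1) fun x => (2 / 3) * laplacian G r x :=
    (hG.laplacian hc hα).const_mul hc hα _
  have heb : ∀ i, WBdd U r (-1) (e i) := fun i =>
    wbdd_pd_sub_of_wbdd hc hα (hG.gradSq hc hα) hb h i
  have hz : ∀ {s : ℤ} {m : ℕ} {u : E3 → ℝ}, s ≤ 0 → WHolder U r α m s u → WBdd U r 0 u :=
    fun hs hu => hu.wbdd_zero hs
  have hN := hz (by norm_num) (hG.gradSq hc hα)
  have hr : ∀ i, WBdd U r 0 (pd i r) := fun i => hz le_rfl (hc.wHolder_pd hα 0 0 i)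
  have hgr : ∀ i, WBdd U r 0 (gradient G r i) := fun i => hz (by norm_num) (hG.gradient hc hα i)
  have hGb := hz (by norm_num) (hG.wHolder i j)
  have hT := hz (by norm_num) (hG.tracelessHess hc hα i j)
  have hm : ∀ {e e' : ℝ} {u v : E3 → ℝ} (c : ℝ), WBdd U r e u → WBdd U r e' v → e + e' = c →
      WBdd U r c fun x => u x * v x := fun c hu hv h => h ▸ hu.mul hv hc
  have h1 : WBdd U r 0 fun _ => (1 : ℝ) := WBdd.of_contDiffOn contDiffOn_const
  have hN1 : WBdd U r (-1) fun x => gradSq G r x - 1 :=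
    ((h.mono_exp hc (by norm_num : (-2 : ℝ) ≤ -1)).add
      (hm (-1) (hz (by norm_num) hb) (wbdd_self hc) (by norm_num)) hc).congr fun x _ => by ring
  have heg : WBdd U r (-1) fun x => ∑ l, e l x * gradient G r l x :=
    WBdd.sum hc _ fun l _ => hm _ (heb l) (hgr l) (by norm_num)
  have h2 := ((hm (-1) hN1 (hm 0 (hN.add h1 hc) hT (by norm_num)) (by norm_num)).sub hc
    (hm (-1) hN (((((hm (-1) (heb i) (hr j) (by norm_num)).add
      (hm (-1) (heb j) (hr i) (by norm_num)) hc).const_mul hc (1 / 2))).sub hc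
        (hm (-1) (heg.const_mul hc (1 / 3)) hGb (by norm_num))) (by norm_num))).add
    (hm (-1) (heg.const_mul hc (1 / 4)) ((hm 0 (hr i) (hr j) (by norm_num)).sub hc
      (hm 0 (hN.const_mul hc (1 / 3)) hGb (by norm_num))) (by norm_num)) hc
  refine h2.congr fun x hx => ?_
  rw [(hG.isMetricOn hc).calH_eq_polyH hc.contDiffOn_two hx]
  exact (IsMetricOn.polyH_sub_tracelessHess G r x (fun i => e i x) (fun i => by simp [he]) i j).symm

end WeakMetrics

/-! ### Tensor fields in charts -/

section TensorFields

variable {M : Type*} [TopologicalSpace M] [ChartedSpace (EuclideanHalfSpace 3) M]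
  {φ ψ : Chart M} {x : E3}

/-- The coordinate vector fields of a chart are smooth. -/
theorem contMDiffOn_coordVec [IsManifold I3 ∞ M] (hφ : φ ∈ smoothCharts M) (i : Fin 3) :
    ContMDiffOn 𝓘(ℝ, E3) I3.tangent ∞
      (fun x => (TotalSpace.mk' E3 ((φ.extend I3).symm x) (coordVec φ x i) : TangentBundle I3 M))
      (halfSet (chartOpen φ)) := by
  have hu : UniqueMDiffOn 𝓘(ℝ, E3) (halfSet (chartOpen φ)) :=
    (uniqueDiffOn_halfSet (isOpen_chartOpen φ)).uniqueMDiffOn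
  have h1 := (contMDiffOn_extend_symm_halfSet hφ).contMDiffOn_tangentMapWithin (m := ∞)
    (by simp) hu
  have h2 : ContMDiffOn 𝓘(ℝ, E3) 𝓘(ℝ, E3).tangent ∞
      (fun x => (TotalSpace.mk' E3 x (EuclideanSpace.single i (1 : ℝ)) :
        TangentBundle 𝓘(ℝ, E3) E3)) (halfSet (chartOpen φ)) :=
    contMDiffOn_vectorSpace_iff_contDiffOn.2 contDiffOn_const
  refine (h1.comp h2 fun x hx => hx).congr fun x hx => ?_
  simp only [Function.comp_apply, tangentMapWithin, coordVec, mfderivWithin_range_eq hφ hx]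

/-- The components of a smooth Riemannian metric are smooth up to the boundary. -/
theorem contDiffOn_cov2Comps [IsManifold I3 ∞ M]
    (h : ContMDiffRiemannianMetric I3 ∞ E3 (fun p : M => TangentSpace I3 p))
    (hφ : φ ∈ smoothCharts M) (J : Fin 2 → Fin 3) :
    ContDiffOn ℝ ∞ (fun x => cov2Comps h.inner φ x J) (halfSet (chartOpen φ)) := by
  rw [← contMDiffOn_iff_contDiffOn]
  have key : ContMDiffOn 𝓘(ℝ, E3) (I3.prod 𝓘(ℝ)) ∞
      (fun x => TotalSpace.mk' ℝ (E := Bundle.Trivial M ℝ) ((φ.extend I3).symm x)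
        (h.inner ((φ.extend I3).symm x) (coordVec φ x (J 0)) (coordVec φ x (J 1))))
      (halfSet (chartOpen φ)) := by
    apply ContMDiffOn.clm_bundle_apply₂ (F₁ := E3) (F₂ := E3)
    · exact h.contMDiff.comp_contMDiffOn (contMDiffOn_extend_symm_halfSet hφ)
    · exact contMDiffOn_coordVec hφ (J 0)
    · exact contMDiffOn_coordVec hφ (J 1)
  intro x hx
  have := key x hx
  simp only [contMDiffWithinAt_totalSpace] at this
  exact this.2

theorem bilin_sum_sum (b : E3 →L[ℝ] E3 →L[ℝ] ℝ) (w : Fin 3 → E3) (c d : Fin 3 → ℝ) :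
    b (∑ i, c i • w i) (∑ j, d j • w j) = ∑ i, ∑ j, c i * d j * b (w i) (w j) := by
  simp only [map_sum, map_smul, FunLike.coe_sum, Finset.sum_apply, smul_apply, smul_eq_mul,
    Finset.mul_sum, mul_assoc]
  rw [Finset.sum_comm]
  refine Finset.sum_congr rfl fun i _ => Finset.sum_congr rfl fun j _ => by ring

/-- The matrix of a scalar product with respect to a frame is positive definite. -/
theorem posDef_of_frame {b : E3 →L[ℝ] E3 →L[ℝ] ℝ} (hs : ∀ v w, b v w = b w v)
    (hp : ∀ v, v ≠ 0 → 0 < b v v) {w : Fin 3 → E3} (hw : ∀ c : Fin 3 → ℝ, ∑ i, c i • w i = 0 → c = 0) :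
    (Matrix.of fun i j => b (w i) (w j)).PosDef := by
  refine Matrix.PosDef.of_dotProduct_mulVec_pos ?_ fun c hc => ?_
  · ext i j
    simp [Matrix.conjTranspose_apply, hs (w j)]
  · have h1 : star c ⬝ᵥ (Matrix.of fun i j => b (w i) (w j)).mulVec c
        = b (∑ i, c i • w i) (∑ j, c j • w j) := by
      rw [bilin_sum_sum]
      simp only [Matrix.mulVec, dotProduct, Matrix.of_apply, star_trivial, Fin.sum_univ_three]
      ring
    rw [h1]
    exact hp _ fun h0 => hc (hw c h0)

theorem eq_sum_single (v : E3) : v = ∑ i, v i • EuclideanSpace.single i (1 : ℝ) := by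
  ext j
  simp [Pi.single_apply]

theorem frame_independent {A L : E3 →L[ℝ] E3} (hAL : A.comp L = ContinuousLinearMap.id ℝ E3)
    {c : Fin 3 → ℝ} (hc : ∑ i, c i • L (EuclideanSpace.single i 1) = 0) : c = 0 := by
  have h1 : L (∑ i, c i • EuclideanSpace.single i (1 : ℝ)) = 0 := by
    simpa only [map_sum, map_smul] using hc
  have h2 := congrArg (fun B : E3 →L[ℝ] E3 => B (∑ i, c i • EuclideanSpace.single i (1 : ℝ))) hAL
  simp only [ContinuousLinearMap.comp_apply, h1, map_zero] at h2
  ext i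
  have := congrArg (fun w : E3 => w i) h2
  simpa [Pi.single_apply] using this.symm

theorem posDef_coordVec (hφ : φ ∈ smoothCharts M) (hx : x ∈ halfSet (chartOpen φ))
    {b : TangentSpace I3 ((φ.extend I3).symm x) →L[ℝ] TangentSpace I3 ((φ.extend I3).symm x) →L[ℝ] ℝ}
    (hb : IsScalarProduct b) :
    (Matrix.of fun i j => b (coordVec φ x i) (coordVec φ x j)).PosDef :=
  posDef_of_frame (b := b) hb.1 hb.2
    fun _ hc => frame_independent (mfderiv_extend_comp_mfderivWithin_symm hφ hx) hc

/-- The differential of a chart, as an endomorphism of `E3`, which is the type of all tangent spaces. -/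
def chartDeriv (φ : Chart M) (p : M) : E3 →L[ℝ] E3 := mfderiv I3 𝓘(ℝ, E3) (φ.extend I3) p

/-- A bilinear form in terms of its matrix in a chart. -/
theorem cov2_apply (hφ : φ ∈ smoothCharts M) {p : M} (hp : p ∈ φ.source) (u : Cov2 M)
    (v w : TangentSpace I3 p) :
    u p v w = ∑ i, ∑ j, chartDeriv φ p v i * chartDeriv φ p w j
      * cov2Comps u φ (φ.extend I3 p) ![i, j] := by
  obtain ⟨x, hx, rfl⟩ : ∃ x ∈ halfSet (chartOpen φ), (φ.extend I3).symm x = p :=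
    ⟨_, extend_mem_halfSet hp, symm_extend_apply hp⟩
  rw [extend_symm_apply hx]
  set b : E3 →L[ℝ] E3 →L[ℝ] ℝ := u ((φ.extend I3).symm x) with hb
  set L : E3 →L[ℝ] E3 := mfderivWithin 𝓘(ℝ, E3) I3 (φ.extend I3).symm (range I3) x with hL
  have hLA : ∀ z : E3, L (chartDeriv φ ((φ.extend I3).symm x) z) = z := fun z =>
    congrArg (fun B : E3 →L[ℝ] E3 => B z) (mfderiv_symm_comp_mfderiv_extend hφ hx)
  have hz : ∀ z : E3, z = ∑ i, chartDeriv φ ((φ.extend I3).symm x) z i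
      • L (EuclideanSpace.single i 1) := fun z => by
    conv_lhs => rw [← hLA z, eq_sum_single (chartDeriv φ ((φ.extend I3).symm x) z)]
    simp only [map_sum, map_smul]
  have h1 : b v w = _ := (congrArg₂ (fun v w : E3 => b v w) (hz v) (hz w)).trans
    (bilin_sum_sum b _ _ _)
  exact h1

/-- Change of charts for the components of a covariant 2-tensor. -/
theorem cov2Comps_change (hψ : ψ ∈ smoothCharts M) (hx : (φ.extend I3).symm x ∈ ψ.source)
    (u : Cov2 M) (J : Fin 2 → Fin 3) :
    cov2Comps u φ x J = ∑ i, ∑ j,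
      chartDeriv ψ ((φ.extend I3).symm x) (coordVec φ x (J 0)) i
      * chartDeriv ψ ((φ.extend I3).symm x) (coordVec φ x (J 1)) j
      * cov2Comps u ψ (ψ.extend I3 ((φ.extend I3).symm x)) ![i, j] :=
  cov2_apply hψ hx u _ _

/-- The differential of a change of charts is continuous. -/
theorem continuousOn_chartDeriv_coordVec (hφ : φ ∈ smoothCharts M) (hψ : ψ ∈ smoothCharts M)
    (j : Fin 3) :
    ContinuousOn (fun x => chartDeriv ψ ((φ.extend I3).symm x) (coordVec φ x j))
      (halfSet (overlapOpen φ ψ)) := by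
  set V := halfSet (overlapOpen φ ψ) with hV
  have hsub : V ⊆ halfSet (chartOpen φ) := fun x hx => (mem_halfSet_overlapOpen.1 hx).1
  have hV' : UniqueDiffOn ℝ V := uniqueDiffOn_halfSet (isOpen_overlapOpen φ ψ)
  have hτ : ContDiffOn ℝ ∞ (ψ.extend I3 ∘ (φ.extend I3).symm) V := by
    rw [← contMDiffOn_iff_contDiffOn]
    refine ContMDiffOn.comp (t := ψ.source) (fun p hp => (ψ.contMDiffAt_extend hψ hp).contMDiffWithinAt)
      ((contMDiffOn_extend_symm_halfSet hφ).mono hsub) fun x hx => (mem_halfSet_overlapOpen.1 hx).2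
  have hcont : ContinuousOn (fun x => fderivWithin ℝ (ψ.extend I3 ∘ (φ.extend I3).symm) V x
      (EuclideanSpace.single j 1)) V :=
    (hτ.continuousOn_fderivWithin hV' (by simp)).clm_apply continuousOn_const
  refine hcont.congr fun x hx => ?_
  obtain ⟨hx1, hx2⟩ := mem_halfSet_overlapOpen.1 hx
  have hVr : V ∈ 𝓝[range I3] x := by
    rw [range_I3, hV, halfSet, inter_comm]
    exact inter_mem_nhdsWithin _ ((isOpen_overlapOpen φ ψ).mem_nhds hx.1)
  have hmd : MDifferentiableWithinAt 𝓘(ℝ, E3) I3 (φ.extend I3).symm V x :=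
    (mdifferentiableWithinAt_extend_symm hφ hx1).mono hsub
  have h1 : mfderivWithin 𝓘(ℝ, E3) 𝓘(ℝ, E3) (ψ.extend I3 ∘ (φ.extend I3).symm) V x
      = (mfderiv I3 𝓘(ℝ, E3) (ψ.extend I3) ((φ.extend I3).symm x)).comp
        (mfderivWithin 𝓘(ℝ, E3) I3 (φ.extend I3).symm V x) :=
    mfderiv_comp_mfderivWithin x (mdifferentiableAt_extend hψ hx2) hmd (hV'.uniqueMDiffOn x hx)
  have h2 : mfderivWithin 𝓘(ℝ, E3) I3 (φ.extend I3).symm (range I3) x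
      = mfderivWithin 𝓘(ℝ, E3) I3 (φ.extend I3).symm V x :=
    hmd.mfderivWithin_mono_of_mem_nhdsWithin (uniqueMDiffWithinAt_range hx1) hVr
  rw [mfderivWithin_eq_fderivWithin] at h1
  rw [chartDeriv, coordVec, h2]
  exact (congrArg (fun B : E3 →L[ℝ] E3 => B (EuclideanSpace.single j 1)) h1).symm

theorem mem_interior_iff [IsManifold I3 ∞ M] (hφ : φ ∈ smoothCharts M)
    (hx : x ∈ halfSet (chartOpen φ)) : (φ.extend I3).symm x ∈ I3.interior M ↔ 0 < x 0 := by
  have h := isInteriorPoint_iff_extend hφ (symm_mem_source hx)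
  rwa [extend_symm_apply hx] at h

/-- A change of charts preserves convergence to a boundary point from the interior. -/
theorem tendsto_change_posSet [IsManifold I3 ∞ M] (hφ : φ ∈ smoothCharts M) (hψ : ψ ∈ smoothCharts M)
    (hx : x ∈ halfSet (overlapOpen φ ψ)) :
    Tendsto (fun y => ψ.extend I3 ((φ.extend I3).symm y)) (𝓝[posSet (chartOpen φ)] x)
      (𝓝[posSet (chartOpen ψ)] (ψ.extend I3 ((φ.extend I3).symm x))) := by
  obtain ⟨hx1, hx2⟩ := mem_halfSet_overlapOpen.1 hx
  refine tendsto_nhdsWithin_iff.2 ⟨?_, ?_⟩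
  · have h1 : ContinuousWithinAt (φ.extend I3).symm (halfSet (chartOpen φ)) x :=
      (contMDiffOn_extend_symm_halfSet hφ).continuousOn x hx1
    have h2 : ContinuousAt (ψ.extend I3) ((φ.extend I3).symm x) :=
      (ψ.contMDiffAt_extend hψ hx2).continuousAt
    exact (h2.comp_continuousWithinAt h1).mono posSet_subset_halfSet
  · filter_upwards [inter_mem_nhdsWithin (posSet (chartOpen φ))
      ((isOpen_overlapOpen φ ψ).mem_nhds hx.1)] with y hy
    have hyh := posSet_subset_halfSet hy.1
    have hys : (φ.extend I3).symm y ∈ ψ.source := hy.2.2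
    have h3 := extend_mem_halfSet (φ := ψ) hys
    refine ⟨h3.1, (mem_interior_iff hψ h3).1 ?_⟩
    rw [symm_extend_apply hys]
    exact (mem_interior_iff hφ hyh).2 hy.1.2

/-- If the components of a 2-tensor have limits at the boundary in every chart, then these limits
are the components of a tensor. -/
theorem exists_hasBoundaryValue [IsManifold I3 ∞ M] (u : Cov2 M)
    (h : ∀ φ ∈ smoothCharts M, ∀ J, ∀ x ∈ halfSet (chartOpen φ),
      ∃ l, Tendsto (fun y => cov2Comps u φ y J) (𝓝[posSet (chartOpen φ)] x) (𝓝 l)) (p : M) :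
    ∃ t, HasBoundaryValue (cov2Comps u) p t := by
  set ψ : Chart M := chartAt (EuclideanHalfSpace 3) p with hψdef
  have hψ : ψ ∈ smoothCharts M := IsManifold.chart_mem_maximalAtlas p
  have hpψ : p ∈ ψ.source := mem_chart_source _ p
  choose L hL using fun J => h ψ hψ J _ (extend_mem_halfSet hpψ)
  -- the limits of the components in the preferred chart at `p` define the tensor
  set t : E3 →L[ℝ] E3 →L[ℝ] ℝ := ∑ i, ∑ j, L ![i, j] •
    ((EuclideanSpace.proj i : E3 →L[ℝ] ℝ).comp (chartDeriv ψ p)).smulRight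
      ((EuclideanSpace.proj j : E3 →L[ℝ] ℝ).comp (chartDeriv ψ p)) with ht
  have hteq : ∀ v w, t v w = ∑ i, ∑ j, chartDeriv ψ p v i * chartDeriv ψ p w j * L ![i, j] := by
    intro v w
    have hproj : ∀ (k : Fin 3) (z : E3), (EuclideanSpace.proj k : E3 →L[ℝ] ℝ) z = z k :=
      fun _ _ => rfl
    simp only [ht, FunLike.coe_sum, Finset.sum_apply, smul_apply, smul_eq_mul,
      ContinuousLinearMap.smulRight_apply, ContinuousLinearMap.comp_apply,
      hproj]
    exact Finset.sum_congr rfl fun i _ => Finset.sum_congr rfl fun j _ => by ring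
  refine ⟨t, fun φ hφ hp J => ?_⟩
  have hx : φ.extend I3 p ∈ halfSet (overlapOpen φ ψ) :=
    mem_halfSet_overlapOpen.2 ⟨extend_mem_halfSet hp, by rwa [symm_extend_apply hp]⟩
  have hq := symm_extend_apply hp
  have hcoef : ∀ j i, Tendsto (fun y => chartDeriv ψ ((φ.extend I3).symm y) (coordVec φ y j) i)
      (𝓝[posSet (chartOpen φ)] (φ.extend I3 p))
      (𝓝 (chartDeriv ψ p (coordVec φ (φ.extend I3 p) j) i)) := fun j i => by
    have h1 := (continuousOn_chartDeriv_coordVec hφ hψ j) _ hx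
    have h2 := ((EuclideanSpace.proj i : E3 →L[ℝ] ℝ).continuous.tendsto _).comp h1
    have h3 : 𝓝[posSet (chartOpen φ)] (φ.extend I3 p)
        ≤ 𝓝[halfSet (overlapOpen φ ψ)] (φ.extend I3 p) := by
      refine nhdsWithin_le_iff.2 ?_
      filter_upwards [inter_mem_nhdsWithin (posSet (chartOpen φ))
        ((isOpen_overlapOpen φ ψ).mem_nhds hx.1)] with y hy
      exact ⟨hy.2, show (0 : ℝ) ≤ y 0 from le_of_lt hy.1.2⟩
    have h4 : Tendsto (fun y => chartDeriv ψ ((φ.extend I3).symm y) (coordVec φ y j) i)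
      (𝓝[posSet (chartOpen φ)] (φ.extend I3 p))
      (𝓝 (chartDeriv ψ ((φ.extend I3).symm (φ.extend I3 p))
        (coordVec φ (φ.extend I3 p) j) i)) := h2.mono_left h3
    rwa [hq] at h4
  have hu : ∀ i j, Tendsto (fun y => cov2Comps u ψ (ψ.extend I3 ((φ.extend I3).symm y)) ![i, j])
      (𝓝[posSet (chartOpen φ)] (φ.extend I3 p)) (𝓝 (L ![i, j])) := fun i j => by
    refine (hL ![i, j]).comp ?_
    have := tendsto_change_posSet hφ hψ hx
    rwa [symm_extend_apply hp] at this
  rw [dom_eq_posSet hφ]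
  have hlim := tendsto_finsetSum Finset.univ fun i _ =>
    tendsto_finsetSum Finset.univ fun j _ => ((hcoef (J 0) i).mul (hcoef (J 1) j)).mul (hu i j)
  have hval := hteq (coordVec φ (φ.extend I3 p) (J 0)) (coordVec φ (φ.extend I3 p) (J 1))
  rw [← hval] at hlim
  refine hlim.congr' ?_
  filter_upwards [mem_nhdsWithin_of_mem_nhds ((isOpen_overlapOpen φ ψ).mem_nhds hx.1)] with y hy
  exact (cov2Comps_change hψ hy.2 u J).symm

end TensorFields

/-! ### The function spaces in charts -/

section FunctionSpaces

variable {M : Type*} [TopologicalSpace M] [ChartedSpace (EuclideanHalfSpace 3) M]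
  [IsManifold I3 ∞ M] {φ : Chart M} {x : E3} {ρ : M → ℝ} {α : ℝ} {n : ℕ}

theorem image_extend_inter_interior (hφ : φ ∈ smoothCharts M) {S : Set M} (hS : S ⊆ φ.source) :
    φ.extend I3 '' (S ∩ I3.interior M) = φ.extend I3 '' S ∩ posSet (chartOpen φ) := by
  have key : ∀ p ∈ S, p ∈ I3.interior M ↔ 0 < (φ.extend I3 p) 0 := fun p hp =>
    isInteriorPoint_iff_extend hφ (hS hp)
  ext y
  constructor
  · rintro ⟨p, ⟨hp, hpi⟩, rfl⟩
    exact ⟨⟨p, hp, rfl⟩, (extend_mem_halfSet (hS hp)).1, (key p hp).1 hpi⟩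
  · rintro ⟨⟨p, hp, rfl⟩, hy⟩
    exact ⟨p, ⟨hp, (key p hp).2 hy.2⟩, rfl⟩

/-- The weighted Hölder spaces in terms of the coordinate ranges of the charts. -/
theorem memHolder_iff {k : ℕ} {δ : ℝ} {r : ℤ} {ι : Type} {u : Comps M ι} :
    MemHolder ρ k α δ r u ↔ ∀ φ ∈ smoothCharts M, ∀ J,
      HolderBounds (chartOpen φ) (inChart ρ φ) α k ((r : ℝ) - δ) fun x => u φ x J := by
  refine forall₂_congr fun φ hφ => forall_congr' fun J => ?_
  rw [dom_eq_posSet hφ, HolderBounds]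
  refine and_congr_right fun _ => ⟨fun h => ?_, fun ⟨h1, h2⟩ S hSc hS => ?_⟩
  · have key : ∀ S' ⊆ halfSet (chartOpen φ), IsCompact S' → ∃ S ⊆ φ.source, IsCompact S ∧
        φ.extend I3 '' (S ∩ I3.interior M) = S' ∩ posSet (chartOpen φ) := fun S' hS' hc => by
      refine ⟨(φ.extend I3).symm '' S', image_subset_iff.2 fun x hx => symm_mem_source (hS' hx),
        hc.image_of_continuousOn ((contMDiffOn_extend_symm_halfSet hφ).continuousOn.mono hS'), ?_⟩
      rw [image_extend_inter_interior hφ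
        (image_subset_iff.2 fun x hx => symm_mem_source (hS' hx)), image_image]
      congr 1
      exact (image_congr fun x hx => extend_symm_apply (hS' hx)).trans (image_id' _)
    refine ⟨fun j hj S' hS' hc => ?_, fun S' hS' hc => ?_⟩
    · obtain ⟨S, hS, hSc, hSS⟩ := key S' hS' hc
      obtain ⟨C, hC, -⟩ := h S hSc hS
      exact ⟨C, fun x hx => hC x (hSS ▸ hx) j hj⟩
    · obtain ⟨S, hS, hSc, hSS⟩ := key S' hS' hc
      obtain ⟨C, -, hC⟩ := h S hSc hS
      exact ⟨C, fun x hx y hy hxy => hC x (hSS ▸ hx) y (hSS ▸ hy) hxy⟩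
  · have hS' : φ.extend I3 '' S ⊆ halfSet (chartOpen φ) :=
      image_subset_iff.2 fun p hp => extend_mem_halfSet (hS hp)
    have hc : IsCompact (φ.extend I3 '' S) :=
      hSc.image_of_continuousOn fun p hp =>
        (φ.contMDiffAt_extend hφ (hS hp)).continuousAt.continuousWithinAt
    rw [image_extend_inter_interior hφ hS]
    choose! C hC using fun j hj => h1 j hj _ hS' hc
    obtain ⟨C', hC'⟩ := h2 _ hS' hc
    refine ⟨∑ j ∈ Finset.range (k + 1), |C j| + |C'|, fun x hx j hj => ?_, fun x hx y hy hxy => ?_⟩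
    · have h3 := Finset.single_le_sum (f := fun j => |C j|) (fun j _ => abs_nonneg _)
        (Finset.mem_range_succ_iff.2 hj)
      have h4 := hC j hj x hx
      have h5 := le_abs_self (C j)
      have h6 := abs_nonneg C'
      linarith
    · refine (hC' x hx y hy hxy).trans ?_
      gcongr
      have := Finset.sum_nonneg fun j (_ : j ∈ Finset.range (k + 1)) => abs_nonneg (C j)
      linarith [le_abs_self C']

/-- The components of the background metric are smooth up to the boundary, hence so are its
Christoffel symbols. -/
theorem wHolder_christoffel_of_smooth (hρ : IsDefiningFunction ρ) (hα : 0 < α ∧ α < 1)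
    (h : ContMDiffRiemannianMetric I3 ∞ E3 (fun p : M => TangentSpace I3 p))
    (hφ : φ ∈ smoothCharts M) (n : ℕ) (s : ℤ) (l i j : Fin 3) :
    WHolder (chartOpen φ) (inChart ρ φ) α n s (christoffel (mat (cov2Comps h.inner) φ) l i j) := by
  have hc := isBoundaryChart_inChart hρ hφ
  have hsm : ∀ i j, ContDiffOn ℝ ∞ (fun x => mat (cov2Comps h.inner) φ x i j)
      (halfSet (chartOpen φ)) := fun i j => contDiffOn_cov2Comps h hφ ![i, j]
  have hdet : AwayFromZero (chartOpen φ) fun x => (mat (cov2Comps h.inner) φ x).det := by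
    refine AwayFromZero.of_tendsto fun x hx => ⟨(mat (cov2Comps h.inner) φ x).det, ?_, ?_⟩
    · exact (posDef_coordVec hφ hx (b := h.inner _) ⟨h.symm _, h.pos _⟩).det_pos.ne'
    · have hcont : ∀ i j, Tendsto (fun x => mat (cov2Comps h.inner) φ x i j)
          (𝓝[posSet (chartOpen φ)] x) (𝓝 (mat (cov2Comps h.inner) φ x i j)) := fun i j =>
        ((hsm i j).continuousOn x hx).mono posSet_subset_halfSet
      simp only [det_eq_sum]
      exact tendsto_finsetSum _ fun j _ => (hcont _ _).mul
        (((hcont _ _).mul (hcont _ _)).sub ((hcont _ _).mul (hcont _ _)))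
  exact (WHolder.christoffel hc hα (min_le_right (s - 1) (-1))
    (fun i j => WHolder.of_contDiffOn hc hα (hsm i j) (n + 1) _) hdet l i j).mono hc (by omega)

/-- A bound of `∇̄ u` improves the weight of the class of `u` by one. -/
theorem wHolder_of_covDeriv (hρ : IsDefiningFunction ρ) (hα : 0 < α ∧ α < 1)
    (h : ContMDiffRiemannianMetric I3 ∞ E3 (fun p : M => TangentSpace I3 p))
    (hφ : φ ∈ smoothCharts M) {m : ℕ} {u : CovComps M m} {s t : ℤ} (hs : s ≤ 0) (hts : t + 1 = s)
    (hu : ∀ J, WHolder (chartOpen φ) (inChart ρ φ) α (n + 1) s fun x => u φ x J)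
    (hdu : ∀ J, WHolder (chartOpen φ) (inChart ρ φ) α n s fun x =>
      covDeriv (cov2Comps h.inner) u φ x J) (J : Fin m → Fin 3) :
    WHolder (chartOpen φ) (inChart ρ φ) α (n + 1) t fun x => u φ x J := by
  have hc := isBoundaryChart_inChart hρ hφ
  have h0 : t.toNat = s.toNat := by omega
  refine ⟨(hu J).1, h0 ▸ (hu J).wbdd, fun i => ?_⟩
  rw [hts]
  refine ((hdu (Fin.cons i J)).add hc (WHolder.sum hc hα Finset.univ fun a _ =>
    WHolder.sum hc hα Finset.univ fun l _ => (wHolder_christoffel_of_smooth hρ hα h hφ n s l i (J a)).mul'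
      hc hα hs ((hu (Function.update J a l)).of_succ hc hα))).congr hc fun x _ => ?_
  simp [covDeriv]

theorem MemScriptC.wHolder (hρ : IsDefiningFunction ρ) {h : CovComps M 2} {k l m q : ℕ}
    {u : CovComps M q} (hu : MemScriptC ρ h k α m u) (hl : l ≤ m) (hφ : φ ∈ smoothCharts M)
    (J : Fin (q + l) → Fin 3) :
    WHolder (chartOpen φ) (inChart ρ φ) α (k - l) 0 fun x => iterCovDeriv h u l φ x J := by
  have h0 := memHolder_iff.1 (hu l hl) φ hφ J
  rw [Int.cast_natCast, sub_self, ← Int.cast_zero] at h0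
  exact (holderBounds_iff_wHolder (isBoundaryChart_inChart hρ hφ) le_rfl).1 h0

theorem MemScriptC.wHolder_one (hρ : IsDefiningFunction ρ) (hα : 0 < α ∧ α < 1)
    (h : ContMDiffRiemannianMetric I3 ∞ E3 (fun p : M => TangentSpace I3 p)) {q : ℕ}
    {u : CovComps M q} (hu : MemScriptC ρ (cov2Comps h.inner) (n + 1) α 1 u)
    (hφ : φ ∈ smoothCharts M) (J : Fin q → Fin 3) :
    WHolder (chartOpen φ) (inChart ρ φ) α (n + 1) (-1) fun x => u φ x J :=
  wHolder_of_covDeriv hρ hα h hφ (s := 0) le_rfl (by norm_num)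
    (fun J => hu.wHolder hρ (l := 0) (by norm_num) hφ J)
    (fun J => hu.wHolder hρ (l := 1) le_rfl hφ J) J

theorem MemScriptC.wHolder_two (hρ : IsDefiningFunction ρ) (hα : 0 < α ∧ α < 1)
    (h : ContMDiffRiemannianMetric I3 ∞ E3 (fun p : M => TangentSpace I3 p)) {q : ℕ}
    {u : CovComps M q} (hu : MemScriptC ρ (cov2Comps h.inner) (n + 2) α 2 u)
    (hφ : φ ∈ smoothCharts M) (J : Fin q → Fin 3) :
    WHolder (chartOpen φ) (inChart ρ φ) α (n + 2) (-2) fun x => u φ x J := by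
  have h1 : ∀ J, WHolder (chartOpen φ) (inChart ρ φ) α (n + 1) 0 fun x =>
      covDeriv (cov2Comps h.inner) u φ x J := fun J => hu.wHolder hρ (l := 1) (by norm_num) hφ J
  refine wHolder_of_covDeriv (n := n + 1) hρ hα h hφ (s := -1) (by norm_num) (by norm_num)
    (wHolder_of_covDeriv (n := n + 1) hρ hα h hφ (s := 0) le_rfl (by norm_num)
      (fun J => hu.wHolder hρ (l := 0) (by norm_num) hφ J) h1)
    (wHolder_of_covDeriv hρ hα h hφ (s := 0) le_rfl (by norm_num) h1
      (fun J => hu.wHolder hρ (l := 2) le_rfl hφ J)) J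

/-! ### Boundary values and weighted bounds -/

theorem EqOnBoundary.tendsto_sub {u v : CovComps M 2} (h : EqOnBoundary u v)
    (hφ : φ ∈ smoothCharts M) (hx : x ∈ chartOpen φ) (hx0 : x 0 = 0) (J : Fin 2 → Fin 3) :
    Tendsto (fun y => u φ y J - v φ y J) (𝓝[posSet (chartOpen φ)] x) (𝓝 0) := by
  have hxh : x ∈ halfSet (chartOpen φ) := ⟨hx, hx0.ge⟩
  obtain ⟨t, hu, hv⟩ := h _ ((symm_mem_boundary_iff hφ hxh).2 hx0)
  have h1 := (hu φ hφ (symm_mem_source hxh) J).sub (hv φ hφ (symm_mem_source hxh) J)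
  rwa [sub_self, extend_symm_apply hxh, dom_eq_posSet hφ] at h1

/-- Tensor components which differ by `O(ρ)` have the same boundary values. -/
theorem HasBoundaryValue.of_wbdd_sub {u v : CovComps M 2} (hρ : IsDefiningFunction ρ) {p : M}
    (hp : p ∈ I3.boundary M) {t} (hu : HasBoundaryValue u p t)
    (h : ∀ φ ∈ smoothCharts M, ∀ J, WBdd (chartOpen φ) (inChart ρ φ) (-1) fun x =>
      u φ x J - v φ x J) : HasBoundaryValue v p t := by
  intro φ hφ hpφ J
  have hxh := extend_mem_halfSet hpφ
  have hx0 : (φ.extend I3 p) 0 = 0 :=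
    (symm_mem_boundary_iff hφ hxh).1 (by rwa [symm_extend_apply hpφ])
  have h1 := (h φ hφ J).tendsto_zero (isBoundaryChart_inChart hρ hφ) hxh.1 hx0
  rw [← dom_eq_posSet hφ] at h1
  have h2 := (hu φ hφ hpφ J).sub h1
  rw [sub_zero] at h2
  exact h2.congr fun x => by ring

end FunctionSpaces

section Data

variable {M : Type*} [TopologicalSpace M] [ChartedSpace (EuclideanHalfSpace 3) M]
  [IsManifold I3 ∞ M] {φ : Chart M} {x : E3} {ρ : M → ℝ} {α : ℝ} {n : ℕ} {g : Cov2 M}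

/-- The determinant of `ḡ` is bounded away from zero up to the boundary, because the boundary value of
`ḡ` is a scalar product. -/
theorem IsWeaklyAH.isWeakMetric (hρ : IsDefiningFunction ρ) (hα : 0 < α ∧ α < 1)
    (h : ContMDiffRiemannianMetric I3 ∞ E3 (fun p : M => TangentSpace I3 p))
    (hg : IsWeaklyAH ρ (cov2Comps h.inner) (n + 2) α g) (hφ : φ ∈ smoothCharts M) :
    IsWeakMetric (chartOpen φ) (inChart ρ φ) α n (mat (cov2Comps (gBar ρ g)) φ) := by
  have hc := isBoundaryChart_inChart hρ hφ
  have hW : ∀ i j, WHolder (chartOpen φ) (inChart ρ φ) α (n + 2) (-2) fun x =>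
      mat (cov2Comps (gBar ρ g)) φ x i j :=
    fun i j => hg.regular.wHolder_two hρ hα h hφ ![i, j]
  have hpos : ∀ x ∈ posSet (chartOpen φ), (mat (cov2Comps (gBar ρ g)) φ x).PosDef := by
    intro x hx
    have hsp := hg.riemannian _ (symm_mem_interior hφ hx)
    have hr : 0 < ρ ((φ.extend I3).symm x) := hc.pos hx
    refine posDef_coordVec hφ (posSet_subset_halfSet hx) (b := gBar ρ g ((φ.extend I3).symm x))
      ⟨fun v w => ?_, fun v hv => ?_⟩
    · exact congrArg (ρ ((φ.extend I3).symm x) ^ 2 * ·) (hsp.1 v w)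
    · exact mul_pos (pow_pos hr 2) (hsp.2 v hv)
  refine ⟨hW, hpos, AwayFromZero.of_tendsto fun x hx => ?_⟩
  have key : ∀ A : Matrix (Fin 3) (Fin 3) ℝ, (∀ i j, Tendsto
      (fun y => mat (cov2Comps (gBar ρ g)) φ y i j) (𝓝[posSet (chartOpen φ)] x) (𝓝 (A i j))) →
      Tendsto (fun y => (mat (cov2Comps (gBar ρ g)) φ y).det) (𝓝[posSet (chartOpen φ)] x)
        (𝓝 A.det) := fun A hA => by
    simp only [det_eq_sum]
    exact tendsto_finsetSum _ fun j _ => (hA _ _).mul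
      (((hA _ _).mul (hA _ _)).sub ((hA _ _).mul (hA _ _)))
  rcases (show (0 : ℝ) ≤ x 0 from hx.2).eq_or_lt with hx0 | hx0
  · obtain ⟨t, ht, htp, -⟩ := hg.boundary _ ((symm_mem_boundary_iff hφ hx).2 hx0.symm)
    refine ⟨_, (posDef_coordVec hφ hx htp).det_pos.ne', key _ fun i j => ?_⟩
    have h1 := ht φ hφ (symm_mem_source hx) ![i, j]
    rw [extend_symm_apply hx, dom_eq_posSet hφ] at h1
    exact h1
  · have hxp : x ∈ posSet (chartOpen φ) := ⟨hx.1, hx0⟩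
    exact ⟨_, (hpos x hxp).det_pos.ne', key _ fun i j => (hW i j).continuousOn x hxp⟩

theorem MemHolder.wbdd {k : ℕ} {δ e : ℝ} {r : ℤ} {ι : Type} {u : Comps M ι}
    (hρ : IsDefiningFunction ρ) (hu : MemHolder ρ k α δ r u) (he : (r : ℝ) - δ = e)
    (hφ : φ ∈ smoothCharts M) (J : ι) :
    WBdd (chartOpen φ) (inChart ρ φ) e fun x => u φ x J := by
  have h1 := (memHolder_iff.1 hu φ hφ J).2.1 0 (Nat.zero_le _)
  rw [he, Nat.cast_zero, add_zero] at h1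
  exact (wbdd_iteratedFDeriv_zero (isBoundaryChart_inChart hρ hφ)).1 h1

variable {vol : ∀ p : M, TangentSpace I3 p [⋀^Fin 3]→ₗ[ℝ] ℝ} {K : Cov2 M} {E B J : VecField M}
  {ξ : M → ℝ}

theorem mat_cov2Comps_eq_smul_gBar (hρ : IsDefiningFunction ρ) (hφ : φ ∈ smoothCharts M)
    (hx : x ∈ posSet (chartOpen φ)) :
    mat (cov2Comps g) φ x = (inChart ρ φ x ^ 2)⁻¹ • mat (cov2Comps (gBar ρ g)) φ x := by
  have hr := (isBoundaryChart_inChart hρ hφ).pos hx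
  have h1 : mat (cov2Comps (gBar ρ g)) φ x = inChart ρ φ x ^ 2 • mat (cov2Comps g) φ x := rfl
  rw [h1, smul_smul, inv_mul_cancel₀ (by positivity), one_smul]

/-- The Hamiltonian constraint makes `calH` and the traceless Hessian agree at the boundary. -/
theorem IsHyperboloidalData.wbdd_calH_sub_tracelessHess (hρ : IsDefiningFunction ρ)
    (hα : 0 < α ∧ α < 1)
    (h : ContMDiffRiemannianMetric I3 ∞ E3 (fun p : M => TangentSpace I3 p))
    (hd : IsHyperboloidalData ρ (cov2Comps h.inner) vol (n + 2) α g K E B J ξ)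
    (hφ : φ ∈ smoothCharts M) (I : Fin 2 → Fin 3) :
    WBdd (chartOpen φ) (inChart ρ φ) (-1) fun x =>
      calHComps ρ g φ x I - tracelessHessComps ρ g φ x I := by
  have hc := isBoundaryChart_inChart hρ hφ
  have hG := hd.metric.isWeakMetric hρ hα h hφ
  have hD := dom_eq_posSet hφ
  have hadd : ∀ y, mat (cov2Comps fun p => K p + g p) φ y
      = mat (cov2Comps K) φ y + mat (cov2Comps g) φ y := fun y => rfl
  refine Hyperboloidal.wbdd_calH_sub_tracelessHess hG hc hα (wbdd_of_hamiltonian hG hc hα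
    (fun y hy => mat_cov2Comps_eq_smul_gBar hρ hφ hy)
    (K := mat (cov2Comps K) φ) (S := mat (cov2Comps (sigmaBar ρ g K)) φ)
    (fun y _ => rfl) (fun y hy => ?_) (fun i j => ?_)
    (fun i => hd.E_regular.wbdd hρ (by norm_num) hφ i)
    (fun i => hd.B_regular.wbdd hρ (by norm_num) hφ i)
    (hd.xi_regular.wbdd hρ (by norm_num) hφ ![]) fun y hy => ?_) (I 0) (I 1)
  · rw [← hadd]
    exact hd.traceless φ hφ y (hD ▸ hy)
  · exact (MemScriptC.wHolder_one hρ hα h (n := n) hd.sigma_regular hφ ![i, j]).wbdd_zero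
      (by norm_num)
  · exact hd.constraints.hamiltonian φ hφ y (hD ▸ hy)

/-- The difference of `Σ̄` and `calH` has one bounded derivative, so that the scale invariant bounds
of weight 3 say no more than that it is `O(ρ)`. -/
theorem IsHyperboloidalData.memHolder_iff_wbdd (hρ : IsDefiningFunction ρ) (hα : 0 < α ∧ α < 1)
    (h : ContMDiffRiemannianMetric I3 ∞ E3 (fun p : M => TangentSpace I3 p))
    (hd : IsHyperboloidalData ρ (cov2Comps h.inner) vol (n + 2) α g K E B J ξ) :
    MemHolder ρ (n + 1) α 3 2 (cov2Comps (sigmaBar ρ g K) - calHComps ρ g) ↔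
      ∀ φ ∈ smoothCharts M, ∀ I, WBdd (chartOpen φ) (inChart ρ φ) (-1) fun x =>
        cov2Comps (sigmaBar ρ g K) φ x I - calHComps ρ g φ x I := by
  rw [memHolder_iff]
  refine forall₂_congr fun φ hφ => forall_congr' fun I => ?_
  rw [show ((2 : ℤ) : ℝ) - 3 = -1 by norm_num]
  have hc := isBoundaryChart_inChart hρ hφ
  exact holderBounds_neg_one_iff hc
    ((MemScriptC.wHolder_one hρ hα h (n := n) hd.sigma_regular hφ I).sub hc hα
      ((hd.metric.isWeakMetric hρ hα h hφ).calH hc hα (I 0) (I 1)))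

end Data

end Hyperboloidal

end

theorem mainTheorem7 {M : Type*} [TopologicalSpace M] [ChartedSpace (EuclideanHalfSpace 3) M]
    [IsManifold (𝓡∂ 3) ∞ M] [CompactSpace M] [T2Space M]
    (ρ : M → ℝ) (hρ : Hyperboloidal.IsDefiningFunction ρ)
    (h : ContMDiffRiemannianMetric (𝓡∂ 3) ∞ (EuclideanSpace ℝ (Fin 3))
      (fun p : M => TangentSpace (𝓡∂ 3) p))
    (hh : ∀ p ∈ (𝓡∂ 3).boundary M,
      Hyperboloidal.IsUnitCovector (h.inner p) (Hyperboloidal.dAt ρ p))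
    (vol : ∀ p : M, TangentSpace (𝓡∂ 3) p [⋀^Fin 3]→ₗ[ℝ] ℝ) (hvol : ∀ p, vol p ≠ 0)
    (k : ℕ) (hk : 2 ≤ k) (α : ℝ) (hα : 0 < α ∧ α < 1)
    (g K : Hyperboloidal.Cov2 M) (E B J : Hyperboloidal.VecField M) (ξ : M → ℝ)
    (hdata : Hyperboloidal.IsHyperboloidalData ρ (Hyperboloidal.cov2Comps h.inner) vol k α
      g K E B J ξ) :
    List.TFAE [
      Hyperboloidal.EqOnBoundary (Hyperboloidal.cov2Comps (Hyperboloidal.sigmaBar ρ g K))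
        (Hyperboloidal.tracelessHessComps ρ g),
      Hyperboloidal.EqOnBoundary (Hyperboloidal.cov2Comps (Hyperboloidal.sigmaBar ρ g K))
        (Hyperboloidal.calHComps ρ g),
      Hyperboloidal.MemHolder ρ (k - 1) α 3 2
        (Hyperboloidal.cov2Comps (Hyperboloidal.sigmaBar ρ g K)
          - Hyperboloidal.calHComps ρ g)] := by
  obtain ⟨n, rfl⟩ := Nat.exists_eq_add_of_le' hk
  have hdiff := fun φ hφ I => hdata.wbdd_calH_sub_tracelessHess hρ hα h (φ := φ) hφ I
  tfae_have 1 ↔ 2 := by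
    refine forall₂_congr fun p hp => exists_congr fun t => and_congr_right fun _ => ⟨fun ht => ?_,
      fun ht => ?_⟩
    · exact ht.of_wbdd_sub hρ hp fun φ hφ I =>
        ((hdiff φ hφ I).const_mul (Hyperboloidal.isBoundaryChart_inChart hρ hφ) (-1)).congr
          fun x _ => by ring
    · exact ht.of_wbdd_sub hρ hp hdiff
  tfae_have 2 ↔ 3 := by
    refine Iff.trans ?_ (hdata.memHolder_iff_wbdd hρ hα h).symm
    have hS := fun φ hφ I => Hyperboloidal.MemScriptC.wHolder_one hρ hα h (n := n)
      hdata.sigma_regular (φ := φ) hφ I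
    refine ⟨fun h2 φ hφ I => ?_, fun h3 p hp => ?_⟩
    · have hc := Hyperboloidal.isBoundaryChart_inChart hρ hφ
      exact ((hS φ hφ I).sub hc hα ((hdata.metric.isWeakMetric hρ hα h hφ).calH hc hα
        (I 0) (I 1))).wbdd_neg_one_of_tendsto hc le_rfl
          fun x hx hx0 => h2.tendsto_sub hφ hx hx0 I
    · obtain ⟨t, ht⟩ := Hyperboloidal.exists_hasBoundaryValue
        (Hyperboloidal.sigmaBar ρ g K) (fun φ hφ I x hx => (hS φ hφ I).exists_tendsto
          (Hyperboloidal.isBoundaryChart_inChart hρ hφ) le_rfl hx) p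
      exact ⟨t, ht, ht.of_wbdd_sub hρ hp h3⟩
  tfae_finish
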